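/- **Setting.** Let $F$ be a finite field with $q$ elements. There are $S\ge 1$ sources; source $i$ holds a matrix $W_i\in F^{a\times b}$ ($a,b\ge 1$). Let $K\ge 1$ with $S\mid K$ and $K\mid bS$, and divide the concatenation $[W_1\,\cdots\,W_S]=[W^{(1)}\,\cdots\,W^{(K)}]$ into $K$ blocks $W^{(j)}\in F^{a\times bS/K}$, so that source $i$ owns the blocks with $(i-1)\frac KS<j\le i\frac KS$. A user holds $U^{(1)},\dots,U^{(K)}\in F^{a\times bS/K}$. The function $h$ takes two $a\times \frac{bS}{K}$ matrices to one, and the entries of its value are polynomials over $F$ in the entries of its arguments; $\deg h$ is the largest total degree of these polynomials. Let $X,A,N\ge0$. Choose distinct $\beta_1,\dots,\beta_{K+X}\in F$ and distinct $\alpha_1,\dots,\alpha_N\in F$ with $\alpha_k\notin\{\beta_1,\dots,\beta_K\}$, and put $\ell_j(z)=\prod_{l\in[K+X]\setminus\{j\}}\frac{z-\beta_l}{\beta_j-\beta_l}$ and $$f^{(i)}(z)=\sum_{t=1}^{X}P^{(i)}_t\,\ell_{K+t}(z)+\sum_{(i-1)\frac KS<j\le i\frac KS}W^{(j)}\ell_j(z),\qquad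 g(z)=\sum_{j=1}^{K}U^{(j)}\ell_j(z)+\sum_{t=1}^{X}Q_t\,\ell_{K+t}(z),$$ where the masks $P^{(i)}_t,Q_t\in F^{a\times bS/K}$ are independent, uniformly distributed, and independent of the data $(W,U)$, whose joint law is arbitrary. Worker $k\in[N]$ receives $f^{(i)}(\alpha_k)$ from each source $i$ and $g(\alpha_k)$ from the user, and its correct response is $Y_k=h\big(\sum_{i}f^{(i)}(\alpha_k),\,g(\alpha_k)\big)$. Put $\hat M=(K+X-1)\deg h+2A$ and $M=\hat M+1$. Let $H$ be Shannon entropy in units of $\log q$ (symbols of $F$). The upload cost of source $i$ is $U_{S_i}=\sum_{k}H(f^{(i)}(\alpha_k))$, that of the user is $U_u=\sum_k H(g(\alpha_k))$, and the entropic download cost is $D=\max_{\mathcal K\subseteq[N],\,|\mathcal K|=M}\sum_{k\in\mathcal K}H(Y_k)$. The size of a message is the base-$q$ logarithm of the number of its possible values as a matrix over $F$. **Theorem 3.2.** 1. If $X\ge1$, then $U_{S_i}=U_u=N\,a\,b\,\frac SK$ for every $i$. 2. Let $M\le N$. The user download cost counted by message size, that is, the maximum over sets of $M$ workers of the total size of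 their responses, is $\big((K+X-1)\deg h+2A+1\big)\,a\,b\,\frac SK$. The entropic download cost satisfies $$D\le\big((K+X-1)\deg h+2A+1\big)\,a\,b\,\tfrac SK ,$$ with equality if and only if there are $M$ workers whose responses $Y_k$ are each uniformly distributed. If $X\ge 1$, then for every $d\ge1$ with $(K+X-1)d+2A+1\le N$ there is an $h$ with $\deg h=d$ for which equality holds for all choices of the points $\alpha_k,\beta_j$ and all laws of the data. 3. There is an absolute constant $C>0$ such that, for every finite field, all sizes as above and every $d$ for which $\hat M=(K+X-1)d+2A\ge3$, there is an algebraic computation tree over $F$ (unit cost for each arithmetic operation $+,-,\times,\div$, each loading of a constant, and each equality test) that decodes within $$C\,a\,b\,\tfrac SK\,\hat M\,\log^2\hat M\,\log\log\hat M$$ operations. That is, for all points $\alpha_k,\beta_j$, every $h$ with $\deg h=d$, all data and masks, and any $M$ distinct responding workers, given as input the points $\alpha_k$ of these workers, the points $\beta_1,\dots,\beta_K$, and $M$ received matrices, at most $A$ of which differ from the correct responses $Y_k$, it outputs $h(W^{(j)},U^{(j)})$ for all $j\in[K]$. The tree depends only on $F$, the sizes and $d$. -/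

import Mathlib

open scoped BigOperators

universe u

noncomputable section

namespace PolyComputing

/-! ## The Lagrange encoding scheme -/

/-- The sizes of an instance: `S` sources, each holding an `a × b` matrix; the joined data
`[W_1 ⋯ W_S]` and the user's data are cut into `K` blocks of `c = b S / K` columns; `X` random
masks; `N` workers, at most `A` of which are byzantine. -/
structure Params where
  S : ℕ
  K : ℕ
  X : ℕ
  N : ℕ
  A : ℕ
  a : ℕ
  b : ℕ
  c : ℕ
  S_pos : 1 ≤ S
  K_pos : 1 ≤ K
  a_pos : 1 ≤ a
  b_pos : 1 ≤ b
  S_dvd_K : S ∣ K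
  block_width : K * c = S * b

/-- A data block `W^(j)`, `U^(j)`, a mask, an encoded share, or a response. -/
abbrev Block (F : Type u) (p : Params) : Type u := Matrix (Fin p.a) (Fin p.c) F

/-- The source matrices `W_1, …, W_S`. -/
abbrev SourceData (F : Type u) (p : Params) : Type u :=
  Fin p.S → Matrix (Fin p.a) (Fin p.b) F

/-- The user's blocks `U^(1), …, U^(K)`. -/
abbrev UserData (F : Type u) (p : Params) : Type u := Fin p.K → Block F p

/-- The masks `P^(i)_t` of the sources and `Q_t` of the user, `t = 1, …, X`. -/
abbrev Masks (F : Type u) (p : Params) : Type u :=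
  (Fin p.S → Fin p.X → Block F p) × (Fin p.X → Block F p)

/-- The concatenation `W = [W_1 W_2 ⋯ W_S]`. -/
def concat {F : Type u} {p : Params} (w : SourceData F p) :
    Matrix (Fin p.a) (Fin (p.S * p.b)) F :=
  Matrix.of fun r t => w (finProdFinEquiv.symm t).1 r (finProdFinEquiv.symm t).2

/-- The block `W^(j)` in the division `W = [W^(1) W^(2) ⋯ W^(K)]`: columns
`j c, …, j c + c - 1` of `W`, counting from zero. -/
def dataBlock {F : Type u} {p : Params} (w : SourceData F p) (j : Fin p.K) : Block F p :=
  Matrix.of fun r t => concat w r (Fin.cast p.block_width (finProdFinEquiv (j, t)))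

/-- The public points of the scheme: distinct `β_1, …, β_{K+X}` and distinct `α_1, …, α_N`, with
no `α_k` among `β_1, …, β_K`. -/
structure Points (F : Type u) (p : Params) where
  β : Fin (p.K + p.X) → F
  α : Fin p.N → F
  β_injective : Function.Injective β
  α_injective : Function.Injective α
  disjoint : ∀ (k : Fin p.N) (j : Fin p.K), α k ≠ β (Fin.castAdd p.X j)

section Encoding

variable {F : Type u} [Field F] {p : Params}

/-- The value at `z` of the Lagrange polynomial `∏_{l ≠ j} (z - β_l) / (β_j - β_l)`. -/
def lagrange (s : Points F p) (j : Fin (p.K + p.X)) (z : F) : F :=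
  (Lagrange.basis Finset.univ s.β j).eval z

/-- The user's encoding polynomial `g`, at `z`. -/
def userEncode (s : Points F p) (v : UserData F p) (Q : Fin p.X → Block F p) (z : F) :
    Block F p :=
  (∑ j : Fin p.K, lagrange s (Fin.castAdd p.X j) z • v j) +
    ∑ t : Fin p.X, lagrange s (Fin.natAdd p.K t) z • Q t

/-- The encoding polynomial `f^(i)` of source `i`, at `z`. The blocks of source `i` are those
with index `i K/S, …, (i + 1) K/S - 1`, counting from zero. -/
def sourceEncode (s : Points F p) (w : SourceData F p)
    (P : Fin p.S → Fin p.X → Block F p) (i : Fin p.S) (z : F) : Block F p :=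
  (∑ t : Fin p.X, lagrange s (Fin.natAdd p.K t) z • P i t) +
    ∑ j : Fin p.K with j.val / (p.K / p.S) = i.val,
      lagrange s (Fin.castAdd p.X j) z • dataBlock w j

/-- The function `h` to be computed, given by polynomials: it takes two blocks to one block, and
each entry of the result is a polynomial in the entries of the first block (variables `Sum.inl`)
and of the second block (variables `Sum.inr`). -/
abbrev PolyMap (F : Type u) [Field F] (p : Params) : Type u :=
  Fin p.a → Fin p.c →
    MvPolynomial ((Fin p.a × Fin p.c) ⊕ (Fin p.a × Fin p.c)) F

/-- The value `h(x, y)`. -/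
def PolyMap.apply (h : PolyMap F p) (x y : Block F p) : Block F p :=
  Matrix.of fun r t =>
    MvPolynomial.eval (Sum.elim (fun e => x e.1 e.2) (fun e => y e.1 e.2)) (h r t)

/-- `deg h`: the largest total degree of an entry. -/
def PolyMap.deg (h : PolyMap F p) : ℕ :=
  Finset.univ.sup fun e : Fin p.a × Fin p.c => (h e.1 e.2).totalDegree

/-- The correct response `Y_k = h(∑_i f^(i)(α_k), g(α_k))` of worker `k`. -/
def response (s : Points F p) (h : PolyMap F p) (w : SourceData F p) (v : UserData F p)
    (m : Masks F p) (k : Fin p.N) : Block F p :=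
  h.apply (∑ i : Fin p.S, sourceEncode s w m.1 i (s.α k)) (userEncode s v m.2 (s.α k))

end Encoding

/-- `M̂ = (K + X - 1) d + 2 A`, where `d` is the degree of the polynomial map. -/
def mHat (p : Params) (d : ℕ) : ℕ := (p.K + p.X - 1) * d + 2 * p.A

/-- The recovery threshold `M = (K + X - 1) d + 2 A + 1`. -/
def threshold (p : Params) (d : ℕ) : ℕ := mHat p d + 1

/-! ## Communication costs -/

section Costs

variable {F : Type u} [Field F] [Fintype F] {p : Params}

/-- Shannon entropy of a law on a finite set, in units of `log q`, `q = |F|`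
(that is, in symbols of `F`). -/
def entropy (F : Type u) [Fintype F] {T : Type u} [Fintype T] (law : PMF T) : ℝ :=
  (∑ x, Real.negMulLog (law x).toReal) / Real.log (Fintype.card F)

/-- The joint law of data and masks: the data have an arbitrary law, and the masks are
independent and uniformly distributed, and independent of the data. -/
def jointLaw (data : PMF (SourceData F p × UserData F p)) :
    PMF ((SourceData F p × UserData F p) × Masks F p) :=
  data.bind fun d => (PMF.uniformOfFintype (Masks F p)).map fun m => (d, m)

/-- The law of the share that source `i` sends to worker `k`. -/
def sourceShareLaw (s : Points F p) (data : PMF (SourceData F p × UserData F p))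
    (i : Fin p.S) (k : Fin p.N) : PMF (Block F p) :=
  (jointLaw data).map fun ω => sourceEncode s ω.1.1 ω.2.1 i (s.α k)

/-- The law of the share that the user sends to worker `k`. -/
def userShareLaw (s : Points F p) (data : PMF (SourceData F p × UserData F p))
    (k : Fin p.N) : PMF (Block F p) :=
  (jointLaw data).map fun ω => userEncode s ω.1.2 ω.2.2 (s.α k)

/-- The law of the response `Y_k`. -/
def responseLaw (s : Points F p) (h : PolyMap F p)
    (data : PMF (SourceData F p × UserData F p)) (k : Fin p.N) : PMF (Block F p) :=
  (jointLaw data).map fun ω => response s h ω.1.1 ω.1.2 ω.2 k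

/-- Upload cost of source `i`: the sum over the workers of the entropies of its shares. -/
def sourceUploadCost (s : Points F p) (data : PMF (SourceData F p × UserData F p))
    (i : Fin p.S) : ℝ :=
  ∑ k : Fin p.N, entropy F (sourceShareLaw s data i k)

/-- Upload cost of the user. -/
def userUploadCost (s : Points F p) (data : PMF (SourceData F p × UserData F p)) : ℝ :=
  ∑ k : Fin p.N, entropy F (userShareLaw s data k)

/-- Entropic download cost of the user: the maximum, over the sets of `M` workers, of the sum of
the entropies of their responses, where `M` is the recovery threshold. -/
def downloadCost (s : Points F p) (h : PolyMap F p)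
    (data : PMF (SourceData F p × UserData F p)) : ℝ :=
  ⨆ 𝒦 : {𝒦 : Finset (Fin p.N) // 𝒦.card = threshold p h.deg},
    ∑ k ∈ 𝒦.1, entropy F (responseLaw s h data k)

/-- Size of a message with values in the finite set `T`, in symbols of `F`: `log_q |T|`. -/
def messageSize (F : Type u) [Fintype F] (T : Type u) [Fintype T] : ℝ :=
  Real.logb (Fintype.card F) (Fintype.card T)

/-- Download cost of the user counted by message size: the maximum, over the sets of `M` workers,
of the total size of the blocks they return. -/
def downloadSize (F : Type u) [Fintype F] (p : Params) (d : ℕ) : ℝ :=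
  ⨆ 𝒦 : {𝒦 : Finset (Fin p.N) // 𝒦.card = threshold p d},
    ∑ _k ∈ 𝒦.1, messageSize F (Block F p)

end Costs

/-! ## Algebraic computation trees -/

/-- The arithmetic operations of a field. -/
inductive ArithOp where
  | add
  | sub
  | mul
  | div

/-- The value of an operation (with the convention `x / 0 = 0`). -/
def ArithOp.eval {F : Type u} [Field F] : ArithOp → F → F → F
  | .add, x, y => x + y
  | .sub, x, y => x - y
  | .mul, x, y => x * y
  | .div, x, y => x / y

/-- Algebraic computation trees over `F`. The registers, which hold elements of `F`, are the
inputs (indexed by `I`) and work registers (indexed by `ℕ`). A tree either halts, naming the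
registers in which the outputs (indexed by `O`) stand, or loads a constant into a register, or
performs an arithmetic operation, or branches on the equality of two registers. -/
inductive CompTree (F : Type u) (I O : Type) : Type u where
  | halt (out : O → I ⊕ ℕ) : CompTree F I O
  | const (dst : I ⊕ ℕ) (x : F) (next : CompTree F I O) : CompTree F I O
  | arith (op : ArithOp) (dst src₁ src₂ : I ⊕ ℕ) (next : CompTree F I O) : CompTree F I O
  | test (src₁ src₂ : I ⊕ ℕ) (ifEq ifNe : CompTree F I O) : CompTree F I O

namespace CompTree

variable {F : Type u} [Field F] {I O : Type}

open Classical in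
/-- The outputs of a tree and the number of executed instructions (constants, arithmetic
operations and tests, each counted once), started on the register contents `e`. -/
def exec : CompTree F I O → (I ⊕ ℕ → F) → (O → F) × ℕ
  | .halt out, e => (fun o => e (out o), 0)
  | .const dst x next, e =>
      let r := next.exec (Function.update e dst x)
      (r.1, r.2 + 1)
  | .arith op dst src₁ src₂ next, e =>
      let r := next.exec (Function.update e dst (op.eval (e src₁) (e src₂)))
      (r.1, r.2 + 1)
  | .test src₁ src₂ ifEq ifNe, e =>
      let r := if e src₁ = e src₂ then ifEq.exec e else ifNe.exec e
      (r.1, r.2 + 1)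

/-- The initial registers: the inputs, and zero in the work registers. -/
def init (x : I → F) : I ⊕ ℕ → F := Sum.elim x fun _ => 0

/-- The outputs on the input `x`. -/
def output (T : CompTree F I O) (x : I → F) : O → F := (T.exec (init x)).1

/-- The number of executed instructions on the input `x`. -/
def cost (T : CompTree F I O) (x : I → F) : ℕ := (T.exec (init x)).2

end CompTree

/-! ## Decoding -/

/-- The inputs of the decoder: the points `α` of the `M` responding workers, the points
`β_1, …, β_K`, and the entries of the `M` received blocks. -/
abbrev DecoderInput (p : Params) (d : ℕ) : Type :=
  Fin (threshold p d) ⊕ Fin p.K ⊕ (Fin (threshold p d) × Fin p.a × Fin p.c)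

/-- The outputs of the decoder: the entries of the `K` blocks `h(W^(j), U^(j))`. -/
abbrev DecoderOutput (p : Params) : Type := Fin p.K × Fin p.a × Fin p.c

/-- What the decoder is given when the workers `κ 0, κ 1, …` respond with the blocks `Z`. -/
def decoderInput {F : Type u} {p : Params} {d : ℕ} (s : Points F p)
    (κ : Fin (threshold p d) ↪ Fin p.N) (Z : Fin (threshold p d) → Block F p) :
    DecoderInput p d → F :=
  Sum.elim (fun t => s.α (κ t))
    (Sum.elim (fun j => s.β (Fin.castAdd p.X j)) (fun e => Z e.1 e.2.1 e.2.2))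

/-- The decoder `T` for degree `d` is correct and uses at most `τ` operations: for every choice of
the points, every polynomial map of degree `d`, all data and masks, every choice of `M` responding
workers, and all received blocks of which at most `A` differ from the correct response, `T` finds
all the blocks `h(W^(j), U^(j))` within `τ` operations. -/
def DecodesWithin {F : Type u} [Field F] {p : Params} {d : ℕ}
    (T : CompTree F (DecoderInput p d) (DecoderOutput p)) (τ : ℝ) : Prop :=
  ∀ (s : Points F p) (h : PolyMap F p), h.deg = d →
    ∀ (w : SourceData F p) (v : UserData F p) (m : Masks F p)
      (κ : Fin (threshold p d) ↪ Fin p.N) (Z : Fin (threshold p d) → Block F p),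
      {t | Z t ≠ response s h w v m (κ t)}.ncard ≤ p.A →
        (∀ (j : Fin p.K) (r : Fin p.a) (t : Fin p.c),
          T.output (decoderInput s κ Z) (j, r, t) = h.apply (dataBlock w j) (v j) r t) ∧
        (T.cost (decoderInput s κ Z) : ℝ) ≤ τ

end PolyComputing

end

/-!
# Costs of Lagrange coded computing

*Communication.* Since `α_k` is none of `β_1, …, β_K`, some mask enters the share of worker `k`
with a nonzero coefficient (`exists_lagrange_ne_zero`). Shifting this mask shifts the share by an
arbitrary block, so the share is uniformly distributed (`map_uniform_of_shift`), whatever the data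
are. By the strict concavity of `x ↦ - x log x`, the entropy of a block is at most its size, with
equality for the uniform distribution only (`entropy_le_messageSize`); this gives the bounds for
the download and the case of equality. For `h(x, y) = x + y^d` the responses are uniformly
distributed, again by shifting a mask (`responseLaw_addPow`).

*Decoding.* Each entry of the correct responses is the value at `α_k` of a polynomial `f` of
degree at most `D = (K + X - 1) d`, whose values at the `β_j` are wanted. Of the more than `D + 2
A` received values `y_k`, at most `A` are wrong. The pairs `(E, N)` of polynomials with `E(α_k)
y_k = N(α_k)` for all `k` form a free module of rank two. In a basis that is reduced for the
degrees `deg E + D` and `deg N`, one row has degree at most `D + A`, and for that row `N = f E`,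
where `E` divides the product of `X - α_k` over the errors (`IntBasis.decode`). Hence `f(β_j) =
N(β_j) / E(β_j)`.

*Complexity.* Polynomials of length `n` are multiplied in `O(n log n log log n)` operations over
any field (`Can.polyMul`): the multiplication is done modulo `1 + X^m + ⋯ + X^{(r-1)m}`, where
powers of `X` serve as roots of unity for a radix-`r` transform over the ring of the coefficients.
Here `r = 2`, and `r = 3` in characteristic two. All other steps take `O(log n)` multiplications
of this length in total, as they proceed by halving. To avoid remainders of polynomials, weights
`ρ_i` on the points `α_i` are represented by their moments `∑ ρ_i α_i^k`: multiplication of the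
weights by the values `P(α_i)` becomes the multiplication by a Hankel matrix (`hankel_moment`),
which is a transposed multiplication of polynomials. In this form a reduced basis is computed by
divide and conquer (`Reach.intBasis`), and the quotients `N(β_j) / E(β_j)` by descent in a
subproduct tree (`Reach.quotients`).

Operations are counted by two inductive predicates: `Can` for straight-line programs, and `Reach`
for programs with divisions and tests. They follow the set of the elements computed so far and, in
the case of `Reach`, the set of the inputs that lead to the given branch. `Reach.exists_compTree`
turns such a computation into a computation tree.
-/

noncomputable section

namespace PolyComputing

open Polynomial Matrix

/-! ### Straight-line programs -/

section StraightLine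

variable (F : Type*) [Field F] {R : Type*} [CommRing R] [Algebra F R]

/-- The element `x` is at the disposal of a program that has already computed the elements of `V`:
it is one of them, or a constant. -/
def Known (V : Set R) (x : R) : Prop := x ∈ V ∨ x ∈ Set.range (algebraMap F R)

/-- From the elements of `V`, at most `τ` ring operations (constants of `F` being free) lead to a
larger set of computed elements with the property `Q`. -/
inductive Can (Q : Set R → Prop) : Set R → ℕ → Prop
  | done {V : Set R} {τ : ℕ} (h : Q V) : Can Q V τ
  | op {V : Set R} {τ : ℕ} {x y : R} (z : R) (hx : Known F V x) (hy : Known F V y)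
      (hz : z = x + y ∨ z = x - y ∨ z = x * y) (h : Can Q (insert z V) τ) : Can Q V (τ + 1)

/-- `p` has length at most `n` (its coefficients from index `n` on vanish), and all its
coefficients satisfy `K`. -/
def CoeffsIn {A : Type*} [Semiring A] (K : A → Prop) (n : ℕ) (p : A[X]) : Prop :=
  (∀ i, n ≤ i → p.coeff i = 0) ∧ ∀ i, K (p.coeff i)

variable {F}

theorem Known.mono {V W : Set R} {x : R} (h : Known F V x) (hVW : V ⊆ W) : Known F W x :=
  h.imp (fun h => hVW h) id

theorem Known.of_mem {V : Set R} {x : R} (h : x ∈ V) : Known F V x := Or.inl h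

theorem Known.const (V : Set R) (c : F) : Known F V (algebraMap F R c) := Or.inr ⟨c, rfl⟩

theorem Known.zero (V : Set R) : Known F V (0 : R) := Or.inr ⟨0, map_zero _⟩

theorem Known.one (V : Set R) : Known F V (1 : R) := Or.inr ⟨1, map_one _⟩

theorem Can.bind {Q Q' : Set R → Prop} {V : Set R} {τ σ : ℕ} (h : Can F Q V τ)
    (k : ∀ V', V ⊆ V' → Q V' → Can F Q' V' σ) : Can F Q' V (τ + σ) := by
  have key : ∀ {Q' : Set R → Prop} {V : Set R} {τ τ' : ℕ}, Can F Q' V τ → τ ≤ τ' →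
      Can F Q' V τ' := by
    intro Q' V τ τ' h
    induction h generalizing τ' with
    | done h => exact fun _ => .done h
    | op z hx hy hz _ ih =>
      intro hle
      obtain ⟨s, rfl⟩ : ∃ s, τ' = s + 1 := ⟨τ' - 1, by omega⟩
      exact .op z hx hy hz (ih (by omega))
  induction h with
  | done h => exact key (k _ subset_rfl h) (by omega)
  | @op V τ x y z hx hy hz _ ih =>
    have := ih fun V' hV' hQ => k V' ((Set.subset_insert _ _).trans hV') hQ
    exact key (.op z hx hy hz this) (by omega)

theorem Can.mono {Q Q' : Set R → Prop} {V : Set R} {τ σ : ℕ} (h : Can F Q V τ) (hτ : τ ≤ σ)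
    (k : ∀ V', V ⊆ V' → Q V' → Q' V') : Can F Q' V σ := by
  obtain ⟨s, rfl⟩ := Nat.exists_eq_add_of_le hτ
  exact h.bind fun V' hV' hQ => .done (k V' hV' hQ)

theorem Can.le {Q : Set R → Prop} {V : Set R} {τ σ : ℕ} (h : Can F Q V τ) (hτ : τ ≤ σ) :
    Can F Q V σ := h.mono hτ fun _ _ h => h

theorem Can.add {V : Set R} {x y : R} (hx : Known F V x) (hy : Known F V y) :
    Can F (Known F · (x + y)) V 1 :=
  .op _ hx hy (.inl rfl) (.done (.of_mem (Set.mem_insert _ _)))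

theorem Can.sub {V : Set R} {x y : R} (hx : Known F V x) (hy : Known F V y) :
    Can F (Known F · (x - y)) V 1 :=
  .op _ hx hy (.inr (.inl rfl)) (.done (.of_mem (Set.mem_insert _ _)))

theorem Can.mul {V : Set R} {x y : R} (hx : Known F V x) (hy : Known F V y) :
    Can F (Known F · (x * y)) V 1 :=
  .op _ hx hy (.inr (.inr rfl)) (.done (.of_mem (Set.mem_insert _ _)))

theorem Can.forall_range {Q : ℕ → Set R → Prop} (hQ : ∀ i V V', V ⊆ V' → Q i V → Q i V')
    {V : Set R} {τ : ℕ} (n : ℕ) (h : ∀ i < n, ∀ V', V ⊆ V' → Can F (Q i) V' τ) :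
    Can F (fun V' => ∀ i < n, Q i V') V (n * τ) := by
  induction n with
  | zero => exact .done fun i hi => absurd hi (Nat.not_lt_zero i)
  | succ n ih =>
    rw [Nat.succ_mul]
    refine (ih fun i hi => h i (by omega)).bind fun V' hV' hall => ?_
    refine (h n (by omega) V' hV').mono le_rfl fun V'' hV'' hn i hi => ?_
    rcases Nat.lt_succ_iff_lt_or_eq.1 hi with hi | rfl
    · exact hQ i _ _ hV'' (hall i hi)
    · exact hn

/-- Sums of terms that cost `τ` operations each. -/
theorem Can.sum {V : Set R} {τ : ℕ} (n : ℕ) (x : ℕ → R)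
    (h : ∀ i < n, ∀ V', V ⊆ V' → Can F (Known F · (x i)) V' τ) :
    Can F (Known F · (∑ i ∈ Finset.range n, x i)) V (n * (τ + 1)) := by
  induction n with
  | zero => exact .done (by simpa using Known.zero V)
  | succ n ih =>
    rw [Nat.succ_mul]
    refine (ih fun i hi => h i (by omega)).bind fun V' hV' hs => ?_
    refine (h n (by omega) V' hV').bind fun V'' hV'' hn => ?_
    rw [Finset.sum_range_succ]
    exact Can.add (hs.mono hV'') hn

section CoeffsIn

variable {A : Type*} [Semiring A] {K K' : A → Prop} {n m : ℕ} {p : A[X]}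

theorem CoeffsIn.imp (h : CoeffsIn K n p) (hK : ∀ x, K x → K' x) : CoeffsIn K' n p :=
  ⟨h.1, fun i => hK _ (h.2 i)⟩

theorem CoeffsIn.mono_length (h : CoeffsIn K n p) (hnm : n ≤ m) : CoeffsIn K m p :=
  ⟨fun i hi => h.1 i (hnm.trans hi), h.2⟩

theorem CoeffsIn.of_lt (hK : K 0) (h₁ : ∀ i, n ≤ i → p.coeff i = 0)
    (h₂ : ∀ i < n, K (p.coeff i)) : CoeffsIn K n p :=
  ⟨h₁, fun i => if hi : i < n then h₂ i hi else by rw [h₁ i (not_lt.1 hi)]; exact hK⟩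

theorem CoeffsIn.eq_sum (h : CoeffsIn K n p) : p = ∑ i ∈ Finset.range n, C (p.coeff i) * X ^ i := by
  ext j
  simp only [finsetSum_coeff, coeff_C_mul, coeff_X_pow, mul_ite, mul_one, mul_zero,
    Finset.sum_ite_eq, Finset.mem_range]
  split_ifs with hj
  · rfl
  · exact h.1 j (not_lt.1 hj)

end CoeffsIn

theorem CoeffsIn.mono {V W : Set R} {n : ℕ} {p : R[X]} (h : CoeffsIn (Known F V) n p)
    (hVW : V ⊆ W) : CoeffsIn (Known F W) n p := h.imp fun _ hx => hx.mono hVW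

/-- A polynomial is computed coefficient by coefficient. Here `K V a` says that `V` contains what
represents the element `a` of some ring `A`. -/
theorem Can.poly {A : Type*} [Semiring A] {K : Set R → A → Prop}
    (hK : ∀ a V V', V ⊆ V' → K V a → K V' a) (hK0 : ∀ V, K V 0) {V : Set R} {n τ : ℕ}
    {c : A[X]} (hc : ∀ i, n ≤ i → c.coeff i = 0)
    (h : ∀ i < n, ∀ V', V ⊆ V' → Can F (fun V'' => K V'' (c.coeff i)) V' τ) :
    Can F (fun V' => CoeffsIn (K V') n c) V (n * τ) :=
  (Can.forall_range (Q := fun i V' => K V' (c.coeff i)) (fun _ V V' => hK _ V V') n h).mono le_rfl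
    fun V' _ hV' => CoeffsIn.of_lt (hK0 V') hc hV'

theorem Can.polyKnown {V : Set R} {n τ : ℕ} {c : R[X]} (hc : ∀ i, n ≤ i → c.coeff i = 0)
    (h : ∀ i < n, ∀ V', V ⊆ V' → Can F (Known F · (c.coeff i)) V' τ) :
    Can F (fun V' => CoeffsIn (Known F V') n c) V (n * τ) :=
  Can.poly (K := Known F) (fun _ _ _ hV h => h.mono hV) (fun V => Known.zero V) hc h

theorem Can.polyAdd {V : Set R} {n : ℕ} {p q : R[X]} (hp : CoeffsIn (Known F V) n p)
    (hq : CoeffsIn (Known F V) n q) : Can F (fun V' => CoeffsIn (Known F V') n (p + q)) V n := by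
  refine (Can.polyKnown (τ := 1) (fun i hi => by simp [hp.1 i hi, hq.1 i hi])
    fun i _ V' hV' => ?_).le (by omega)
  rw [coeff_add]
  exact Can.add ((hp.2 i).mono hV') ((hq.2 i).mono hV')

theorem Can.polySub {V : Set R} {n : ℕ} {p q : R[X]} (hp : CoeffsIn (Known F V) n p)
    (hq : CoeffsIn (Known F V) n q) : Can F (fun V' => CoeffsIn (Known F V') n (p - q)) V n := by
  refine (Can.polyKnown (τ := 1) (fun i hi => by simp [hp.1 i hi, hq.1 i hi])
    fun i _ V' hV' => ?_).le (by omega)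
  rw [coeff_sub]
  exact Can.sub ((hp.2 i).mono hV') ((hq.2 i).mono hV')

theorem Can.polyC_mul {V : Set R} {n : ℕ} {a : R} {p : R[X]} (ha : Known F V a)
    (hp : CoeffsIn (Known F V) n p) :
    Can F (fun V' => CoeffsIn (Known F V') n (C a * p)) V n := by
  refine (Can.polyKnown (τ := 1) (fun i hi => by simp [hp.1 i hi])
    fun i _ V' hV' => ?_).le (by omega)
  rw [coeff_C_mul]
  exact Can.mul (ha.mono hV') ((hp.2 i).mono hV')

theorem coeff_mul_eq_zero_of_length {A : Type*} [CommSemiring A] {p q : A[X]} {n m : ℕ}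
    (hp : ∀ i, n ≤ i → p.coeff i = 0) (hq : ∀ i, m ≤ i → q.coeff i = 0) (i : ℕ)
    (hi : n + m ≤ i + 1) : (p * q).coeff i = 0 := by
  rw [coeff_mul]
  refine Finset.sum_eq_zero fun x hx => ?_
  rw [Finset.HasAntidiagonal.mem_antidiagonal] at hx
  by_cases h : n ≤ x.1
  · rw [hp _ h, zero_mul]
  · rw [hq _ (by omega), mul_zero]

theorem coeff_mul_of_length {A : Type*} [CommSemiring A] {p q : A[X]} {n : ℕ}
    (hp : ∀ i, n ≤ i → p.coeff i = 0) (i : ℕ) :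
    (p * q).coeff i
      = ∑ j ∈ Finset.range n, p.coeff j * (if j ≤ i then q.coeff (i - j) else 0) := by
  have h : CoeffsIn (fun _ => True) n p := ⟨hp, fun _ => trivial⟩
  conv_lhs => rw [h.eq_sum]
  simp only [Finset.sum_mul, finsetSum_coeff, mul_assoc, coeff_C_mul, coeff_X_pow_mul']

/-- Multiplication by the definition of the product. -/
theorem Can.polyMulNaive {V : Set R} {n : ℕ} {p q : R[X]} (hp : CoeffsIn (Known F V) n p)
    (hq : CoeffsIn (Known F V) n q) :
    Can F (fun V' => CoeffsIn (Known F V') (2 * n) (p * q)) V (2 * n * (n * 2)) := by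
  refine Can.polyKnown
    (fun i hi => coeff_mul_eq_zero_of_length hp.1 hq.1 i (by omega)) fun i _ V' hV' => ?_
  rw [coeff_mul_of_length hp.1 i]
  refine Can.sum n _ fun j _ W hW => Can.mul ((hp.2 j).mono (hV'.trans hW)) ?_
  split_ifs
  · exact (hq.2 _).mono (hV'.trans hW)
  · exact Known.zero _

end StraightLine

/-! ### Radix-`r` Fourier multiplication over a ring with a principal root of unity -/

section Chunks

variable {A : Type*} [CommRing A]

/-- The `k`-th of the pieces of length `t` into which the coefficients of `a` are cut. -/
def chunk (t : ℕ) (a : A[X]) (k : ℕ) : A[X] :=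
  ∑ s ∈ Finset.range t, C (a.coeff (t * k + s)) * X ^ s

theorem coeff_chunk (t : ℕ) (a : A[X]) (k s : ℕ) :
    (chunk t a k).coeff s = if s < t then a.coeff (t * k + s) else 0 := by
  simp [chunk, coeff_X_pow]

theorem coeff_sum_mul_X_pow {t : ℕ} (ht : 0 < t) (n : ℕ) (q : ℕ → A[X])
    (hq : ∀ k < n, ∀ i, t ≤ i → (q k).coeff i = 0) (i : ℕ) :
    (∑ k ∈ Finset.range n, q k * X ^ (t * k)).coeff i
      = if i / t < n then (q (i / t)).coeff (i % t) else 0 := by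
  have key : ∀ k < n, (q k * X ^ (t * k)).coeff i
      = if i / t = k then (q (i / t)).coeff (i % t) else 0 := by
    intro k hk
    rw [coeff_mul_X_pow']
    split_ifs with h1 h2 h2
    · subst h2
      rw [Nat.mod_eq_sub_mul_div]
    · refine hq k hk _ ?_
      by_contra h3
      push Not at h3
      refine h2 ((Nat.div_eq_iff ht).2 ⟨?_, ?_⟩)
      · rw [mul_comm]; exact h1
      · rw [mul_comm k]; omega
    · exact absurd (h2 ▸ Nat.mul_div_le i t) h1
    · rfl
  rw [finsetSum_coeff, Finset.sum_congr rfl fun k hk => key k (Finset.mem_range.1 hk)]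
  simp

theorem eq_sum_chunk {t : ℕ} (ht : 0 < t) (n : ℕ) {a : A[X]}
    (ha : ∀ i, t * n ≤ i → a.coeff i = 0) :
    a = ∑ k ∈ Finset.range n, chunk t a k * X ^ (t * k) := by
  ext i
  rw [coeff_sum_mul_X_pow ht n _ fun k _ i hi => by rw [coeff_chunk, if_neg (not_lt.2 hi)]]
  split_ifs with h
  · rw [coeff_chunk, if_pos (Nat.mod_lt _ ht), Nat.div_add_mod]
  · refine ha i ?_
    rw [not_lt, Nat.le_div_iff_mul_le ht] at h
    rwa [mul_comm]

/-- The remainder of `∑_{k < r} a_k X^{t k}` modulo `X^t - u`. -/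
def foldAt (t r : ℕ) (u : A) (a : A[X]) : A[X] :=
  ∑ k ∈ Finset.range r, C (u ^ k) * chunk t a k

theorem dvd_sub_foldAt {t r : ℕ} (ht : 0 < t) (u : A) {a : A[X]}
    (ha : ∀ i, t * r ≤ i → a.coeff i = 0) : X ^ t - C u ∣ a - foldAt t r u a := by
  have h : a - foldAt t r u a
      = ∑ k ∈ Finset.range r, (chunk t a k * X ^ (t * k) - C (u ^ k) * chunk t a k) := by
    rw [Finset.sum_sub_distrib, ← eq_sum_chunk ht r ha, foldAt]
  rw [h]
  refine Finset.dvd_sum fun k _ => ?_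
  rw [mul_comm (C _), ← mul_sub, pow_mul, C_pow]
  exact Dvd.dvd.mul_left (sub_dvd_pow_sub_pow _ _ _) _

theorem coeff_foldAt (t r : ℕ) (u : A) (a : A[X]) (s : ℕ) :
    (foldAt t r u a).coeff s
      = if s < t then ∑ k ∈ Finset.range r, u ^ k * a.coeff (t * k + s) else 0 := by
  simp only [foldAt, finsetSum_coeff, coeff_C_mul, coeff_chunk]
  split_ifs <;> simp

/-- A scalar multiple of the idempotent of the factor `X^t - u` of `X^{tr} - u^r`. -/
theorem idempotent_mul (t r : ℕ) {u v : A} (huv : u * v = 1) :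
    (∑ k ∈ Finset.range r, C (v ^ k) * X ^ (t * k)) * (X ^ t - C u)
      = C (u * v ^ r) * (X ^ (t * r) - C (u ^ r)) := by
  have h1 : (X ^ t - C u : A[X]) = C u * (C v * X ^ t - 1) := by
    rw [mul_sub, ← mul_assoc, ← C_mul, huv, C_1, one_mul, mul_one]
  have h2 : (∑ k ∈ Finset.range r, C (v ^ k) * X ^ (t * k) : A[X])
      = ∑ k ∈ Finset.range r, (C v * X ^ t) ^ k :=
    Finset.sum_congr rfl fun k _ => by rw [mul_pow, C_pow, pow_mul]
  have h3 : v ^ r * u ^ r = 1 := by rw [← mul_pow, mul_comm v, huv, one_pow]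
  rw [h1, h2, mul_left_comm, geom_sum_mul, mul_pow, ← pow_mul, C_mul, mul_assoc,
    mul_sub (C (v ^ r)), ← C_mul, h3, C_1, C_pow]

end Chunks

section Fourier

variable {F : Type*} [Field F] {R : Type*} [CommRing R] [Algebra F R]

/-- `A` is a ring whose elements are represented by elements of `R`: `K V a` says that `V`
contains what represents `a`. A linear operation `a + ζ^e b`, a subtraction, or a multiplication
by the constant `ρ` costs `lin` operations in `R`, a multiplication costs `mul` operations. -/
structure CostedRing (F : Type*) [Field F] {R : Type*} [CommRing R] [Algebra F R]
    {A : Type*} [CommRing A] (K : Set R → A → Prop) (ζ ρ : A) (lin mul : ℕ) : Prop where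
  mono : ∀ a V V', V ⊆ V' → K V a → K V' a
  zero : ∀ V, K V 0
  add_pow_mul : ∀ V a b e, K V a → K V b → Can F (fun V' => K V' (a + ζ ^ e * b)) V lin
  sub : ∀ V a b, K V a → K V b → Can F (fun V' => K V' (a - b)) V lin
  const_mul : ∀ V a, K V a → Can F (fun V' => K V' (ρ * a)) V lin
  mul : ∀ V a b, K V a → K V b → Can F (fun V' => K V' (a * b)) V mul

variable {A : Type*} [CommRing A] {K : Set R → A → Prop} {ζ ρ : A} {lin mul : ℕ}

theorem CostedRing.linComb (hK : CostedRing F K ζ ρ lin mul) {V : Set R} (r : ℕ) (e : ℕ → ℕ)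
    (x : ℕ → A) (hx : ∀ k < r, K V (x k)) :
    Can F (fun V' => K V' (∑ k ∈ Finset.range r, ζ ^ e k * x k)) V (r * lin) := by
  induction r with
  | zero => exact .done (by simpa using hK.zero V)
  | succ r ih =>
    rw [Nat.succ_mul]
    refine (ih fun i hi => hx i (by omega)).bind fun V' hV' hs => ?_
    rw [Finset.sum_range_succ]
    exact hK.add_pow_mul _ _ _ _ hs (hK.mono _ _ _ hV' (hx r (by omega)))

theorem CostedRing.polyMono (hK : CostedRing F K ζ ρ lin mul) {V V' : Set R} {n : ℕ} {p : A[X]}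
    (h : CoeffsIn (K V) n p) (hV : V ⊆ V') : CoeffsIn (K V') n p :=
  h.imp fun _ => hK.mono _ _ _ hV

theorem CostedRing.foldAt (hK : CostedRing F K ζ ρ lin mul) {V : Set R} {t r : ℕ} (e : ℕ)
    {a : A[X]} (ha : CoeffsIn (K V) (t * r) a) :
    Can F (fun V' => CoeffsIn (K V') t (foldAt t r (ζ ^ e) a)) V (t * (r * lin)) := by
  refine Can.poly hK.mono hK.zero (fun i hi => ?_) fun i hi V' hV' => ?_
  · rw [coeff_foldAt, if_neg (not_lt.2 hi)]
  · rw [coeff_foldAt, if_pos hi]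
    simp only [← pow_mul]
    exact hK.linComb r _ _ fun k _ => hK.mono _ _ _ hV' (ha.2 _)

/-- One radix-`r` step: the factors `a`, `b` are reduced modulo `X^t - u_j` for `j₀ ≤ j < r`,
multiplied there, and the products `q_j` are put together with the idempotents of the factors.
The factors with `j < j₀` are given up: `q_j = 0`. -/
theorem CostedRing.crtStep (hK : CostedRing F K ζ ρ lin mul) {V : Set R} {t r : ℕ} (j₀ : ℕ)
    (ht : 0 < t) (E E' : ℕ → ℕ) {T : ℕ}
    (hT : ∀ j, j₀ ≤ j → j < r → ∀ V a b, CoeffsIn (K V) t a → CoeffsIn (K V) t b →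
      Can F (fun V' => ∃ p, CoeffsIn (K V') t p ∧ X ^ t - C (ζ ^ E j) ∣ a * b - p) V T)
    {a b : A[X]} (ha : CoeffsIn (K V) (t * r) a) (hb : CoeffsIn (K V) (t * r) b) :
    Can F (fun V' => ∃ p, CoeffsIn (K V') (t * r) p ∧ ∃ q : ℕ → A[X],
      (∀ j < j₀, q j = 0) ∧ (∀ j, j₀ ≤ j → j < r → X ^ t - C (ζ ^ E j) ∣ a * b - q j) ∧
      p = ∑ j ∈ Finset.range r,
        (C ρ * ∑ k ∈ Finset.range r, C ((ζ ^ E' j) ^ k) * X ^ (t * k)) * q j) V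
      ((r - j₀) * (t * (r * lin) + t * (r * lin) + T) + t * r * (r * lin + lin)) := by
  refine (Can.forall_range (F := F) (V := V) (τ := t * (r * lin) + t * (r * lin) + T)
    (Q := fun i V' => ∃ q, CoeffsIn (K V') t q ∧ X ^ t - C (ζ ^ E (j₀ + i)) ∣ a * b - q)
    (fun i V V' hV ⟨q, h1, h2⟩ => ⟨q, hK.polyMono h1 hV, h2⟩) (r - j₀)
    fun i hi V₁ hV₁ => ?_).bind fun V₁ hV₁ hq => ?_
  · refine ((hK.foldAt (E (j₀ + i)) (hK.polyMono ha hV₁)).bind fun V₂ hV₂ ha' =>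
      (hK.foldAt (E (j₀ + i)) (hK.polyMono hb (hV₁.trans hV₂))).mono le_rfl
        fun V₃ hV₃ hb' => And.intro (hK.polyMono ha' hV₃) hb').bind fun V₂ hV₂ hab => ?_
    refine (hT (j₀ + i) (by omega) (by omega) V₂ _ _ hab.1 hab.2).mono le_rfl ?_
    rintro V₃ - ⟨p, hp, hdvd⟩
    refine ⟨p, hp, ?_⟩
    have h1 := dvd_sub_foldAt (r := r) ht (ζ ^ E (j₀ + i)) ha.1
    have h2 := dvd_sub_foldAt (r := r) ht (ζ ^ E (j₀ + i)) hb.1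
    have h3 := (h1.mul_right b).add ((h2.mul_left (PolyComputing.foldAt t r (ζ ^ E (j₀ + i)) a)).add
      hdvd)
    convert h3 using 1
    ring
  · choose! q hq1 hq2 using hq
    set Q : ℕ → A[X] := fun j => if j < j₀ then 0 else q (j - j₀) with hQ
    have hQt : ∀ j < r, CoeffsIn (K V₁) t (Q j) := by
      intro j hj
      simp only [hQ]
      split_ifs with h
      · exact ⟨fun _ _ => coeff_zero _, fun _ => by rw [coeff_zero]; exact hK.zero _⟩
      · exact hq1 _ (by omega)
    have hp : (∑ j ∈ Finset.range r,
        (C ρ * ∑ k ∈ Finset.range r, C ((ζ ^ E' j) ^ k) * X ^ (t * k)) * Q j : A[X])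
        = ∑ k ∈ Finset.range r,
          (C ρ * ∑ j ∈ Finset.range r, C (ζ ^ (E' j * k)) * Q j) * X ^ (t * k) := by
      simp only [Finset.mul_sum, Finset.sum_mul]
      rw [Finset.sum_comm]
      refine Finset.sum_congr rfl fun k _ => Finset.sum_congr rfl fun j _ => ?_
      rw [← pow_mul]; ring
    have hlen : ∀ k < r, ∀ i, t ≤ i →
        (C ρ * ∑ j ∈ Finset.range r, C (ζ ^ (E' j * k)) * Q j : A[X]).coeff i = 0 := by
      intro k _ i hi
      rw [coeff_C_mul, finsetSum_coeff, Finset.sum_eq_zero, mul_zero]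
      intro j hj
      rw [coeff_C_mul, (hQt j (Finset.mem_range.1 hj)).1 i hi, mul_zero]
    refine (Can.poly hK.mono hK.zero (n := t * r) (τ := r * lin + lin) (c := ∑ k ∈ Finset.range r,
          (C ρ * ∑ j ∈ Finset.range r, C (ζ ^ (E' j * k)) * Q j) * X ^ (t * k))
          (fun i hi => ?_) fun i _ V' hV' => ?_).mono le_rfl
          fun V' _ hpV => ⟨_, hpV, Q, fun j hj => by simp [hQ, hj], fun j h1 h2 => ?_, hp.symm⟩
    · rw [coeff_sum_mul_X_pow ht r _ hlen, if_neg]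
      rw [not_lt, Nat.le_div_iff_mul_le ht, mul_comm]
      exact hi
    · rw [coeff_sum_mul_X_pow ht r _ hlen]
      split_ifs with h
      · simp only [coeff_C_mul, finsetSum_coeff]
        exact (hK.linComb r _ _ fun j hj => hK.mono _ _ _ hV' ((hQt j hj).2 _)).bind
          fun _ _ h => hK.const_mul _ _ h
      · exact .done (hK.zero _)
    · simp only [hQ, not_lt.2 h1, if_false]
      have := hq2 (j - j₀) (by omega)
      rwa [Nat.add_sub_cancel' h1] at this

variable {r o : ℕ}

/-- The idempotents of the factors `X^t - u_j` sum to one. -/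
theorem sum_idempotent {t : ℕ} (hr : 0 < r) (hρ : ρ * r = 1) (v : ℕ → A)
    (hv : ∀ k, 0 < k → k < r → ∑ j ∈ Finset.range r, v j ^ k = 0) :
    ∑ j ∈ Finset.range r, (C ρ * ∑ k ∈ Finset.range r, C (v j ^ k) * X ^ (t * k) : A[X]) = 1 := by
  rw [← Finset.mul_sum, Finset.sum_comm, Finset.sum_eq_single 0]
  · simp only [pow_zero, map_one, mul_zero, mul_one, Finset.sum_const, Finset.card_range,
      nsmul_eq_mul]
    rw [← C_eq_natCast, ← C_mul, hρ, C_1]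
  · intro k hk hk0
    rw [← Finset.sum_mul, ← map_sum, hv k (Nat.pos_of_ne_zero hk0) (Finset.mem_range.1 hk), C_0,
      zero_mul]
  · intro h
    exact absurd (Finset.mem_range.2 hr) h

theorem sum_inv_root_pow (hr : r.Prime) (ho : 0 < o)
    (horth : ∀ e, ¬ r ∣ e → ∑ j ∈ Finset.range r, ζ ^ (o * e * j) = 0) (e₀ k : ℕ) (hk : 0 < k)
    (hkr : k < r) :
    ∑ j ∈ Finset.range r, (ζ ^ ((o * r - 1) * (e₀ + o * j))) ^ k = 0 := by
  have h : ∀ j, (ζ ^ ((o * r - 1) * (e₀ + o * j))) ^ k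
      = ζ ^ ((o * r - 1) * e₀ * k) * ζ ^ (o * ((o * r - 1) * k) * j) := by
    intro j
    rw [← pow_mul, ← pow_add]
    congr 1
    ring
  rw [Finset.sum_congr rfl fun j _ => h j, ← Finset.mul_sum, horth, mul_zero]
  intro hdvd
  rcases (Nat.Prime.dvd_mul hr).1 hdvd with h1 | h1
  · have h2 : r ∣ o * r - (o * r - 1) := Nat.dvd_sub (Dvd.intro_left _ rfl) h1
    have h3 : o * r - (o * r - 1) = 1 := by
      have := Nat.mul_pos ho hr.pos
      omega
    rw [h3] at h2
    exact hr.one_lt.ne' (Nat.dvd_one.1 h2)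
  · exact absurd (Nat.le_of_dvd hk h1) (not_le.2 hkr)

theorem root_mul_inv (hr : 0 < r) (ho : 0 < o) (hζ : ζ ^ (o * r) = 1) (e : ℕ) :
    ζ ^ e * ζ ^ ((o * r - 1) * e) = 1 := by
  rw [← pow_add]
  have h := Nat.mul_pos ho hr
  have : e + (o * r - 1) * e = o * r * e := by
    obtain ⟨s, hs⟩ := Nat.exists_eq_add_of_le h
    rw [hs]; simp; ring
  rw [this, pow_mul, hζ, one_pow]

/-- Multiplication modulo `X^{r^i} - ζ^{e r^i}` by `i` radix-`r` steps. -/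
theorem CostedRing.fourierMul (hK : CostedRing F K ζ ρ lin mul) (hr : r.Prime) (ho : 0 < o)
    (hζ : ζ ^ (o * r) = 1) (hρ : ρ * r = 1)
    (horth : ∀ e, ¬ r ∣ e → ∑ j ∈ Finset.range r, ζ ^ (o * e * j) = 0) (i : ℕ) (hi : r ^ i ∣ o)
    (e : ℕ) (V : Set R) (a b : A[X]) (ha : CoeffsIn (K V) (r ^ i) a)
    (hb : CoeffsIn (K V) (r ^ i) b) :
    Can F (fun V' => ∃ p, CoeffsIn (K V') (r ^ i) p ∧
      X ^ r ^ i - C (ζ ^ (e * r ^ i)) ∣ a * b - p) V (r ^ i * (mul + 4 * r * i * lin)) := by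
  induction i generalizing e V a b with
  | zero =>
    refine (hK.mul V (a.coeff 0) (b.coeff 0) (ha.2 0) (hb.2 0)).mono (by simp) fun V' _ h =>
      ⟨C (a.coeff 0 * b.coeff 0), ⟨fun i hi => ?_, fun i => ?_⟩, ?_⟩
    · rw [coeff_C, if_neg (by rw [pow_zero] at hi; omega)]
    · rw [coeff_C]; split_ifs
      · exact h
      · exact hK.zero _
    · have h1 : ∀ {p : A[X]}, (∀ i, r ^ 0 ≤ i → p.coeff i = 0) → p = C (p.coeff 0) := by
        intro p hp
        ext j
        rw [coeff_C]
        split_ifs with hj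
        · rw [hj]
        · exact hp j (by rw [pow_zero]; omega)
      rw [C_mul, ← h1 ha.1, ← h1 hb.1, sub_self]
      exact dvd_zero _
  | succ i ih =>
    have ht : 0 < r ^ i := pow_pos hr.pos i
    have hio : r ^ i ∣ o := (pow_dvd_pow r (Nat.le_succ i)).trans hi
    obtain ⟨w, hw⟩ := hio
    rw [pow_succ] at ha hb
    refine (hK.crtStep 0 ht (fun j => e * r ^ i + o * j)
      (fun j => (o * r - 1) * (e * r ^ i + o * j))
      (T := r ^ i * (mul + 4 * r * i * lin)) (fun j _ _ V a b ha hb => ?_) ha hb).mono ?_ ?_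
    · have h1 : e * r ^ i + o * j = (e + w * j) * r ^ i := by
        rw [hw]; ring
      simp only [h1]
      exact ih ⟨w, hw⟩ (e + w * j) V a b ha hb
    · rw [pow_succ, Nat.sub_zero]
      have h1 : 1 ≤ r := hr.pos
      have h2 : 2 ≤ r := hr.two_le
      calc r * (r ^ i * (r * lin) + r ^ i * (r * lin) + r ^ i * (mul + 4 * r * i * lin))
            + r ^ i * r * (r * lin + lin)
          = r ^ i * r * (mul + 4 * r * i * lin + 3 * r * lin + 1 * lin) := by ring
        _ ≤ r ^ i * r * (mul + 4 * r * i * lin + 3 * r * lin + r * lin) := by gcongr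
        _ = r ^ i * r * (mul + 4 * r * (i + 1) * lin) := by ring
    · rintro V' - ⟨p, hp, q, -, hq, rfl⟩
      rw [pow_succ]
      refine ⟨_, hp, ?_⟩
      have h1 := sum_idempotent (ρ := ρ) (t := r ^ i) hr.pos hρ
        (fun j => ζ ^ ((o * r - 1) * (e * r ^ i + o * j)))
        (fun k hk hkr => sum_inv_root_pow hr ho horth (e * r ^ i) k hk hkr)
      conv_rhs => rw [← one_mul (a * b), ← h1, Finset.sum_mul, ← Finset.sum_sub_distrib]
      refine Finset.dvd_sum fun j hj => ?_
      obtain ⟨c, hc⟩ := hq j (Nat.zero_le _) (Finset.mem_range.1 hj)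
      rw [← mul_sub, hc, mul_assoc, ← mul_assoc (∑ k ∈ _, _),
        idempotent_mul (r ^ i) r (root_mul_inv hr.pos ho hζ (e * r ^ i + o * j))]
      have h2 : (ζ ^ (e * r ^ i + o * j)) ^ r = ζ ^ (e * (r ^ i * r)) := by
        rw [← pow_mul]
        have : (e * r ^ i + o * j) * r = e * (r ^ i * r) + o * r * j := by ring
        rw [this, pow_add, pow_mul ζ (o * r), hζ, one_pow, mul_one]
      rw [h2]
      exact Dvd.intro_left (C ρ * C (ζ ^ (e * r ^ i + o * j)
        * (ζ ^ ((o * r - 1) * (e * r ^ i + o * j))) ^ r) * c) (by ring)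

/-- Multiplication modulo `∑_{k < r} X^{k r^i}`: modulo `X^{r^{i+1}} - 1`, the factor `X^{r^i} - 1`
is given up. -/
theorem CostedRing.cyclotomicMul (hK : CostedRing F K ζ ρ lin mul) (hr : r.Prime) (ho : 0 < o)
    (hζ : ζ ^ (o * r) = 1) (hρ : ρ * r = 1)
    (horth : ∀ e, ¬ r ∣ e → ∑ j ∈ Finset.range r, ζ ^ (o * e * j) = 0) (i : ℕ) (hi : r ^ i ∣ o)
    (V : Set R) (a b : A[X]) (ha : CoeffsIn (K V) (r ^ i * r) a)
    (hb : CoeffsIn (K V) (r ^ i * r) b) :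
    Can F (fun V' => ∃ p, CoeffsIn (K V') (r ^ i * r) p ∧
      (∑ k ∈ Finset.range r, X ^ (r ^ i * k)) ∣ a * b - p) V
      ((r - 1) * (r ^ i * mul) + 4 * r * r * r ^ i * (i + 1) * lin) := by
  have ht : 0 < r ^ i := pow_pos hr.pos i
  obtain ⟨w, hw⟩ := hi
  refine (hK.crtStep 1 ht (fun j => 0 + o * j) (fun j => (o * r - 1) * (0 + o * j))
      (T := r ^ i * (mul + 4 * r * i * lin)) (fun j _ _ V a b ha hb => ?_) ha hb).mono ?_ ?_
  · have h1 : 0 + o * j = (w * j) * r ^ i := by rw [hw]; ring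
    simp only [h1]
    exact hK.fourierMul hr ho hζ hρ horth i ⟨w, hw⟩ (w * j) V a b ha hb
  · have h2 : 2 ≤ r := hr.two_le
    have h3 : r - 1 ≤ r := Nat.sub_le _ _
    calc (r - 1) * (r ^ i * (r * lin) + r ^ i * (r * lin) + r ^ i * (mul + 4 * r * i * lin))
            + r ^ i * r * (r * lin + lin)
        = (r - 1) * (r ^ i * mul) + ((r - 1) * (2 * (r ^ i * (r * lin)) + r ^ i * (4 * r * i * lin))
            + r ^ i * r * (r * lin + 1 * lin)) := by ring
      _ ≤ (r - 1) * (r ^ i * mul) + (r * (2 * (r ^ i * (r * lin)) + r ^ i * (4 * r * i * lin))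
            + r ^ i * r * (r * lin + r * lin)) := by gcongr; omega
      _ = _ := by ring
  · rintro V' - ⟨p, hp, q, hq0, hq, rfl⟩
    refine ⟨_, hp, ?_⟩
    have h1 := sum_idempotent (ρ := ρ) (t := r ^ i) hr.pos hρ
      (fun j => ζ ^ ((o * r - 1) * (0 + o * j)))
      (fun k hk hkr => sum_inv_root_pow hr ho horth 0 k hk hkr)
    conv_rhs => rw [← one_mul (a * b), ← h1, Finset.sum_mul, ← Finset.sum_sub_distrib]
    refine Finset.dvd_sum fun j hj => ?_
    rcases Nat.eq_zero_or_pos j with rfl | hj0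
    · rw [hq0 0 one_pos]
      simp only [mul_zero, add_zero, pow_zero, one_pow, map_one, one_mul, sub_zero]
      exact Dvd.dvd.mul_right (Dvd.intro_left _ rfl) _
    · obtain ⟨c, hc⟩ := hq j hj0 (Finset.mem_range.1 hj)
      rw [← mul_sub, hc, mul_assoc, ← mul_assoc (∑ k ∈ _, _),
        idempotent_mul (r ^ i) r (root_mul_inv hr.pos ho hζ (0 + o * j))]
      have h2 : (ζ ^ (0 + o * j)) ^ r = 1 := by
        rw [← pow_mul, zero_add, mul_right_comm, pow_mul, hζ, one_pow]
      have h3 : (∑ k ∈ Finset.range r, X ^ (r ^ i * k) : A[X]) * (X ^ r ^ i - 1)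
          = X ^ (r ^ i * r) - 1 := by
        simp only [pow_mul]
        exact geom_sum_mul _ _
      rw [h2, C_1, ← h3]
      exact Dvd.intro_left (C ρ * C (ζ ^ (0 + o * j) * (ζ ^ ((o * r - 1) * (0 + o * j))) ^ r)
        * (X ^ r ^ i - 1) * c) (by ring)

end Fourier

/-! ### Fast multiplication of polynomials -/

section Modulus

variable {A : Type*} [CommRing A]

/-- The modulus `1 + X^n + ⋯ + X^{(r-1)n}`, in which `X` is a principal root of unity of order
`r n`. -/
def cyc (A : Type*) [CommRing A] (r n : ℕ) : A[X] := ∑ k ∈ Finset.range r, X ^ (n * k)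

theorem cyc_mul (r n : ℕ) : cyc A r n * (X ^ n - 1) = X ^ (n * r) - 1 := by
  simp only [cyc, pow_mul]
  exact geom_sum_mul _ _

theorem cyc_dvd (r n : ℕ) : cyc A r n ∣ X ^ (n * r) - 1 := Dvd.intro _ (cyc_mul r n)

theorem cyc_eq {r n : ℕ} (hr : 0 < r) :
    cyc A r n = X ^ (n * (r - 1)) + ∑ k ∈ Finset.range (r - 1), X ^ (n * k) := by
  obtain ⟨r, rfl⟩ : ∃ s, r = s + 1 := ⟨r - 1, by omega⟩
  rw [cyc, Finset.sum_range_succ, add_comm, Nat.add_sub_cancel]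

theorem degree_cyc_tail_lt {r n : ℕ} (hn : 0 < n) :
    (∑ k ∈ Finset.range (r - 1), X ^ (n * k) : A[X]).degree < (n * (r - 1) : ℕ) := by
  refine (degree_lt_iff_coeff_zero _ _).2 fun i hi => ?_
  rw [finsetSum_coeff]
  refine Finset.sum_eq_zero fun k hk => ?_
  rw [coeff_X_pow, if_neg]
  rintro rfl
  exact absurd (Nat.le_of_mul_le_mul_left hi hn) (not_le.2 (Finset.mem_range.1 hk))

theorem monic_cyc {r n : ℕ} (hr : 0 < r) (hn : 0 < n) : (cyc A r n).Monic := by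
  rw [cyc_eq hr]
  exact monic_X_pow_add (degree_cyc_tail_lt hn)

theorem degree_cyc [Nontrivial A] {r n : ℕ} (hr : 0 < r) (hn : 0 < n) :
    (cyc A r n).degree = (n * (r - 1) : ℕ) := by
  rw [cyc_eq hr, degree_add_eq_left_of_degree_lt, degree_X_pow]
  rw [degree_X_pow]
  exact degree_cyc_tail_lt hn

theorem eq_of_cyc_dvd_sub {r n : ℕ} (hr : 0 < r) (hn : 0 < n) {p q : A[X]}
    (hp : ∀ i, n * (r - 1) ≤ i → p.coeff i = 0) (hq : ∀ i, n * (r - 1) ≤ i → q.coeff i = 0)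
    (h : cyc A r n ∣ p - q) : p = q := by
  nontriviality A
  have hm : (cyc A r n).Monic := monic_cyc hr hn
  have h1 := modByMonic_eq_of_dvd_sub hm h
  rwa [(modByMonic_eq_self_iff hm).2, (modByMonic_eq_self_iff hm).2] at h1
  · rw [degree_cyc hr hn]; exact (degree_lt_iff_coeff_zero _ _).2 hq
  · rw [degree_cyc hr hn]; exact (degree_lt_iff_coeff_zero _ _).2 hp

theorem coeff_modByMonic_cyc {r n : ℕ} (hr : 0 < r) (hn : 0 < n) (p : A[X]) (i : ℕ)
    (hi : n * (r - 1) ≤ i) : (p %ₘ cyc A r n).coeff i = 0 := by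
  nontriviality A
  refine (degree_lt_iff_coeff_zero _ (n * (r - 1))).1 ?_ i hi
  rw [← degree_cyc (A := A) hr hn]
  exact degree_modByMonic_lt _ (monic_cyc hr hn)

theorem map_cyc {B : Type*} [CommRing B] (f : A →+* B) (r n : ℕ) :
    (cyc A r n).map f = cyc B r n := by
  simp [cyc, Polynomial.map_sum]

/-- Reduction modulo a polynomial with constant coefficients does not lengthen the coefficients. -/
theorem coeff_coeff_modByMonic_map {P : A[X][X]} {Q : A[X]} (hQ : Q.Monic) {D : ℕ}
    (hP : ∀ l i, D ≤ i → (P.coeff l).coeff i = 0) (l i : ℕ) (hi : D ≤ i) :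
    ((P %ₘ Q.map C).coeff l).coeff i = 0 := by
  have hQ' : (Q.map C).Monic := hQ.map _
  have h1 : P %ₘ Q.map C
      = ∑ j ∈ Finset.range (P.natDegree + 1), P.coeff j • ((X ^ j %ₘ Q).map C) := by
    conv_lhs => rw [P.as_sum_range_C_mul_X_pow]
    have : ∀ p : A[X][X], p %ₘ Q.map C = modByMonicHom (Q.map C) p := fun _ => rfl
    rw [this, map_sum]
    refine Finset.sum_congr rfl fun j _ => ?_
    rw [← smul_eq_C_mul, map_smul, ← this, map_modByMonic C hQ]
    simp
  rw [h1]
  simp only [finsetSum_coeff, coeff_smul, coeff_map, smul_eq_mul, coeff_mul_C]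
  exact Finset.sum_eq_zero fun j _ => by rw [hP j i hi, zero_mul]

end Modulus

section Reduction

variable {F : Type*} [Field F] {R : Type*} [CommRing R] [Algebra F R]

/-- Reduction of a polynomial of length `n r` modulo `cyc r n`. -/
theorem Can.reduce {A : Type*} [CommRing A] {K : Set R → A → Prop}
    (hK : ∀ a V V', V ⊆ V' → K V a → K V' a) (hK0 : ∀ V, K V 0) {τ : ℕ}
    (hsub : ∀ V a b, K V a → K V b → Can F (fun V' => K V' (a - b)) V τ) {V : Set R} {n r : ℕ}
    (hr : 0 < r) (hn : 0 < n) {a : A[X]} (ha : CoeffsIn (K V) (n * r) a) :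
    Can F (fun V' => ∃ c, CoeffsIn (K V') (n * (r - 1)) c ∧ cyc A r n ∣ a - c) V
      (n * (r - 1) * τ) := by
  set c : A[X] := ∑ k ∈ Finset.range (r - 1), (chunk n a k - chunk n a (r - 1)) * X ^ (n * k)
    with hc
  have hlen : ∀ k < r - 1, ∀ i, n ≤ i → (chunk n a k - chunk n a (r - 1)).coeff i = 0 := by
    intro k _ i hi
    rw [coeff_sub, coeff_chunk, coeff_chunk, if_neg (not_lt.2 hi), if_neg (not_lt.2 hi), sub_zero]
  refine (Can.poly (F := F) (c := c) hK hK0 (n := n * (r - 1)) (τ := τ) (fun i hi => ?_)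
    fun i _ V' hV' => ?_).mono le_rfl fun V' _ h => ⟨c, h, ?_⟩
  · rw [hc, coeff_sum_mul_X_pow hn _ _ hlen, if_neg]
    rw [not_lt, Nat.le_div_iff_mul_le hn, mul_comm]
    exact hi
  · rw [hc, coeff_sum_mul_X_pow hn _ _ hlen]
    split_ifs
    · rw [coeff_sub, coeff_chunk, coeff_chunk, if_pos (Nat.mod_lt _ hn), if_pos (Nat.mod_lt _ hn)]
      exact hsub _ _ _ (hK _ _ _ hV' (ha.2 _)) (hK _ _ _ hV' (ha.2 _))
    · exact .done (hK0 _)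
  · refine Dvd.intro_left (chunk n a (r - 1)) ?_
    have h := eq_sum_chunk hn r ha.1
    obtain ⟨s, rfl⟩ : ∃ s, r = s + 1 := ⟨r - 1, by omega⟩
    rw [Finset.sum_range_succ] at h
    rw [hc, cyc, Finset.sum_range_succ]
    simp only [sub_mul, Finset.sum_sub_distrib, Nat.add_sub_cancel, ← Finset.mul_sum]
    linear_combination -h

theorem Can.reduceKnown {V : Set R} {n r : ℕ} (hr : 0 < r) (hn : 0 < n) {a : R[X]}
    (ha : CoeffsIn (Known F V) (n * r) a) :
    Can F (fun V' => ∃ c, CoeffsIn (Known F V') (n * (r - 1)) c ∧ cyc R r n ∣ a - c) V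
      (n * (r - 1) * 1) :=
  Can.reduce (K := Known F) (fun _ _ _ hV h => h.mono hV) (fun V => Known.zero V)
    (fun _ _ _ h h' => Can.sub h h') hr hn ha

/-- Reduction of a polynomial of length `2 n r` modulo `cyc r n`. -/
theorem Can.reduceLong {V : Set R} {n r : ℕ} (hr : 0 < r) (hn : 0 < n) {a : R[X]}
    (ha : CoeffsIn (Known F V) (n * r * 2) a) :
    Can F (fun V' => ∃ c, CoeffsIn (Known F V') (n * (r - 1)) c ∧ cyc R r n ∣ a - c) V
      (3 * (n * r)) := by
  have hnr := Nat.mul_pos hn hr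
  refine ((Can.polyKnown (F := F) (V := V) (n := n * r) (τ := 2 * (0 + 1))
    (c := foldAt (n * r) 2 1 a) (fun i hi => ?_) fun i hi V' hV' => ?_).bind (σ := n * r)
    fun V₁ _ h => ?_).le (le_of_eq (by ring))
  · rw [coeff_foldAt, if_neg (not_lt.2 hi)]
  · rw [coeff_foldAt, if_pos hi]
    refine Can.sum 2 _ fun k _ W hW => .done ?_
    rw [one_pow, one_mul]
    exact (ha.2 _).mono (hV'.trans hW)
  · refine (Can.reduceKnown hr hn h).mono ?_ ?_
    · rw [mul_one]; exact Nat.mul_le_mul_left _ (Nat.sub_le _ _)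
    · rintro V₂ - ⟨c, hc, hdvd⟩
      refine ⟨c, hc, ?_⟩
      have h1 := dvd_sub_foldAt hnr (1 : R) ha.1
      rw [C_1] at h1
      convert ((cyc_dvd r n).trans h1).add hdvd using 1
      ring

/-- Multiplication modulo `cyc r n` takes at most `τ` operations. -/
def MulModWithin (F : Type*) [Field F] (R : Type*) [CommRing R] [Algebra F R] (r n τ : ℕ) : Prop :=
  ∀ (V : Set R) (a b : R[X]), CoeffsIn (Known F V) (n * (r - 1)) a →
    CoeffsIn (Known F V) (n * (r - 1)) b →
    Can F (fun V' => ∃ c, CoeffsIn (Known F V') (n * (r - 1)) c ∧ cyc R r n ∣ a * b - c) V τ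

/-- The elements of `R[X]/(cyc r o)` that are represented by their remainder. -/
def KnownMod (F : Type*) [Field F] {R : Type*} [CommRing R] [Algebra F R] (r o : ℕ) (V : Set R)
    (a : AdjoinRoot (cyc R r o)) : Prop :=
  ∃ p, CoeffsIn (Known F V) (o * (r - 1)) p ∧ AdjoinRoot.mk (cyc R r o) p = a

theorem root_pow_eq_one (r o : ℕ) : (AdjoinRoot.root (cyc R r o)) ^ (o * r) = 1 := by
  have h : AdjoinRoot.mk (cyc R r o) (X ^ (o * r) - 1) = 0 :=
    AdjoinRoot.mk_eq_zero.2 (cyc_dvd r o)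
  rw [map_sub, map_pow, AdjoinRoot.mk_X, map_one] at h
  exact sub_eq_zero.1 h

/-- `R[X]/(cyc r o)` as a ring with computable operations; multiplication by a power of `X` is a
cyclic shift modulo `X^{ro} - 1`. -/
theorem costedRing_adjoinRoot {r o μ : ℕ} (hr : 0 < r) (ho : 0 < o) (c : F)
    (hμ : MulModWithin F R r o μ) :
    CostedRing F (KnownMod F r o (R := R)) (AdjoinRoot.root _)
      (AdjoinRoot.mk _ (C (algebraMap F R c))) (4 * (o * r)) μ where
  mono := fun a V V' hV ⟨p, hp, h⟩ => ⟨p, hp.mono hV, h⟩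
  zero := fun V => ⟨0, ⟨fun _ _ => coeff_zero _, fun _ => by rw [coeff_zero]; exact Known.zero V⟩,
    map_zero _⟩
  sub := by
    rintro V _ _ ⟨p, hp, rfl⟩ ⟨q, hq, rfl⟩
    refine (Can.polySub hp hq).mono ?_ fun V' _ h => ⟨_, h, map_sub _ _ _⟩
    calc o * (r - 1) ≤ 1 * (o * r) := by rw [one_mul]; exact Nat.mul_le_mul_left _ (Nat.sub_le _ _)
      _ ≤ _ := Nat.mul_le_mul_right _ (by norm_num)
  const_mul := by
    rintro V _ ⟨p, hp, rfl⟩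
    refine (Can.polyC_mul (Known.const V c) hp).mono ?_ fun V' _ h => ⟨_, h, map_mul _ _ _⟩
    calc o * (r - 1) ≤ 1 * (o * r) := by rw [one_mul]; exact Nat.mul_le_mul_left _ (Nat.sub_le _ _)
      _ ≤ _ := Nat.mul_le_mul_right _ (by norm_num)
  mul := by
    rintro V _ _ ⟨p, hp, rfl⟩ ⟨q, hq, rfl⟩
    refine (hμ V p q hp hq).mono le_rfl ?_
    rintro V' - ⟨c, hc, hdvd⟩
    refine ⟨c, hc, ?_⟩
    rw [← map_mul]
    exact (AdjoinRoot.mk_eq_mk.2 hdvd).symm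
  add_pow_mul := by
    rintro V _ _ e ⟨p, hp, rfl⟩ ⟨q, hq, rfl⟩
    have hor := Nat.mul_pos ho hr
    have hle : o * (r - 1) ≤ o * r := Nat.mul_le_mul_left _ (Nat.sub_le _ _)
    have hshift : CoeffsIn (Known F V) (o * r * 2) (X ^ (e % (o * r)) * q) := by
      refine ⟨fun i hi => ?_, fun i => ?_⟩
      · rw [coeff_X_pow_mul']
        have := Nat.mod_lt e hor
        rw [if_pos (by omega)]
        exact hq.1 _ (by omega)
      · rw [coeff_X_pow_mul']
        split_ifs
        · exact hq.2 _
        · exact Known.zero V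
    refine ((Can.reduceLong hr ho hshift).bind (σ := o * r) fun V₁ hV₁ ⟨c, hc, hdvd⟩ => ?_).le
      (le_of_eq (by ring))
    refine (Can.polyAdd (hp.mono hV₁) hc).mono hle fun V' _ h => ⟨_, h, ?_⟩
    have h1 : AdjoinRoot.root (cyc R r o) ^ e = AdjoinRoot.root (cyc R r o) ^ (e % (o * r)) := by
      conv_lhs => rw [← Nat.div_add_mod e (o * r), pow_add, pow_mul, root_pow_eq_one, one_pow,
        one_mul]
    rw [h1, map_add, ← AdjoinRoot.mk_eq_mk.2 hdvd, map_mul, map_pow, AdjoinRoot.mk_X]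

theorem sum_root_pow {r o : ℕ} (hr : r = 2 ∨ r = 3) (e : ℕ) (he : ¬ r ∣ e) :
    ∑ j ∈ Finset.range r, (AdjoinRoot.root (cyc R r o)) ^ (o * e * j) = 0 := by
  set ω := (AdjoinRoot.root (cyc R r o)) ^ o with hω
  have h1 : ω ^ r = 1 := by rw [hω, ← pow_mul, root_pow_eq_one]
  have h0 : ∑ j ∈ Finset.range r, ω ^ j = 0 := by
    have h : AdjoinRoot.mk (cyc R r o) (cyc R r o) = 0 := AdjoinRoot.mk_self
    conv_lhs at h => enter [2]; rw [cyc]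
    simpa only [map_sum, map_pow, AdjoinRoot.mk_X, pow_mul] using h
  have h2 : ∀ j, (AdjoinRoot.root (cyc R r o)) ^ (o * e * j) = (ω ^ (e % r)) ^ j := by
    intro j
    rw [pow_mul, pow_mul, ← hω]
    congr 1
    conv_lhs => rw [← Nat.div_add_mod e r, pow_add, pow_mul, h1, one_pow, one_mul]
  rw [Finset.sum_congr rfl fun j _ => h2 j]
  rcases hr with rfl | rfl
  · have h3 : e % 2 = 1 := by omega
    simpa [h3] using h0
  · have h3 : e % 3 = 1 ∨ e % 3 = 2 := by omega
    rcases h3 with h3 | h3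
    · simpa [h3] using h0
    · simp only [h3, Finset.sum_range_succ, Finset.sum_range_zero] at h0 ⊢
      have h4 : (ω ^ 2) ^ 2 = ω := by
        have : (ω ^ 2) ^ 2 = ω ^ 3 * ω := by ring
        rw [this, h1, one_mul]
      rw [h4]
      linear_combination h0

end Reduction

section Recursion

variable {F : Type*} [Field F] {R : Type*} [CommRing R] [Algebra F R]

/-- The bivariate polynomial `∑_l (chunk m a l) Y^l`, which becomes `a` at `Y = X^m`. -/
def blocks (m n : ℕ) (a : R[X]) : R[X][X] := ∑ l ∈ Finset.range n, C (chunk m a l) * X ^ l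

theorem coeff_blocks (m n : ℕ) (a : R[X]) (l : ℕ) :
    (blocks m n a).coeff l = if l < n then chunk m a l else 0 := by
  simp [blocks, coeff_X_pow]

theorem eval_blocks {m n : ℕ} (hm : 0 < m) {a : R[X]} (ha : ∀ i, m * n ≤ i → a.coeff i = 0) :
    (blocks m n a).eval (X ^ m) = a := by
  conv_rhs => rw [eq_sum_chunk hm n ha]
  simp [blocks, eval_finsetSum, pow_mul]

theorem coeff_coeff_blocks_mul (m n : ℕ) (a b : R[X]) (l i : ℕ) (hi : 2 * m ≤ i) :
    ((blocks m n a * blocks m n b).coeff l).coeff i = 0 := by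
  have h : ∀ (a : R[X]) l i, m ≤ i → ((blocks m n a).coeff l).coeff i = 0 := by
    intro a l i hi
    rw [coeff_blocks]
    split_ifs
    · rw [coeff_chunk, if_neg (not_lt.2 hi)]
    · exact coeff_zero _
  rw [coeff_mul, finsetSum_coeff]
  exact Finset.sum_eq_zero fun x _ =>
    coeff_mul_eq_zero_of_length (h a x.1) (h b x.2) i (by omega)

/-- Substitution of `X^m` into a bivariate polynomial whose coefficients have length `2m`. -/
theorem Can.evalXPow {V : Set R} {m n : ℕ} (hm : 0 < m) {P : R[X][X]}
    (hP : ∀ l, n ≤ l → P.coeff l = 0) (hP' : ∀ l, CoeffsIn (Known F V) (2 * m) (P.coeff l)) :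
    Can F (fun V' => CoeffsIn (Known F V') (m * (n + 1)) (P.eval (X ^ m))) V (m * (n + 1)) := by
  have hlen : ∀ k l i, m ≤ i → (chunk m (P.coeff l) k).coeff i = 0 := fun k l i hi => by
    rw [coeff_chunk, if_neg (not_lt.2 hi)]
  have hsum : ∀ k i, (∑ l ∈ Finset.range n, chunk m (P.coeff l) k * X ^ (m * l)).coeff i
      = if i / m < n then (P.coeff (i / m)).coeff (m * k + i % m) else 0 := by
    intro k i
    rw [coeff_sum_mul_X_pow hm n _ fun l _ i hi => hlen k l i hi]
    simp only [coeff_chunk, if_pos (Nat.mod_lt _ hm)]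
  have heval : P.eval (X ^ m) = ∑ l ∈ Finset.range n, chunk m (P.coeff l) 0 * X ^ (m * l)
      + X ^ m * ∑ l ∈ Finset.range n, chunk m (P.coeff l) 1 * X ^ (m * l) := by
    have h : CoeffsIn (fun _ => True) n P := ⟨hP, fun _ => trivial⟩
    conv_lhs => rw [h.eq_sum, eval_finsetSum]
    rw [Finset.mul_sum, ← Finset.sum_add_distrib]
    refine Finset.sum_congr rfl fun l _ => ?_
    rw [eval_mul, eval_C, eval_pow, eval_X]
    conv_lhs => rw [eq_sum_chunk hm 2 fun i hi => (hP' l).1 i (by omega)]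
    rw [Finset.sum_range_succ, Finset.sum_range_one, ← pow_mul]
    ring
  refine (Can.polyKnown (τ := 1) (fun i hi => ?_) fun i _ V' hV' => ?_).le (by omega)
  · have h1 : n + 1 ≤ i / m := (Nat.le_div_iff_mul_le hm).2 (by rw [mul_comm]; exact hi)
    have h2 : m ≤ i := le_trans (Nat.le_mul_of_pos_right m (by omega)) hi
    have h3 : n ≤ (i - m) / m := by
      rw [Nat.le_div_iff_mul_le hm]
      have : m * (n + 1) = n * m + m := by ring
      omega
    rw [heval, coeff_add, hsum, if_neg (by omega), coeff_X_pow_mul', if_pos h2, hsum,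
      if_neg (by omega), add_zero]
  · rw [heval, coeff_add, hsum, coeff_X_pow_mul']
    refine Can.add ?_ ?_
    · split_ifs
      · exact ((hP' _).2 _).mono hV'
      · exact Known.zero _
    · split_ifs
      · rw [hsum]
        split_ifs
        · exact ((hP' _).2 _).mono hV'
        · exact Known.zero _
      · exact Known.zero _

/-- Multiplication modulo `cyc r n` for `n = r^i r^j`: in `Y = X^{r^j}`, the factors are
polynomials of length `(r - 1) r^i` with coefficients of length `r^j`. They are multiplied modulo
`cyc r r^i` in `Y`, and with coefficients modulo `cyc r o`, where `o = r^{j+e}`; since the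
coefficients of the product have length at most `2 r^j = (r - 1) o`, nothing is lost by that. -/
theorem MulModWithin.step {r e i j μ : ℕ} (hr : r = 2 ∨ r = 3) (he : r ^ e * (r - 1) = 2)
    (hrF : (r : F) ≠ 0) (hi : i ≤ j + e) (hμ : MulModWithin F R r (r ^ (j + e)) μ) :
    MulModWithin F R r (r ^ (i + j))
      ((r - 1) * (r ^ i * μ) + 1000 * ((i + 1) * r ^ (i + j))) := by
  intro V a b ha hb
  have hp : r.Prime := by rcases hr with rfl | rfl <;> norm_num
  have hr0 : 0 < r := hp.pos
  set m := r ^ j with hm_def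
  set t := r ^ i with ht_def
  set o := r ^ (j + e) with ho_def
  have hm : 0 < m := pow_pos hr0 _
  have ht : 0 < t := pow_pos hr0 _
  have ho : 0 < o := pow_pos hr0 _
  have hn : r ^ (i + j) = m * t := by rw [pow_add, mul_comm]
  have hD : o * (r - 1) = 2 * m := by rw [ho_def, pow_add, mul_assoc, he, mul_comm]
  rw [hn] at ha hb ⊢
  have hK := costedRing_adjoinRoot (R := R) hr0 ho ((r : F)⁻¹) hμ
  have hζ := root_pow_eq_one (R := R) r o
  have hρ : AdjoinRoot.mk (cyc R r o) (C (algebraMap F R (r : F)⁻¹)) * (r : AdjoinRoot (cyc R r o))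
      = 1 := by
    have : (r : AdjoinRoot (cyc R r o))
        = AdjoinRoot.mk (cyc R r o) (C (algebraMap F R (r : F))) := by
      simp
    rw [this, ← map_mul, ← C_mul, ← map_mul, inv_mul_cancel₀ hrF]
    simp
  -- the factors as polynomials in `Y` with coefficients in `R[X]/(cyc r o)`
  have hblocks : ∀ a : R[X], CoeffsIn (Known F V) (m * t * (r - 1)) a →
      CoeffsIn (KnownMod F r o V) (t * r)
        ((blocks m (t * (r - 1)) a).map (AdjoinRoot.mk (cyc R r o))) := by
    intro a ha
    refine ⟨fun l hl => ?_, fun l => ?_⟩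
    · rw [coeff_map, coeff_blocks, if_neg, map_zero]
      rw [not_lt]
      exact (Nat.mul_le_mul_left t (Nat.sub_le r 1)).trans hl
    · rw [coeff_map, coeff_blocks]
      split_ifs
      · refine ⟨_, ⟨fun s hs => ?_, fun s => ?_⟩, rfl⟩
        · rw [coeff_chunk, if_neg]
          omega
        · rw [coeff_chunk]
          split_ifs
          · exact ha.2 _
          · exact Known.zero V
      · rw [map_zero]
        exact hK.zero V
  have hmul := hK.cyclotomicMul hp ho hζ hρ (sum_root_pow hr) i
    (pow_dvd_pow r hi) V _ _ (hblocks a ha) (hblocks b hb)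
  have hprod : Can F (fun V' => ∀ l, CoeffsIn (Known F V') (2 * m)
      (((blocks m (t * (r - 1)) a * blocks m (t * (r - 1)) b) %ₘ cyc R[X] r t).coeff l)) V
      ((r - 1) * (t * μ) + 4 * r * r * r ^ i * (i + 1) * (4 * (o * r))
        + t * (r - 1) * (4 * (o * r))) := by
    refine hmul.bind fun V₁ _ ⟨p, hp1, hp2⟩ =>
      (Can.reduce hK.mono hK.zero hK.sub hr0 ht hp1).mono le_rfl fun V₂ _ ⟨c, hc, hdvd⟩ => ?_
    -- the result is the image of the true product modulo `cyc r t`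
    set P := blocks m (t * (r - 1)) a * blocks m (t * (r - 1)) b with hP
    have hPlen : ∀ l i, 2 * m ≤ i → ((P %ₘ cyc R[X] r t).coeff l).coeff i = 0 := by
      rw [← map_cyc C]
      exact coeff_coeff_modByMonic_map (monic_cyc hr0 ht) fun l i hi =>
        coeff_coeff_blocks_mul m _ a b l i hi
    have hPc : (P %ₘ cyc R[X] r t).map (AdjoinRoot.mk (cyc R r o)) = c := by
      rw [map_modByMonic _ (monic_cyc hr0 ht), map_cyc, hP, Polynomial.map_mul]
      refine eq_of_cyc_dvd_sub hr0 ht (coeff_modByMonic_cyc hr0 ht _) hc.1 ?_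
      have h1 := modByMonic_add_div ((blocks m (t * (r - 1)) a).map (AdjoinRoot.mk (cyc R r o)) *
        (blocks m (t * (r - 1)) b).map (AdjoinRoot.mk (cyc R r o)))
          (cyc (AdjoinRoot (cyc R r o)) r t)
      have h2 := ((show cyc _ r t ∣ _ from hp2).add hdvd).sub (Dvd.intro _ (eq_sub_of_add_eq' h1))
      convert h2 using 1
      abel
    intro l
    obtain ⟨q, hq, hqc⟩ := hc.2 l
    rw [← hPc, coeff_map] at hqc
    rw [← eq_of_cyc_dvd_sub hr0 ho hq.1 (fun i hi => hPlen l i (by omega))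
      (AdjoinRoot.mk_eq_mk.1 hqc), ← hD]
    exact hq
  have heval : Can F (fun V' => ∃ c, CoeffsIn (Known F V') (m * t * r) c ∧
      cyc R r (m * t) ∣ a * b - c) V
        ((r - 1) * (t * μ) + 4 * r * r * r ^ i * (i + 1) * (4 * (o * r))
          + t * (r - 1) * (4 * (o * r)) + m * t * r) := by
    refine hprod.bind fun V₁ _ h => ?_
    have h1 := Can.evalXPow (n := t * (r - 1)) hm (coeff_modByMonic_cyc hr0 ht _) h
    have hle : m * (t * (r - 1) + 1) ≤ m * t * r := by
      rw [mul_assoc]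
      refine Nat.mul_le_mul_left m ?_
      calc t * (r - 1) + 1 ≤ t * (r - 1) + t := by omega
        _ = t * r := by
          obtain ⟨s, rfl⟩ : ∃ s, r = s + 1 := ⟨r - 1, by omega⟩
          simp; ring
    refine h1.mono hle fun V₂ _ h2 => ⟨_, h2.mono_length hle, ?_⟩
    have h3 := modByMonic_add_div (blocks m (t * (r - 1)) a * blocks m (t * (r - 1)) b)
      (cyc R[X] r t)
    have h4 := congrArg (eval (X ^ m)) h3
    rw [eval_add, eval_mul, eval_mul, eval_blocks hm fun i hi => ha.1 i (by rwa [mul_assoc]),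
      eval_blocks hm fun i hi => hb.1 i (by rwa [mul_assoc])] at h4
    have h5 : (cyc R[X] r t).eval (X ^ m) = cyc R r (m * t) := by
      simp [cyc, eval_finsetSum, ← pow_mul, mul_assoc]
    rw [← h4, h5]
    exact Dvd.intro _ (add_sub_cancel_left _ _).symm
  refine (heval.bind (σ := m * t * (r - 1) * 1) ?_).le ?_
  · rintro V₁ - ⟨c, hc, hdvd⟩
    refine (Can.reduceKnown hr0 (Nat.mul_pos hm ht) hc).mono le_rfl ?_
    rintro V₂ - ⟨c', hc', hdvd'⟩
    refine ⟨c', hc', ?_⟩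
    convert hdvd.add hdvd' using 1
    ring
  · have h1 : o ≤ 2 * m := by
      rw [← hD]; exact Nat.le_mul_of_pos_right _ (by have := hp.two_le; omega)
    have h2 : r - 1 ≤ r := Nat.sub_le _ _
    have h3 : r ≤ 3 := by omega
    have h4 : (r - 1) * (t * μ) + 4 * r * r * r ^ i * (i + 1) * (4 * (o * r))
          + t * (r - 1) * (4 * (o * r)) + m * t * r + m * t * (r - 1) * 1
        ≤ (r - 1) * (t * μ) + 4 * 3 * 3 * t * (i + 1) * (4 * (2 * m * 3))
          + t * 3 * (4 * (2 * m * 3)) + m * t * 3 + m * t * 3 * 1 := by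
      gcongr <;> omega
    refine h4.trans ?_
    nlinarith [Nat.zero_le (m * t * i), Nat.zero_le (m * t)]

theorem MulModWithin.naive {r n : ℕ} (hr : 0 < r) (hn : 0 < n) :
    MulModWithin F R r n (4 * (n * r) * (n * r) + 3 * (n * r)) := by
  intro V a b ha hb
  have hle : n * (r - 1) ≤ n * r := Nat.mul_le_mul_left _ (Nat.sub_le _ _)
  refine ((Can.polyMulNaive ha hb).bind fun V' _ h =>
    Can.reduceLong hr hn (h.mono_length ?_)).le ?_
  · omega
  · refine Nat.add_le_add_right ?_ _
    calc 2 * (n * (r - 1)) * (n * (r - 1) * 2) ≤ 2 * (n * r) * (n * r * 2) := by gcongr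
      _ = _ := by ring

/-- The cost of the recursive multiplication modulo `cyc r r^k`, divided by `r^k` and up to a
constant factor: the length of the coefficients is about the square root of `r^k`. -/
def mulRec (k : ℕ) : ℕ := if k ≤ 2 then 1 else 2 * mulRec (k / 2 + 1) + (k + 1)

theorem mulRec_add_two_le (x : ℕ) (hx : 1 ≤ x) :
    mulRec (x + 2) + 6 ≤ 12 * (x * (Nat.log 2 x + 1)) := by
  induction x using Nat.strong_induction_on with
  | _ x ih =>
    rw [mulRec, if_neg (by omega)]
    have h1 : (x + 2) / 2 + 1 = x / 2 + 2 := by omega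
    rw [h1]
    rcases Nat.lt_or_ge x 2 with h2 | h2
    · obtain rfl : x = 1 := by omega
      simp [mulRec]
    · have h3 := ih (x / 2) (by omega) (by omega)
      have h4 : Nat.log 2 x = Nat.log 2 (x / 2) + 1 := Nat.log_of_one_lt_of_le (by norm_num) h2
      rw [h4]
      have h5 : x / 2 * 2 ≤ x := Nat.div_mul_le_self x 2
      nlinarith [Nat.mul_le_mul_right (Nat.log 2 (x / 2) + 1) h5]

/-- The function `(ℓ + 1) (log₂ (ℓ + 1) + 1)`, which for `ℓ = log n` is of the order of
`log n log log n`. -/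
def lgFactor (l : ℕ) : ℕ := (l + 1) * (Nat.log 2 (l + 1) + 1)

theorem lgFactor_mono {l l' : ℕ} (h : l ≤ l') : lgFactor l ≤ lgFactor l' := by
  unfold lgFactor
  gcongr

theorem one_le_lgFactor (l : ℕ) : 1 ≤ lgFactor l := Nat.mul_pos (Nat.succ_pos _) (Nat.succ_pos _)

theorem lgFactor_succ_le (l : ℕ) : lgFactor (l + 1) ≤ 4 * lgFactor l := by
  unfold lgFactor
  have h1 : Nat.log 2 (l + 1 + 1) ≤ Nat.log 2 (l + 1) + 1 := by
    calc Nat.log 2 (l + 1 + 1) ≤ Nat.log 2 ((l + 1) * 2) := Nat.log_mono_right (by omega)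
      _ = Nat.log 2 (l + 1) + 1 := Nat.log_mul_base (by norm_num) (by omega)
  calc (l + 1 + 1) * (Nat.log 2 (l + 1 + 1) + 1)
      ≤ (2 * (l + 1)) * (2 * (Nat.log 2 (l + 1) + 1)) :=
        Nat.mul_le_mul (by omega) (by omega)
    _ = _ := by ring

theorem mulRec_le (k : ℕ) : mulRec k ≤ 12 * lgFactor k := by
  rcases Nat.lt_or_ge k 3 with h | h
  · have := one_le_lgFactor k
    rw [mulRec, if_pos (by omega)]
    omega
  · have h1 := mulRec_add_two_le (k - 2) (by omega)
    have h2 : k - 2 + 2 = k := by omega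
    rw [h2] at h1
    have h3 : (k - 2) * (Nat.log 2 (k - 2) + 1) ≤ lgFactor k := by
      unfold lgFactor
      exact Nat.mul_le_mul (by omega) (Nat.succ_le_succ (Nat.log_mono_right (by omega)))
    omega

theorem MulModWithin.mono {r n τ σ : ℕ} (h : MulModWithin F R r n τ) (hle : τ ≤ σ) :
    MulModWithin F R r n σ := fun V a b ha hb => (h V a b ha hb).le hle

theorem mulModWithin_mulRec {r e : ℕ} (hr : r = 2 ∨ r = 3) (he : r ^ e * (r - 1) = 2)
    (he1 : e ≤ 1) (hrF : (r : F) ≠ 0) (k : ℕ) :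
    MulModWithin F R r (r ^ k) (1000 * (r ^ k * mulRec k)) := by
  have hr0 : 0 < r := by omega
  induction k using Nat.strong_induction_on with
  | _ k ih =>
    rcases Nat.lt_or_ge k 3 with hk | hk
    · refine (MulModWithin.naive hr0 (pow_pos hr0 k)).mono ?_
      rw [mulRec, if_pos (by omega), mul_one]
      have h1 : r ^ k ≤ 9 := by
        calc r ^ k ≤ 3 ^ 2 :=
              (Nat.pow_le_pow_left (by omega) k).trans
                (Nat.pow_le_pow_right (by norm_num) (by omega))
          _ = 9 := by norm_num
      have h2 : r ≤ 3 := by omega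
      calc 4 * (r ^ k * r) * (r ^ k * r) + 3 * (r ^ k * r)
          ≤ 4 * (r ^ k * 3) * (9 * 3) + 3 * (r ^ k * 3) := by gcongr
        _ ≤ _ := by omega
    · have h1 := MulModWithin.step (F := F) (R := R) (i := k - (k / 2 + 1 - e))
        (j := k / 2 + 1 - e) hr he hrF (by omega) (by
          rw [Nat.sub_add_cancel (by omega)]
          exact ih (k / 2 + 1) (by omega))
      rw [Nat.sub_add_cancel (by omega)] at h1
      refine h1.mono ?_
      have h0 : mulRec k = 2 * mulRec (k / 2 + 1) + (k + 1) := by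
        conv_lhs => rw [mulRec, if_neg (by omega : ¬ k ≤ 2)]
      rw [h0]
      have h2 : (r - 1) * (r ^ (k - (k / 2 + 1 - e)) * (1000 * (r ^ (k / 2 + 1)
          * mulRec (k / 2 + 1)))) = 1000 * (r ^ k * (2 * mulRec (k / 2 + 1))) := by
        have h3 : r ^ (k / 2 + 1) = r ^ (k / 2 + 1 - e) * r ^ e := by
          rw [← pow_add, Nat.sub_add_cancel (by omega)]
        have h4 : r ^ k = r ^ (k - (k / 2 + 1 - e)) * r ^ (k / 2 + 1 - e) := by
          rw [← pow_add, Nat.sub_add_cancel (by omega)]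
        rw [h3, h4, ← he]
        ring
      rw [h2]
      have h5 : (k - (k / 2 + 1 - e) + 1) * r ^ k ≤ (k + 1) * r ^ k :=
        Nat.mul_le_mul_right _ (by omega)
      calc _ ≤ 1000 * (r ^ k * (2 * mulRec (k / 2 + 1))) + 1000 * ((k + 1) * r ^ k) := by omega
        _ = _ := by ring

/-- The cost of the product of two polynomials of length `2^ℓ`. -/
def mulCost (l : ℕ) : ℕ := 288000 * (2 ^ l * lgFactor l)

/-- Multiplication of polynomials of length `n = 2^ℓ` over a field takes `O(n log n log log n)`
operations, by a radix-2 transform, or a radix-3 transform in characteristic two. -/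
theorem Can.polyMul {V : Set R} {l : ℕ} {p q : R[X]} (hp : CoeffsIn (Known F V) (2 ^ l) p)
    (hq : CoeffsIn (Known F V) (2 ^ l) q) :
    Can F (fun V' => CoeffsIn (Known F V') (2 ^ (l + 1)) (p * q)) V (mulCost l) := by
  obtain ⟨r, e, hr, he, he1, hrF⟩ : ∃ r e : ℕ, (r = 2 ∨ r = 3) ∧ r ^ e * (r - 1) = 2 ∧ e ≤ 1 ∧
      (r : F) ≠ 0 := by
    by_cases h2 : (2 : F) = 0
    · refine ⟨3, 0, .inr rfl, by norm_num, by norm_num, fun h => ?_⟩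
      exact one_ne_zero (α := F) (by push_cast at h; linear_combination h - h2)
    · exact ⟨2, 1, .inl rfl, by norm_num, le_rfl, by exact_mod_cast h2⟩
  have hr0 : 0 < r := by omega
  have hr1 : 1 < r := by omega
  set k := Nat.clog r (2 ^ (l + 1)) with hk
  have hk1 : 2 ^ (l + 1) ≤ r ^ k := Nat.le_pow_clog hr1 _
  have hk2 : k ≤ l + 1 := by
    rw [hk, Nat.clog_le_iff_le_pow hr1]
    exact Nat.pow_le_pow_left (by omega) _
  have hk3 : r ^ k ≤ 3 * 2 ^ (l + 1) := by
    have h1 : 1 < 2 ^ (l + 1) := Nat.one_lt_two_pow (by omega)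
    have h2 := Nat.pow_pred_clog_lt_self hr1 h1
    have h3 : 0 < k := Nat.clog_pos hr1 h1
    have h4 : r ^ k = r * r ^ (k - 1) := by rw [← pow_succ', Nat.sub_add_cancel h3]
    rw [h4]
    exact Nat.mul_le_mul (by omega) h2.le
  have hlen : 2 ^ (l + 1) ≤ r ^ k * (r - 1) := hk1.trans (Nat.le_mul_of_pos_right _ (by omega))
  have hle : 2 ^ l ≤ r ^ k * (r - 1) :=
    (Nat.pow_le_pow_right (by norm_num) (Nat.le_succ l)).trans hlen
  have hpq : ∀ i, 2 ^ (l + 1) ≤ i → (p * q).coeff i = 0 := fun i hi =>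
    coeff_mul_eq_zero_of_length hp.1 hq.1 i (by rw [pow_succ] at hi; omega)
  refine (mulModWithin_mulRec hr he he1 hrF k V p q (hp.mono_length hle)
    (hq.mono_length hle)).mono ?_ ?_
  · calc 1000 * (r ^ k * mulRec k) ≤ 1000 * ((3 * 2 ^ (l + 1)) * (12 * (4 * lgFactor l))) := by
          gcongr
          exact (mulRec_le k).trans (Nat.mul_le_mul_left _
            ((lgFactor_mono hk2).trans (lgFactor_succ_le l)))
      _ = mulCost l := by rw [mulCost]; ring
  · rintro V' - ⟨c, hc, hdvd⟩
    rw [eq_of_cyc_dvd_sub hr0 (pow_pos hr0 k) (fun i hi => hpq i (hlen.trans hi)) hc.1 hdvd]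
    refine ⟨fun i hi => ?_, hc.2⟩
    rw [← eq_of_cyc_dvd_sub hr0 (pow_pos hr0 k) (fun i hi => hpq i (hlen.trans hi)) hc.1 hdvd]
    exact hpq i hi

end Recursion

/-! ### Computation trees -/

section Reach

variable {Ω F : Type*} [Field F]

/-- The version with divisions and tests of `Can`, for families `Ω → F` of field elements: on the
inputs of `P`, where the elements of `V` have been computed, at most `τ` operations and tests
lead, on every branch, to a smaller set of inputs and a larger set of computed elements with the
property `Q`. -/
inductive Reach (Q : Set Ω → Set (Ω → F) → Prop) : Set Ω → Set (Ω → F) → ℕ → Prop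
  | done {P : Set Ω} {V : Set (Ω → F)} {τ : ℕ} (h : Q P V) : Reach Q P V τ
  | op {P : Set Ω} {V : Set (Ω → F)} {τ : ℕ} {x y : Ω → F} (z : Ω → F) (hx : Known F V x)
      (hy : Known F V y) (hz : (z = x + y ∨ z = x - y ∨ z = x * y) ∨ z = x / y)
      (h : Reach Q P (insert z V) τ) : Reach Q P V (τ + 1)
  | test {P : Set Ω} {V : Set (Ω → F)} {τ : ℕ} {x : Ω → F} (hx : Known F V x)
      (h₀ : Reach Q (P ∩ {ω | x ω = 0}) V τ) (h₁ : Reach Q (P ∩ {ω | x ω ≠ 0}) V τ) :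
      Reach Q P V (τ + 1)

variable {Q Q' : Set Ω → Set (Ω → F) → Prop} {P : Set Ω} {V : Set (Ω → F)} {τ σ : ℕ}

theorem Reach.le (h : Reach Q P V τ) (hle : τ ≤ σ) : Reach Q P V σ := by
  induction h generalizing σ with
  | done h => exact .done h
  | op z hx hy hz _ ih =>
    obtain ⟨s, rfl⟩ : ∃ s, σ = s + 1 := ⟨σ - 1, by omega⟩
    exact .op z hx hy hz (ih (by omega))
  | test hx _ _ ih₀ ih₁ =>
    obtain ⟨s, rfl⟩ : ∃ s, σ = s + 1 := ⟨σ - 1, by omega⟩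
    exact .test hx (ih₀ (by omega)) (ih₁ (by omega))

theorem Reach.bind (h : Reach Q P V τ)
    (k : ∀ P' V', P' ⊆ P → V ⊆ V' → Q P' V' → Reach Q' P' V' σ) : Reach Q' P V (τ + σ) := by
  induction h with
  | done h => exact (k _ _ subset_rfl subset_rfl h).le (by omega)
  | op z hx hy hz _ ih =>
    have := ih fun P' V' hP hV hQ => k P' V' hP ((Set.subset_insert _ _).trans hV) hQ
    exact (Reach.op z hx hy hz this).le (by omega)
  | test hx _ _ ih₀ ih₁ =>
    have h0 := ih₀ fun P' V' hP hV hQ => k P' V' (hP.trans Set.inter_subset_left) hV hQ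
    have h1 := ih₁ fun P' V' hP hV hQ => k P' V' (hP.trans Set.inter_subset_left) hV hQ
    exact (Reach.test hx h0 h1).le (by omega)

theorem Reach.mono (h : Reach Q P V τ) (hτ : τ ≤ σ)
    (k : ∀ P' V', P' ⊆ P → V ⊆ V' → Q P' V' → Q' P' V') : Reach Q' P V σ := by
  obtain ⟨s, rfl⟩ := Nat.exists_eq_add_of_le hτ
  exact h.bind fun P' V' hP hV hQ => .done (k P' V' hP hV hQ)

theorem Can.reach {Q : Set (Ω → F) → Prop} (h : Can F Q V τ)
    (k : ∀ V', V ⊆ V' → Q V' → Reach Q' P V' σ) : Reach Q' P V (τ + σ) := by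
  induction h with
  | done h => exact (k _ subset_rfl h).le (by omega)
  | op z hx hy hz _ ih =>
    have := ih fun V' hV hQ => k V' ((Set.subset_insert _ _).trans hV) hQ
    exact (Reach.op z hx hy (.inl hz) this).le (by omega)

theorem Reach.forall_range {Q : ℕ → Set Ω → Set (Ω → F) → Prop}
    (hQ : ∀ i P P' V V', P' ⊆ P → V ⊆ V' → Q i P V → Q i P' V') (n : ℕ)
    (h : ∀ i < n, ∀ P' V', P' ⊆ P → V ⊆ V' → Reach (Q i) P' V' τ) :
    Reach (fun P' V' => ∀ i < n, Q i P' V') P V (n * τ) := by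
  induction n with
  | zero => exact .done fun i hi => absurd hi (Nat.not_lt_zero i)
  | succ n ih =>
    rw [Nat.succ_mul]
    refine (ih fun i hi => h i (by omega)).bind fun P' V' hP hV hall => ?_
    refine (h n (by omega) P' V' hP hV).mono le_rfl fun P'' V'' hP' hV' hn i hi => ?_
    rcases Nat.lt_succ_iff_lt_or_eq.1 hi with hi | rfl
    · exact hQ i _ _ _ _ hP' hV' (hall i hi)
    · exact hn

theorem Reach.forall_fintype {ι : Type*} [Fintype ι] {Q : ι → Set Ω → Set (Ω → F) → Prop}
    (hQ : ∀ i P P' V V', P' ⊆ P → V ⊆ V' → Q i P V → Q i P' V')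
    (h : ∀ i, ∀ P' V', P' ⊆ P → V ⊆ V' → Reach (Q i) P' V' τ) :
    Reach (fun P' V' => ∀ i, Q i P' V') P V (Fintype.card ι * τ) := by
  have e := Fintype.equivFin ι
  refine (Reach.forall_range (Q := fun n P V => ∀ i, (e i : ℕ) = n → Q i P V)
    (fun n P P' V V' hP hV h i hi => hQ i _ _ _ _ hP hV (h i hi)) (Fintype.card ι)
    fun n hn P' V' hP hV => ?_).mono le_rfl fun P' V' _ _ h i => h (e i) (e i).2 i rfl
  refine (h (e.symm ⟨n, hn⟩) P' V' hP hV).mono le_rfl fun P'' V'' _ _ h i hi => ?_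
  have : i = e.symm ⟨n, hn⟩ := by rw [Equiv.eq_symm_apply]; exact Fin.ext hi
  rwa [this]

end Reach

section Trees

variable {Ω : Type*} {F : Type u} {I O : Type}

/-- Every element of `V` stands, on the inputs of `P`, in an input register or in a work register
with index below `N`. -/
def Stored (P : Set Ω) (V : Set (Ω → F)) (N : ℕ) (e : Ω → I ⊕ ℕ → F) : Prop :=
  ∀ v ∈ V, ∃ ρ : I ⊕ ℕ, (∀ n, ρ = Sum.inr n → n < N) ∧ ∀ ω ∈ P, e ω ρ = v ω

theorem Stored.update [DecidableEq (I ⊕ ℕ)] {P : Set Ω} {V : Set (Ω → F)} {N : ℕ}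
    {e : Ω → I ⊕ ℕ → F} (h : Stored P V N e) (z : Ω → F) :
    Stored P (insert z V) (N + 1) fun ω => Function.update (e ω) (Sum.inr N) (z ω) := by
  rintro v (rfl | hv)
  · exact ⟨Sum.inr N, fun n hn => by rw [← Sum.inr.inj hn]; omega,
      fun ω _ => Function.update_self _ _ _⟩
  · obtain ⟨ρ, h1, h2⟩ := h v hv
    refine ⟨ρ, fun n hn => (h1 n hn).trans (Nat.lt_succ_self N), fun ω hω => ?_⟩
    refine (Function.update_of_ne ?_ _ _).trans (h2 ω hω)
    rintro rfl
    exact lt_irrefl _ (h1 N rfl)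

theorem Stored.subset {P P' : Set Ω} {V V' : Set (Ω → F)} {N : ℕ} {e : Ω → I ⊕ ℕ → F}
    (h : Stored P V N e) (hP : P' ⊆ P) (hV : V' ⊆ V) : Stored P' V' N e := fun v hv =>
  let ⟨ρ, h1, h2⟩ := h v (hV hv); ⟨ρ, h1, fun ω hω => h2 ω (hP hω)⟩

variable [Field F]

/-- Some tree, started on the registers `e ω`, has the outputs `target ω` after at most `τ`
instructions, for all `ω` in `P`. -/
def Runs (P : Set Ω) (e : Ω → I ⊕ ℕ → F) (target : Ω → O → F) (τ : ℕ) : Prop :=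
  ∃ T : CompTree F I O, ∀ ω ∈ P, (T.exec (e ω)).1 = target ω ∧ (T.exec (e ω)).2 ≤ τ

open Classical in
/-- At most one instruction makes a known element stand in a register: constants are loaded. -/
theorem Stored.load {P : Set Ω} {V : Set (Ω → F)} {N : ℕ} {e : Ω → I ⊕ ℕ → F}
    (h : Stored P V N e) {x : Ω → F} (hx : Known F V x) {target : Ω → O → F} {τ : ℕ}
    (k : ∀ (N' : ℕ) (e' : Ω → I ⊕ ℕ → F), Stored P (insert x V) N' e' → Runs P e' target τ) :
    Runs P e target (τ + 1) := by
  rcases hx with hx | ⟨c, rfl⟩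
  · obtain ⟨T, hT⟩ := k N e (by rwa [Set.insert_eq_of_mem hx])
    exact ⟨T, fun ω hω => ⟨(hT ω hω).1, (hT ω hω).2.trans (Nat.le_succ _)⟩⟩
  · obtain ⟨T, hT⟩ := k (N + 1) _ (h.update (algebraMap F (Ω → F) c))
    exact ⟨.const (Sum.inr N) c T, fun ω hω => ⟨(hT ω hω).1, Nat.succ_le_succ (hT ω hω).2⟩⟩

open Classical in
/-- A computation in the sense of `Reach` is carried out by a computation tree; the factor three
pays for the loading of constants. -/
theorem Reach.runs {P : Set Ω} {V : Set (Ω → F)} {τ : ℕ} {target : Ω → O → F}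
    (h : Reach (fun P' V' => ∀ o, ∃ v ∈ V', ∀ ω ∈ P', v ω = target ω o) P V τ) (N : ℕ)
    (e : Ω → I ⊕ ℕ → F) (hreg : Stored P V N e) : Runs P e target (3 * τ) := by
  induction h generalizing N e with
  | done h =>
    choose v hv hvt using h
    choose ρ _ hρ using fun o => hreg (v o) (hv o)
    exact ⟨.halt ρ, fun ω hω => ⟨funext fun o => (hρ o ω hω).trans (hvt o ω hω), Nat.zero_le _⟩⟩
  | @op P V τ x y z hx hy hz _ ih =>
    refine hreg.load hx fun N₁ e₁ h₁ => h₁.load (hy.mono (Set.subset_insert _ _)) fun N₂ e₂ h₂ => ?_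
    obtain ⟨a, -, ha⟩ := h₂ x (Set.mem_insert_of_mem _ (Set.mem_insert _ _))
    obtain ⟨b, -, hb⟩ := h₂ y (Set.mem_insert _ _)
    obtain ⟨o, ho⟩ : ∃ o : ArithOp, ∀ ω, o.eval (x ω) (y ω) = z ω := by
      rcases hz with (rfl | rfl | rfl) | rfl
      exacts [⟨.add, fun _ => rfl⟩, ⟨.sub, fun _ => rfl⟩, ⟨.mul, fun _ => rfl⟩,
        ⟨.div, fun _ => rfl⟩]
    obtain ⟨T, hT⟩ := ih (N₂ + 1) _ ((h₂.update z).subset subset_rfl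
      (Set.insert_subset_insert ((Set.subset_insert _ _).trans (Set.subset_insert _ _))))
    refine ⟨.arith o (Sum.inr N₂) a b T, fun ω hω => ?_⟩
    have h3 := hT ω hω
    beta_reduce at h3
    rw [← ho ω, ← ha ω hω, ← hb ω hω] at h3
    exact ⟨h3.1, Nat.succ_le_succ h3.2⟩
  | @test P V τ x hx _ _ ih₀ ih₁ =>
    refine hreg.load hx fun N₁ e₁ h₁ => h₁.load (Known.zero _) fun N₂ e₂ h₂ => ?_
    obtain ⟨a, -, ha⟩ := h₂ x (Set.mem_insert_of_mem _ (Set.mem_insert _ _))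
    obtain ⟨b, -, hb⟩ := h₂ 0 (Set.mem_insert _ _)
    have hV : V ⊆ insert 0 (insert x V) := (Set.subset_insert _ _).trans (Set.subset_insert _ _)
    obtain ⟨T₀, hT₀⟩ := ih₀ N₂ e₂ (h₂.subset Set.inter_subset_left hV)
    obtain ⟨T₁, hT₁⟩ := ih₁ N₂ e₂ (h₂.subset Set.inter_subset_left hV)
    refine ⟨.test a b T₀ T₁, fun ω hω => ?_⟩
    have h0 : e₂ ω b = 0 := hb ω hω
    by_cases hx0 : x ω = 0
    · have h3 := hT₀ ω ⟨hω, hx0⟩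
      have h4 : e₂ ω a = e₂ ω b := by rw [ha ω hω, h0, hx0]
      simp only [CompTree.exec, if_pos h4]
      exact ⟨h3.1, Nat.succ_le_succ h3.2⟩
    · have h3 := hT₁ ω ⟨hω, hx0⟩
      have h4 : e₂ ω a ≠ e₂ ω b := by rw [ha ω hω, h0]; exact hx0
      simp only [CompTree.exec, if_neg h4]
      exact ⟨h3.1, Nat.succ_le_succ h3.2⟩

/-- Computation trees from computations in the sense of `Reach` that start with the inputs. -/
theorem Reach.exists_compTree {P : Set Ω} {τ : ℕ} {x : Ω → I → F} {target : Ω → O → F}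
    (h : Reach (fun P' V' => ∀ o, ∃ v ∈ V', ∀ ω ∈ P', v ω = target ω o) P
      (Set.range fun i ω => x ω i) τ) :
    ∃ T : CompTree F I O, ∀ ω ∈ P, T.output (x ω) = target ω ∧ T.cost (x ω) ≤ 3 * τ := by
  refine h.runs 0 (fun ω => CompTree.init (x ω)) ?_
  rintro _ ⟨i, rfl⟩
  exact ⟨Sum.inl i, fun n hn => by simp at hn, fun ω _ => rfl⟩

end Trees

/-! ### Moments of weighted points -/

section Moments

variable {ι A : Type*} [CommRing A]

/-- The polynomial `∏ (X - α_i)` over the indices of the list `l`. -/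
def nodePoly (α : ι → A) (l : List ι) : A[X] := (l.map fun i => X - C (α i)).prod

/-- The reversed polynomial `∏ (1 - α_i X)`. -/
def revNodePoly (α : ι → A) (l : List ι) : A[X] := (l.map fun i => 1 - C (α i) * X).prod

/-- The numerator `∑_i y_i ∏_{j ≠ i} (1 - α_j X)` of `∑_i y_i / (1 - α_i X)`. -/
def revNumer (α y : ι → A) : List ι → A[X]
  | [] => 0
  | i :: l => C (y i) * revNodePoly α l + (1 - C (α i) * X) * revNumer α y l

/-- The `k`-th moment `∑_i ρ_i α_i^k`. -/
def moment (α ρ : ι → A) (l : List ι) (k : ℕ) : A := (l.map fun i => ρ i * α i ^ k).sum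

/-- The sums `∑_{j < n} P_j μ_{k + j}`: if `μ` is the sequence of moments of the weights `ρ_i`,
they are the moments of the weights `ρ_i P(α_i)`. -/
def hankel (n : ℕ) (P : A[X]) (μ : ℕ → A) (k : ℕ) : A :=
  ∑ j ∈ Finset.range n, P.coeff j * μ (k + j)

theorem nodePoly_cons (α : ι → A) (i : ι) (l : List ι) :
    nodePoly α (i :: l) = (X - C (α i)) * nodePoly α l := by simp [nodePoly]

theorem revNodePoly_cons (α : ι → A) (i : ι) (l : List ι) :
    revNodePoly α (i :: l) = (1 - C (α i) * X) * revNodePoly α l := by simp [revNodePoly]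

theorem nodePoly_append (α : ι → A) (l l' : List ι) :
    nodePoly α (l ++ l') = nodePoly α l * nodePoly α l' := by simp [nodePoly]

theorem revNodePoly_append (α : ι → A) (l l' : List ι) :
    revNodePoly α (l ++ l') = revNodePoly α l * revNodePoly α l' := by simp [revNodePoly]

theorem moment_append (α ρ : ι → A) (l l' : List ι) (k : ℕ) :
    moment α ρ (l ++ l') k = moment α ρ l k + moment α ρ l' k := by simp [moment]

theorem revNumer_append (α y : ι → A) (l l' : List ι) :
    revNumer α y (l ++ l')
      = revNumer α y l * revNodePoly α l' + revNodePoly α l * revNumer α y l' := by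
  induction l with
  | nil => simp [revNumer, revNodePoly]
  | cons i l ih =>
    rw [List.cons_append, revNumer, revNumer, ih, revNodePoly_append, revNodePoly_cons]
    ring

theorem moment_congr {α ρ ρ' : ι → A} {l : List ι} (h : ∀ i ∈ l, ρ i = ρ' i) (k : ℕ) :
    moment α ρ l k = moment α ρ' l k := by
  unfold moment
  congr 1
  exact List.map_congr_left fun i hi => by rw [h i hi]

theorem moment_eq_zero {α ρ : ι → A} {l : List ι} (h : ∀ i ∈ l, ρ i = 0) (k : ℕ) :
    moment α ρ l k = 0 := by
  rw [moment_congr (ρ' := fun _ => 0) h]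
  simp [moment]

theorem coeff_nodePoly (α : ι → A) (l : List ι) (i : ℕ) (hi : l.length + 1 ≤ i) :
    (nodePoly α l).coeff i = 0 := by
  induction l generalizing i with
  | nil =>
    rw [nodePoly, List.map_nil, List.prod_nil, coeff_one, if_neg]
    rw [List.length_nil] at hi
    omega
  | cons j l ih =>
    rw [nodePoly_cons]
    refine coeff_mul_eq_zero_of_length (n := 2) (fun i hi => ?_) ih i ?_
    · rw [coeff_sub, coeff_X, coeff_C, if_neg (by omega), if_neg (by omega), sub_zero]
    · rw [List.length_cons] at hi
      omega

theorem coeff_revNodePoly (α : ι → A) (l : List ι) (i : ℕ) (hi : l.length + 1 ≤ i) :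
    (revNodePoly α l).coeff i = 0 := by
  induction l generalizing i with
  | nil =>
    rw [revNodePoly, List.map_nil, List.prod_nil, coeff_one, if_neg]
    rw [List.length_nil] at hi
    omega
  | cons j l ih =>
    rw [revNodePoly_cons]
    refine coeff_mul_eq_zero_of_length (n := 2) (fun i hi => ?_) ih i ?_
    · rw [coeff_sub, coeff_C_mul, coeff_X, coeff_one, if_neg (by omega), if_neg (by omega),
        mul_zero, sub_zero]
    · rw [List.length_cons] at hi
      omega

theorem coeff_revNumer (α y : ι → A) (l : List ι) (i : ℕ) (hi : l.length ≤ i) :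
    (revNumer α y l).coeff i = 0 := by
  induction l generalizing i with
  | nil => rw [revNumer, coeff_zero]
  | cons j l ih =>
    rw [List.length_cons] at hi
    rw [revNumer, coeff_add, coeff_C_mul, coeff_revNodePoly α l i hi, mul_zero, zero_add]
    refine coeff_mul_eq_zero_of_length (n := 2) (fun i hi => ?_) ih i (by omega)
    rw [coeff_sub, coeff_C_mul, coeff_X, coeff_one, if_neg (by omega), if_neg (by omega),
        mul_zero, sub_zero]

theorem coeff_zero_revNodePoly (α : ι → A) (l : List ι) : (revNodePoly α l).coeff 0 = 1 := by
  induction l with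
  | nil => simp [revNodePoly]
  | cons j l ih =>
    rw [revNodePoly_cons, mul_coeff_zero, ih]
    simp

theorem eval_nodePoly (α : ι → A) (l : List ι) (x : A) :
    (nodePoly α l).eval x = (l.map fun i => x - α i).prod := by
  induction l with
  | nil => simp [nodePoly]
  | cons j l ih =>
    rw [nodePoly_cons, eval_mul, ih]
    simp

theorem eval_nodePoly_of_mem (α : ι → A) {l : List ι} {i : ι} (hi : i ∈ l) :
    (nodePoly α l).eval (α i) = 0 := by
  rw [eval_nodePoly]
  exact List.prod_eq_zero (List.mem_map.2 ⟨i, hi, sub_self _⟩)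

theorem map_nodePoly {B : Type*} [CommRing B] (f : A →+* B) (α : ι → A) (l : List ι) :
    (nodePoly α l).map f = nodePoly (fun i => f (α i)) l := by
  induction l with
  | nil => simp [nodePoly]
  | cons j l ih =>
    rw [nodePoly_cons, nodePoly_cons, Polynomial.map_mul, ih]
    simp

/-- As power series, `∑_k m_k X^k = revNumer / revNodePoly` for the moments `m_k`. -/
theorem X_pow_dvd_revNodePoly_mul (α y : ι → A) (l : List ι) (T : ℕ) :
    X ^ T ∣ revNodePoly α l * (∑ k ∈ Finset.range T, C (moment α y l k) * X ^ k)
      - revNumer α y l := by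
  induction l with
  | nil => simp [moment, revNumer]
  | cons j l ih =>
    have h1 : ∑ k ∈ Finset.range T, C (moment α y (j :: l) k) * X ^ k
        = C (y j) * ∑ k ∈ Finset.range T, (C (α j) * X) ^ k
          + ∑ k ∈ Finset.range T, C (moment α y l k) * X ^ k := by
      rw [Finset.mul_sum, ← Finset.sum_add_distrib]
      refine Finset.sum_congr rfl fun k _ => ?_
      simp only [moment, List.map_cons, List.sum_cons, map_add, map_mul, map_pow, mul_pow]
      ring
    have h2 : (∑ k ∈ Finset.range T, (C (α j) * X) ^ k) * (1 - C (α j) * X)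
        = 1 - (C (α j) * X) ^ T := by
      have := geom_sum_mul (C (α j) * X) T
      linear_combination -this
    rw [h1, revNodePoly_cons, revNumer]
    have h3 : (1 - C (α j) * X) * revNodePoly α l
          * (C (y j) * ∑ k ∈ Finset.range T, (C (α j) * X) ^ k
            + ∑ k ∈ Finset.range T, C (moment α y l k) * X ^ k)
          - (C (y j) * revNodePoly α l + (1 - C (α j) * X) * revNumer α y l)
        = (1 - C (α j) * X) * (revNodePoly α l
            * (∑ k ∈ Finset.range T, C (moment α y l k) * X ^ k) - revNumer α y l)
          + X ^ T * (-(revNodePoly α l * C (y j) * C (α j) ^ T)) := by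
      rw [mul_pow] at h2
      linear_combination revNodePoly α l * C (y j) * h2
    rw [h3]
    exact dvd_add (ih.mul_left _) (Dvd.intro _ rfl)

theorem hankel_moment {α ρ : ι → A} {l : List ι} {h : ℕ} {P : A[X]}
    (hP : ∀ i, h + 1 ≤ i → P.coeff i = 0) {μ : ℕ → A}
    (hμ : ∀ k < 2 * h, μ k = moment α ρ l k) (k : ℕ) (hk : k < h) :
    hankel (h + 1) P μ k = moment α (fun i => ρ i * P.eval (α i)) l k := by
  have h1 : ∀ x, P.eval x = ∑ j ∈ Finset.range (h + 1), P.coeff j * x ^ j := by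
    intro x
    have h2 : CoeffsIn (fun _ => True) (h + 1) P := ⟨hP, fun _ => trivial⟩
    conv_lhs => rw [h2.eq_sum]
    simp [eval_finsetSum]
  have h2 : hankel (h + 1) P μ k
      = ∑ j ∈ Finset.range (h + 1), P.coeff j * moment α ρ l (k + j) := by
    refine Finset.sum_congr rfl fun j hj => ?_
    rw [Finset.mem_range] at hj
    rw [hμ _ (by omega)]
  rw [h2]
  clear hμ h2
  induction l with
  | nil => simp [moment]
  | cons i l ih =>
    simp only [moment, List.map_cons, List.sum_cons, mul_add, Finset.sum_add_distrib] at ih ⊢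
    rw [ih, h1, Finset.mul_sum, Finset.sum_mul]
    congr 1
    refine Finset.sum_congr rfl fun j _ => ?_
    ring

theorem X_pow_dvd_sub_chunk (n : ℕ) (p : A[X]) : X ^ n ∣ p - chunk n p 0 := by
  rw [X_pow_dvd_iff]
  intro d hd
  rw [coeff_sub, coeff_chunk, if_pos hd, mul_zero, zero_add, sub_self]

end Moments

section MomentPrograms

variable {ι F : Type*} [Field F] {R : Type*} [CommRing R] [Algebra F R]

theorem two_mul_mulCost_le (l : ℕ) : 2 * mulCost l ≤ mulCost (l + 1) := by
  unfold mulCost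
  calc 2 * (288000 * (2 ^ l * lgFactor l)) = 288000 * (2 ^ (l + 1) * lgFactor l) := by ring
    _ ≤ _ := by gcongr; exact lgFactor_mono (Nat.le_succ l)

theorem mulCost_mono {l l' : ℕ} (h : l ≤ l') : mulCost l ≤ mulCost l' := by
  unfold mulCost
  gcongr
  · norm_num
  · exact lgFactor_mono h

theorem two_pow_le_mulCost (l : ℕ) : 100 * 2 ^ l ≤ mulCost l := by
  unfold mulCost
  have h1 := one_le_lgFactor l
  calc 100 * 2 ^ l ≤ 288000 * (2 ^ l * 1) := by omega
    _ ≤ _ := by gcongr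

theorem CoeffsIn.chunk {V : Set R} {n m : ℕ} {p : R[X]} (hp : CoeffsIn (Known F V) n p) (k : ℕ) :
    CoeffsIn (Known F V) m (chunk m p k) := by
  refine ⟨fun i hi => by rw [coeff_chunk, if_neg (not_lt.2 hi)], fun i => ?_⟩
  rw [coeff_chunk]
  split_ifs
  · exact hp.2 _
  · exact Known.zero V

theorem CoeffsIn.one (V : Set R) {n : ℕ} (hn : 0 < n) : CoeffsIn (Known F V) n (1 : R[X]) := by
  refine ⟨fun i hi => by rw [coeff_one, if_neg (by omega)], fun i => ?_⟩
  rw [coeff_one]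
  split_ifs
  · exact Known.one V
  · exact Known.zero V

theorem Can.hankel {V : Set R} {l : ℕ} {P : R[X]} (hP : CoeffsIn (Known F V) (2 ^ l + 1) P)
    {μ : ℕ → R} (hμ : ∀ k < 2 ^ (l + 1), Known F V (μ k)) :
    Can F (fun V' => ∀ k < 2 ^ l, Known F V' (hankel (2 ^ l + 1) P μ k)) V (mulCost (l + 1)) := by
  set h := 2 ^ l with hh
  have hpos : 0 < h := pow_pos (by norm_num) l
  have h2 : 2 ^ (l + 1) = 2 * h := by rw [pow_succ, mul_comm]
  rw [h2] at hμ
  set m : R[X] := ∑ k ∈ Finset.range (2 * h), C (μ k) * X ^ k with hm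
  have hmc : ∀ k, m.coeff k = if k < 2 * h then μ k else 0 := by
    intro k
    simp [hm, coeff_X_pow]
  have hrev : ∀ i, (reflect h P).coeff i = if i < h + 1 then P.coeff (h - i) else 0 := by
    intro i
    rw [coeff_reflect]
    split_ifs with hi
    · rw [revAt_le (by omega)]
    · rw [revAt_eq_self_of_lt (by omega)]
      exact hP.1 _ (by omega)
  have h3 : CoeffsIn (Known F V) (2 ^ (l + 1)) (reflect h P) := by
    refine ⟨fun i hi => by rw [hrev, if_neg (by omega)], fun i => ?_⟩
    rw [hrev]
    split_ifs
    · exact hP.2 _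
    · exact Known.zero V
  have h4 : CoeffsIn (Known F V) (2 ^ (l + 1)) m := by
    refine ⟨fun i hi => by rw [hmc, if_neg (by omega)], fun i => ?_⟩
    rw [hmc]
    split_ifs with hi
    · exact hμ i hi
    · exact Known.zero V
  refine (Can.polyMul h3 h4).mono le_rfl fun V' _ h5 k hk => ?_
  have h6 := h5.2 (h + k)
  rw [coeff_mul_of_length (n := h + 1) (fun i hi => by rw [hrev, if_neg (by omega)]),
    ← Finset.sum_range_reflect] at h6
  convert h6 using 1
  refine Finset.sum_congr rfl fun j hj => ?_
  rw [Finset.mem_range] at hj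
  rw [hrev, if_pos (by omega), if_pos (by omega), hmc, if_pos (by omega)]
  congr 2 <;> omega

/-- Inversion of a power series with constant term one, by Newton iteration. -/
theorem Can.inverse {V : Set R} {n : ℕ} {G : R[X]} (hG : CoeffsIn (Known F V) n G)
    (hG0 : G.coeff 0 = 1) (L : ℕ) :
    Can F (fun V' => ∃ H, CoeffsIn (Known F V') (2 ^ L) H ∧ X ^ 2 ^ L ∣ G * H - 1) V
      (L * (3 * mulCost L)) := by
  induction L with
  | zero =>
    refine .done ⟨1, CoeffsIn.one V (by norm_num), ?_⟩
    rw [pow_zero, X_pow_dvd_iff]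
    intro d hd
    obtain rfl : d = 0 := by omega
    simp [hG0]
  | succ L ih =>
    have hle : 2 ^ (L + 1) = 2 ^ L + 2 ^ L := by rw [pow_succ]; ring
    have hcost : L * (3 * mulCost L) + (mulCost (L + 1) + 2 ^ (L + 1) + mulCost (L + 1))
        ≤ (L + 1) * (3 * mulCost (L + 1)) := by
      have h1 := mulCost_mono (Nat.le_succ L)
      have h2 := two_pow_le_mulCost (L + 1)
      calc L * (3 * mulCost L) + (mulCost (L + 1) + 2 ^ (L + 1) + mulCost (L + 1))
          ≤ L * (3 * mulCost (L + 1)) + 3 * mulCost (L + 1) := by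
            refine Nat.add_le_add (by gcongr) (by omega)
        _ = _ := by ring
    refine (ih.bind fun V₁ hV₁ ⟨H, hH, hdvd⟩ => ?_).le hcost
    have hH' : CoeffsIn (Known F V₁) (2 ^ (L + 1)) H :=
      hH.mono_length (Nat.pow_le_pow_right (by norm_num) (Nat.le_succ L))
    have hC : ∀ V' : Set R, CoeffsIn (Known F V') (2 ^ (L + 1)) (C (algebraMap F R 2)) := by
      intro V'
      refine ⟨fun i hi => ?_, fun i => ?_⟩
      · have := Nat.one_le_two_pow (n := L + 1)
        rw [coeff_C, if_neg (by omega)]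
      · rw [coeff_C]
        split_ifs
        · exact Known.const _ _
        · exact Known.zero _
    have hsub := (Can.polyMul hH' ((hG.mono hV₁).chunk 0)).bind fun V₂ hV₂ h1 =>
      Can.polySub (hC V₂) (h1.chunk 0)
    refine hsub.bind fun V₃ hV₃ h2 => ?_
    refine (Can.polyMul (hH'.mono hV₃) h2).mono le_rfl fun V₄ _ h3 =>
      ⟨_, h3.chunk (m := 2 ^ (L + 1)) 0, ?_⟩
    obtain ⟨D, hD⟩ := hdvd
    obtain ⟨E₁, hE₁⟩ := X_pow_dvd_sub_chunk (2 ^ (L + 1)) G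
    obtain ⟨E₂, hE₂⟩ := X_pow_dvd_sub_chunk (2 ^ (L + 1)) (H * chunk (2 ^ (L + 1)) G 0)
    obtain ⟨E₃, hE₃⟩ := X_pow_dvd_sub_chunk (2 ^ (L + 1))
      (H * (C (algebraMap F R 2) - chunk (2 ^ (L + 1)) (H * chunk (2 ^ (L + 1)) G 0) 0))
    have h4 : (X : R[X]) ^ 2 ^ (L + 1) = X ^ 2 ^ L * X ^ 2 ^ L := by rw [hle, pow_add]
    have h5 : (C (algebraMap F R 2) : R[X]) = 2 := by
      rw [map_ofNat (algebraMap F R) 2, map_ofNat C 2]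
    rw [h5] at hE₃ ⊢
    set G' := chunk (2 ^ (L + 1)) G 0
    set Q := chunk (2 ^ (L + 1)) (H * G') 0
    set H' := chunk (2 ^ (L + 1)) (H * (2 - Q)) 0
    refine ⟨-(D * D) + G * H * (E₂ + H * E₁) - G * E₃, ?_⟩
    -- modulo `X^{2^(L+1)}`: `G H' - 1 ≡ G H (2 - G H) - 1 = -(G H - 1)²`
    have h6 : (G * H - 1) * (G * H - 1) = X ^ 2 ^ (L + 1) * (D * D) := by rw [hD, h4]; ring
    linear_combination -h6 - G * hE₃ + G * H * hE₂ + G * H * H * hE₁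

/-- Moments from `revNumer` and `revNodePoly` by power series division. -/
theorem Can.momentsOfRev {V : Set R} {L n : ℕ} {α y : ι → R} {l : List ι} (hl : l.length ≤ 2 ^ L)
    (hG : CoeffsIn (Known F V) n (revNodePoly α l))
    (hN : ∀ i, Known F V ((revNumer α y l).coeff i)) :
    Can F (fun V' => ∀ k < 2 ^ L, Known F V' (moment α y l k)) V
      ((3 * L + 1) * mulCost L) := by
  refine ((Can.inverse hG (coeff_zero_revNodePoly α l) L).bind (σ := mulCost L)
    fun V₁ hV₁ ⟨H, hH, hdvd⟩ => ?_).le (le_of_eq (by ring))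
  have h1 : CoeffsIn (Known F V₁) (2 ^ L) (revNumer α y l) :=
    ⟨fun i hi => coeff_revNumer α y l i (hl.trans hi), fun i => (hN i).mono hV₁⟩
  refine (Can.polyMul hH h1).mono le_rfl fun V₂ _ h2 k hk => ?_
  set m : R[X] := ∑ k ∈ Finset.range (2 ^ L), C (moment α y l k) * X ^ k with hm
  have hmk : m.coeff k = moment α y l k := by
    simp [hm, coeff_X_pow, hk]
  have h3 : X ^ 2 ^ L ∣ H * revNumer α y l - m := by
    have h4 := X_pow_dvd_revNodePoly_mul α y l (2 ^ L)
    have h5 := ((hdvd.mul_right m).sub (h4.mul_left H))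
    convert h5 using 1
    ring
  have h4 := (X_pow_dvd_iff.1 h3) k hk
  rw [coeff_sub, sub_eq_zero, hmk] at h4
  rw [← h4]
  exact h2.2 k

end MomentPrograms

/-! ### Subproduct trees -/

section Trees

variable {ι F : Type*} [Field F] {R : Type*} [CommRing R] [Algebra F R]

/-- The coefficients of the polynomials `nodePoly` are known for `l`, for its halves, for the halves
of these, and so on, `n` times. -/
def TreeKnown (F : Type*) [Field F] {R : Type*} [CommRing R] [Algebra F R] (α : ι → R) :
    ℕ → List ι → Set R → Prop
  | 0, _, _ => True
  | n + 1, l, V =>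
    (∀ i, Known F V ((nodePoly α (l.take (2 ^ n))).coeff i)) ∧
    (∀ i, Known F V ((nodePoly α (l.drop (2 ^ n))).coeff i)) ∧
    TreeKnown F α n (l.take (2 ^ n)) V ∧ TreeKnown F α n (l.drop (2 ^ n)) V

theorem TreeKnown.mono {α : ι → R} {n : ℕ} {l : List ι} {V W : Set R} (h : TreeKnown F α n l V)
    (hVW : V ⊆ W) : TreeKnown F α n l W := by
  induction n generalizing l with
  | zero => trivial
  | succ n ih =>
    exact ⟨fun i => (h.1 i).mono hVW, fun i => (h.2.1 i).mono hVW, ih h.2.2.1, ih h.2.2.2⟩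

theorem length_take_le_two_pow {l : List ι} {n : ℕ} : (l.take (2 ^ n)).length ≤ 2 ^ n := by
  rw [List.length_take]; exact min_le_left _ _

theorem length_drop_le_two_pow {l : List ι} {n : ℕ} (hl : l.length ≤ 2 ^ (n + 1)) :
    (l.drop (2 ^ n)).length ≤ 2 ^ n := by
  rw [List.length_drop]; rw [pow_succ] at hl; omega

theorem two_pow_add_one_le (n : ℕ) : 2 ^ n + 1 ≤ 2 ^ (n + 1) := by
  have := Nat.one_le_two_pow (n := n)
  rw [pow_succ]; omega

theorem add_mul_mulCost_le (c l : ℕ) :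
    (l + 1) * (c * mulCost l) + (l + 1) * (c * mulCost l) + c * mulCost (l + 1)
      ≤ (l + 1 + 1) * (c * mulCost (l + 1)) := by
  calc (l + 1) * (c * mulCost l) + (l + 1) * (c * mulCost l) + c * mulCost (l + 1)
      = (l + 1) * (c * (2 * mulCost l)) + c * mulCost (l + 1) := by ring
    _ ≤ (l + 1) * (c * mulCost (l + 1)) + c * mulCost (l + 1) := by
        gcongr; exact two_mul_mulCost_le l
    _ = _ := by ring

theorem CoeffsIn.C_of_known {V : Set R} {n : ℕ} (hn : 0 < n) {a : R} (ha : Known F V a) :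
    CoeffsIn (Known F V) n (C a) := by
  refine ⟨fun i hi => by rw [coeff_C, if_neg (by omega)], fun i => ?_⟩
  rw [coeff_C]
  split_ifs
  · exact ha
  · exact Known.zero V

theorem CoeffsIn.X_mul {V : Set R} {n : ℕ} {p : R[X]} (hp : CoeffsIn (Known F V) n p) :
    CoeffsIn (Known F V) (n + 1) (X * p) := by
  refine ⟨fun i hi => ?_, fun i => ?_⟩
  · obtain ⟨i, rfl⟩ : ∃ j, i = j + 1 := ⟨i - 1, by omega⟩
    rw [coeff_X_mul]
    exact hp.1 i (by omega)
  · rcases i with _ | i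
    · rw [coeff_X_mul_zero]; exact Known.zero V
    · rw [coeff_X_mul]; exact hp.2 i

theorem Can.X_sub_C {V : Set R} {a : R} (ha : Known F V a) :
    Can F (fun V' => CoeffsIn (Known F V') 2 (X - C a)) V 2 := by
  refine Can.polySub ?_ (CoeffsIn.C_of_known (by norm_num) ha)
  have h := (CoeffsIn.one (F := F) V (n := 1) one_pos).X_mul
  rwa [mul_one] at h

/-- The subproduct tree over the points of `l`. -/
theorem Can.treeKnown {V : Set R} {α : ι → R} {n : ℕ} {l : List ι} (hl : l.length ≤ 2 ^ n)
    (hα : ∀ i ∈ l, Known F V (α i)) :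
    Can F (fun V' => (∀ i, Known F V' ((nodePoly α l).coeff i)) ∧ TreeKnown F α n l V') V
      ((n + 1) * (1 * mulCost n)) := by
  induction n generalizing V l with
  | zero =>
    rcases l with _ | ⟨i, l⟩
    · refine .done ⟨fun i => ?_, trivial⟩
      exact (CoeffsIn.one (F := F) V one_pos).2 i
    · obtain rfl : l = [] := by
        rw [List.length_cons, pow_zero] at hl
        exact List.eq_nil_of_length_eq_zero (by omega)
      refine (Can.X_sub_C (hα i (by simp))).mono ?_ fun V' _ h => ⟨fun j => ?_, trivial⟩
      · have := two_pow_le_mulCost 0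
        omega
      · have h1 : nodePoly α [i] = X - C (α i) := by simp [nodePoly]
        rw [h1]; exact h.2 j
  | succ n ih =>
    have hle := two_pow_add_one_le n
    have hl₁ := length_take_le_two_pow (l := l) (n := n)
    have hl₂ := length_drop_le_two_pow hl
    refine (((ih (V := V) (l := l.take (2 ^ n)) hl₁
      fun i hi => hα i (List.mem_of_mem_take hi)).bind fun V₁ hV₁ h₁ =>
        (ih (V := V₁) (l := l.drop (2 ^ n)) hl₂
          fun i hi => (hα i (List.mem_of_mem_drop hi)).mono hV₁).bind (σ := mulCost (n + 1))
            fun V₂ hV₂ h₂ => ?_).le ?_)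
    · have g₁ : CoeffsIn (Known F V₂) (2 ^ (n + 1)) (nodePoly α (l.take (2 ^ n))) :=
        ⟨fun i hi => coeff_nodePoly _ _ i (by omega), fun i => (h₁.1 i).mono hV₂⟩
      have g₂ : CoeffsIn (Known F V₂) (2 ^ (n + 1)) (nodePoly α (l.drop (2 ^ n))) :=
        ⟨fun i hi => coeff_nodePoly _ _ i (by omega), h₂.1⟩
      refine (Can.polyMul g₁ g₂).mono le_rfl fun V₃ hV₃ h₃ =>
        ⟨fun i => ?_, fun i => ((h₁.1 i).mono hV₂).mono hV₃, fun i => (h₂.1 i).mono hV₃,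
          (h₁.2.mono hV₂).mono hV₃, h₂.2.mono hV₃⟩
      have := h₃.2 i
      rwa [← nodePoly_append, List.take_append_drop] at this
    · have := add_mul_mulCost_le 1 n
      omega

theorem Can.revNumer {V : Set R} {α y : ι → R} {n : ℕ} {l : List ι} (hl : l.length ≤ 2 ^ n)
    (hα : ∀ i ∈ l, Known F V (α i)) (hy : ∀ i ∈ l, Known F V (y i)) :
    Can F (fun V' => (∀ i, Known F V' ((revNodePoly α l).coeff i)) ∧
      ∀ i, Known F V' ((revNumer α y l).coeff i)) V ((n + 1) * (4 * mulCost n)) := by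
  induction n generalizing V l with
  | zero =>
    rcases l with _ | ⟨i, l⟩
    · refine .done ⟨fun i => ?_, fun i => ?_⟩
      · exact (CoeffsIn.one (F := F) V one_pos).2 i
      · rw [PolyComputing.revNumer, coeff_zero]; exact Known.zero V
    · obtain rfl : l = [] := by
        rw [List.length_cons, pow_zero] at hl
        exact List.eq_nil_of_length_eq_zero (by omega)
      have h1 : revNodePoly α [i] = 1 - X * C (α i) := by simp [revNodePoly, mul_comm X]
      have h2 : PolyComputing.revNumer α y [i] = C (y i) := by
        simp [PolyComputing.revNumer, revNodePoly]
      refine (Can.polySub (n := 2) (CoeffsIn.one V (by norm_num))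
        (CoeffsIn.C_of_known one_pos (hα i (by simp))).X_mul).mono ?_
          fun V' hV' h => ⟨fun j => ?_, fun j => ?_⟩
      · have := two_pow_le_mulCost 0
        omega
      · rw [h1]; exact h.2 j
      · rw [h2]; exact (CoeffsIn.C_of_known one_pos ((hy i (by simp)).mono hV')).2 j
  | succ n ih =>
    have hle := two_pow_add_one_le n
    have hl₁ := length_take_le_two_pow (l := l) (n := n)
    have hl₂ := length_drop_le_two_pow hl
    refine ((ih (V := V) (l := l.take (2 ^ n)) length_take_le_two_pow
      (fun i hi => hα i (List.mem_of_mem_take hi))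
      (fun i hi => hy i (List.mem_of_mem_take hi))).bind fun V₁ hV₁ h₁ =>
        (ih (V := V₁) (l := l.drop (2 ^ n)) (length_drop_le_two_pow hl)
          (fun i hi => (hα i (List.mem_of_mem_drop hi)).mono hV₁)
          (fun i hi => (hy i (List.mem_of_mem_drop hi)).mono hV₁)).bind
            (σ := mulCost (n + 1) + (mulCost (n + 1) + (mulCost (n + 1) + 2 ^ (n + 1 + 1))))
            fun V₂ hV₂ h₂ => ?_).le ?_
    · have g₁ : CoeffsIn (Known F V₂) (2 ^ (n + 1)) (revNodePoly α (l.take (2 ^ n))) :=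
        ⟨fun i hi => coeff_revNodePoly _ _ i (by omega), fun i => (h₁.1 i).mono hV₂⟩
      have g₂ : CoeffsIn (Known F V₂) (2 ^ (n + 1)) (revNodePoly α (l.drop (2 ^ n))) :=
        ⟨fun i hi => coeff_revNodePoly _ _ i (by omega), h₂.1⟩
      have r₁ : CoeffsIn (Known F V₂) (2 ^ (n + 1)) (PolyComputing.revNumer α y (l.take (2 ^ n))) :=
        ⟨fun i hi => coeff_revNumer _ _ _ i (by omega), fun i => (h₁.2 i).mono hV₂⟩
      have r₂ : CoeffsIn (Known F V₂) (2 ^ (n + 1)) (PolyComputing.revNumer α y (l.drop (2 ^ n))) :=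
        ⟨fun i hi => coeff_revNumer _ _ _ i (by omega), h₂.2⟩
      refine (Can.polyMul g₁ g₂).bind fun V₃ hV₃ h₃ => ?_
      refine (Can.polyMul (r₁.mono hV₃) (g₂.mono hV₃)).bind fun V₄ hV₄ h₄ => ?_
      refine (Can.polyMul ((g₁.mono hV₃).mono hV₄) ((r₂.mono hV₃).mono hV₄)).bind
        fun V₅ hV₅ h₅ => ?_
      refine (Can.polyAdd (h₄.mono hV₅) h₅).mono le_rfl fun V₆ hV₆ h₆ => ⟨fun i => ?_, fun i => ?_⟩
      · have := h₃.2 i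
        rw [← revNodePoly_append, List.take_append_drop] at this
        exact ((this.mono hV₄).mono hV₅).mono hV₆
      · have := h₆.2 i
        rwa [← revNumer_append, List.take_append_drop] at this
    · have h1 := add_mul_mulCost_le 4 n
      have h2 := two_pow_le_mulCost (n + 1)
      have h3 : 2 ^ (n + 1 + 1) = 2 * 2 ^ (n + 1) := by rw [pow_succ 2 (n + 1), mul_comm]
      omega

/-- The moments of the weights `y_i` on the points `α_i`: a product with a transposed Vandermonde
matrix. -/
theorem Can.moments {V : Set R} {α y : ι → R} {n L : ℕ} {l : List ι} (hl : l.length ≤ 2 ^ n)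
    (hnL : n ≤ L) (hα : ∀ i ∈ l, Known F V (α i)) (hy : ∀ i ∈ l, Known F V (y i)) :
    Can F (fun V' => ∀ k < 2 ^ L, Known F V' (moment α y l k)) V ((L + 1) * (7 * mulCost L)) := by
  refine ((Can.revNumer hl hα hy).bind fun V₁ _ h => Can.momentsOfRev (n := l.length + 1)
    (hl.trans (Nat.pow_le_pow_right (by norm_num) hnL))
    ⟨fun i hi => coeff_revNodePoly _ _ i hi, h.1⟩ h.2).le ?_
  calc (n + 1) * (4 * mulCost n) + (3 * L + 1) * mulCost L
      ≤ (L + 1) * (4 * mulCost L) + (3 * L + 3) * mulCost L := by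
        gcongr
        · exact mulCost_mono hnL
        · norm_num
    _ = _ := by ring

end Trees

/-! ### Quotients of weights from moments -/

section Quotients

variable {ι Ω F : Type*}

/-- The points of `l` are pairwise distinct on the inputs of `P`. -/
def DistinctOn (α : ι → Ω → F) (l : List ι) (P : Set Ω) : Prop :=
  ∀ ω ∈ P, l.Pairwise fun i j => α i ω ≠ α j ω

theorem DistinctOn.take {α : ι → Ω → F} {l : List ι} {P P' : Set Ω} (h : DistinctOn α l P)
    (hP : P' ⊆ P) (n : ℕ) : DistinctOn α (l.take n) P' := fun ω hω =>
  (h ω (hP hω)).sublist (List.take_sublist _ _)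

theorem DistinctOn.drop {α : ι → Ω → F} {l : List ι} {P P' : Set Ω} (h : DistinctOn α l P)
    (hP : P' ⊆ P) (n : ℕ) : DistinctOn α (l.drop n) P' := fun ω hω =>
  (h ω (hP hω)).sublist (List.drop_sublist _ _)

theorem DistinctOn.ne {α : ι → Ω → F} {l : List ι} {P : Set Ω} (h : DistinctOn α l P) (n : ℕ)
    {ω : Ω} (hω : ω ∈ P) {i j : ι} (hi : i ∈ l.take n) (hj : j ∈ l.drop n) : α i ω ≠ α j ω := by
  have h1 := h ω hω
  rw [← List.take_append_drop n l, List.pairwise_append] at h1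
  exact h1.2.2 i hi j hj

variable [Field F]

theorem moment_mul_eval_right {A : Type*} [CommRing A] (α ρ : ι → A) (l₁ l₂ : List ι) (k : ℕ) :
    moment α (fun i => ρ i * (nodePoly α l₂).eval (α i)) (l₁ ++ l₂) k
      = moment α (fun i => ρ i * (nodePoly α l₂).eval (α i)) l₁ k := by
  rw [moment_append, moment_eq_zero (l := l₂), add_zero]
  intro i hi
  rw [eval_nodePoly_of_mem α hi, mul_zero]

theorem moment_mul_eval_left {A : Type*} [CommRing A] (α ρ : ι → A) (l₁ l₂ : List ι) (k : ℕ) :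
    moment α (fun i => ρ i * (nodePoly α l₁).eval (α i)) (l₁ ++ l₂) k
      = moment α (fun i => ρ i * (nodePoly α l₁).eval (α i)) l₂ k := by
  rw [moment_append, moment_eq_zero (l := l₁), zero_add]
  intro i hi
  rw [eval_nodePoly_of_mem α hi, mul_zero]

theorem eval_nodePoly_ne_zero {α : ι → F} {l : List ι} {x : F} (h : ∀ i ∈ l, x ≠ α i) :
    (nodePoly α l).eval x ≠ 0 := by
  rw [eval_nodePoly]
  refine List.prod_ne_zero fun h0 => ?_
  obtain ⟨i, hi, h1⟩ := List.mem_map.1 h0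
  exact h i hi (sub_eq_zero.1 h1)

/-- Reduction of a polynomial with coefficients in `Ω → F` to its value at `ω`. -/
def polyAt (ω : Ω) (p : (Ω → F)[X]) : F[X] := p.map (Pi.evalRingHom (fun _ => F) ω)

theorem coeff_polyAt (ω : Ω) (p : (Ω → F)[X]) (i : ℕ) : (polyAt ω p).coeff i = p.coeff i ω := by
  simp [polyAt]

theorem polyAt_nodePoly (ω : Ω) (α : ι → Ω → F) (l : List ι) :
    polyAt ω (nodePoly α l) = nodePoly (fun i => α i ω) l := by
  rw [polyAt, map_nodePoly]; rfl

theorem hankel_apply (ω : Ω) (n : ℕ) (P : (Ω → F)[X]) (μ : ℕ → Ω → F) (k : ℕ) :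
    hankel n P μ k ω = hankel n (polyAt ω P) (fun k => μ k ω) k := by
  simp [hankel, coeff_polyAt, Finset.sum_apply]

/-- The weights `ρ_i` are multiplied by the values at `α_i` of a polynomial `P`. -/
theorem hankel_apply_moment {α : ι → Ω → F} {n : ℕ} {l : List ι} {P : (Ω → F)[X]}
    (hP : ∀ i, 2 ^ n + 1 ≤ i → P.coeff i = 0) {μ : ℕ → Ω → F} {ρ : ι → F} {ω : Ω}
    (hμ : ∀ k < 2 ^ (n + 1), μ k ω = moment (fun i => α i ω) ρ l k) (k : ℕ) (hk : k < 2 ^ n) :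
    hankel (2 ^ n + 1) P μ k ω
      = moment (fun i => α i ω) (fun i => ρ i * (polyAt ω P).eval (α i ω)) l k := by
  rw [hankel_apply, hankel_moment (α := fun i => α i ω) (ρ := ρ) (l := l)
    (fun i hi => by rw [coeff_polyAt, hP i hi]; rfl)
    (fun k hk => hμ k (by rw [pow_succ]; omega)) k hk]

/-- Passing to the first half of the points: the weights `ρ_i` are multiplied by the values at `α_i`
of the polynomial that vanishes on the second half. -/
theorem hankel_nodePoly_drop {α : ι → Ω → F} {n : ℕ} {l : List ι} (hl : l.length ≤ 2 ^ (n + 1))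
    {μ : ℕ → Ω → F} {ρ : ι → F} {ω : Ω}
    (hμ : ∀ k < 2 ^ (n + 1), μ k ω = moment (fun i => α i ω) ρ l k) (k : ℕ) (hk : k < 2 ^ n) :
    hankel (2 ^ n + 1) (nodePoly α (l.drop (2 ^ n))) μ k ω
      = moment (fun i => α i ω)
        (fun i => ρ i * (nodePoly (fun i => α i ω) (l.drop (2 ^ n))).eval (α i ω))
        (l.take (2 ^ n)) k := by
  have h2 := length_drop_le_two_pow hl
  have h3 := moment_mul_eval_right (fun i => α i ω) ρ (l.take (2 ^ n)) (l.drop (2 ^ n)) k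
  rw [List.take_append_drop] at h3
  rw [hankel_apply_moment (fun i hi => coeff_nodePoly _ _ i (by omega)) hμ k hk,
    polyAt_nodePoly, h3]

theorem hankel_nodePoly_take {α : ι → Ω → F} {n : ℕ} {l : List ι}
    {μ : ℕ → Ω → F} {ρ : ι → F} {ω : Ω}
    (hμ : ∀ k < 2 ^ (n + 1), μ k ω = moment (fun i => α i ω) ρ l k) (k : ℕ) (hk : k < 2 ^ n) :
    hankel (2 ^ n + 1) (nodePoly α (l.take (2 ^ n))) μ k ω
      = moment (fun i => α i ω)
        (fun i => ρ i * (nodePoly (fun i => α i ω) (l.take (2 ^ n))).eval (α i ω))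
        (l.drop (2 ^ n)) k := by
  have h2 := length_take_le_two_pow (l := l) (n := n)
  have h3 := moment_mul_eval_left (fun i => α i ω) ρ (l.take (2 ^ n)) (l.drop (2 ^ n)) k
  rw [List.take_append_drop] at h3
  rw [hankel_apply_moment (fun i hi => coeff_nodePoly _ _ i (by omega)) hμ k hk,
    polyAt_nodePoly, h3]

theorem coeffsIn_nodePoly_take {V : Set (Ω → F)} {α : ι → Ω → F} {n : ℕ} {l : List ι}
    (h : TreeKnown F α (n + 1) l V) :
    CoeffsIn (Known F V) (2 ^ n + 1) (nodePoly α (l.take (2 ^ n))) :=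
  ⟨fun i hi => coeff_nodePoly _ _ i (by
    have := length_take_le_two_pow (l := l) (n := n); omega), h.1⟩

theorem coeffsIn_nodePoly_drop {V : Set (Ω → F)} {α : ι → Ω → F} {n : ℕ} {l : List ι}
    (hl : l.length ≤ 2 ^ (n + 1)) (h : TreeKnown F α (n + 1) l V) :
    CoeffsIn (Known F V) (2 ^ n + 1) (nodePoly α (l.drop (2 ^ n))) :=
  ⟨fun i hi => coeff_nodePoly _ _ i (by have := length_drop_le_two_pow hl; omega), h.2.1⟩

/-- From the moments of the weights `ρ₁` and `ρ₂` on distinct points, the quotients `ρ₂ / ρ₁` are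
found by descent in the subproduct tree: both weights of a point are multiplied by the same nonzero
factor. -/
theorem Reach.quotients {α : ι → Ω → F} (n : ℕ) {l : List ι} (hl : l.length ≤ 2 ^ n) {P : Set Ω}
    {V : Set (Ω → F)} (hα : DistinctOn α l P) (htree : TreeKnown F α n l V) {μ₁ μ₂ : ℕ → Ω → F}
    (hμ₁ : ∀ k < 2 ^ n, Known F V (μ₁ k)) (hμ₂ : ∀ k < 2 ^ n, Known F V (μ₂ k))
    {ρ₁ ρ₂ : Ω → ι → F}
    (h₁ : ∀ ω ∈ P, ∀ k < 2 ^ n, μ₁ k ω = moment (fun i => α i ω) (ρ₁ ω) l k)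
    (h₂ : ∀ ω ∈ P, ∀ k < 2 ^ n, μ₂ k ω = moment (fun i => α i ω) (ρ₂ ω) l k) :
    Reach (fun P' V' => ∀ i ∈ l, ∃ v ∈ V', ∀ ω ∈ P', v ω = ρ₂ ω i / ρ₁ ω i) P V
      ((n + 1) * (4 * mulCost n)) := by
  induction n generalizing l P V μ₁ μ₂ ρ₁ ρ₂ with
  | zero =>
    rcases l with _ | ⟨i, l⟩
    · exact .done fun i hi => absurd hi List.not_mem_nil
    · obtain rfl : l = [] := by
        rw [List.length_cons, pow_zero] at hl
        exact List.eq_nil_of_length_eq_zero (by omega)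
      have hle : 1 ≤ (0 + 1) * (4 * mulCost 0) := by
        have := two_pow_le_mulCost 0
        omega
      refine Reach.le (.op (μ₂ 0 / μ₁ 0) (hμ₂ 0 (by norm_num)) (hμ₁ 0 (by norm_num)) (.inr rfl)
        (.done (τ := 0) fun j hj => ⟨_, Set.mem_insert _ _, fun ω hω => ?_⟩)) hle
      obtain rfl : j = i := by simpa using hj
      rw [Pi.div_apply, h₁ ω hω 0 (by norm_num), h₂ ω hω 0 (by norm_num)]
      simp [moment]
  | succ n ih =>
    have hpt := coeffsIn_nodePoly_take htree
    have hpd := coeffsIn_nodePoly_drop hl htree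
    refine Reach.le (σ := (n + 1 + 1) * (4 * mulCost (n + 1))) ((Can.hankel hpd hμ₁).reach
      fun V₁ hV₁ k₁ => (Can.hankel (hpd.mono hV₁) fun k hk => (hμ₂ k hk).mono hV₁).reach
      fun V₂ hV₂ k₂ => (Can.hankel ((hpt.mono hV₁).mono hV₂)
        fun k hk => ((hμ₁ k hk).mono hV₁).mono hV₂).reach
      fun V₃ hV₃ k₃ => (Can.hankel (((hpt.mono hV₁).mono hV₂).mono hV₃)
        fun k hk => (((hμ₂ k hk).mono hV₁).mono hV₂).mono hV₃).reach
      (σ := (n + 1) * (4 * mulCost n) + (n + 1) * (4 * mulCost n))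
      fun V₄ hV₄ k₄ => ?_) ?_
    · have htree' := ((((htree.mono hV₁).mono hV₂).mono hV₃).mono hV₄)
      refine (ih length_take_le_two_pow (hα.take subset_rfl _) htree'.2.2.1
        (fun k hk => (((k₁ k hk).mono hV₂).mono hV₃).mono hV₄)
        (fun k hk => ((k₂ k hk).mono hV₃).mono hV₄)
        (fun ω hω k hk => hankel_nodePoly_drop hl (h₁ ω hω) k hk)
        (fun ω hω k hk => hankel_nodePoly_drop hl (h₂ ω hω) k hk)).bind
        fun P₅ V₅ hP₅ hV₅ k₅ => ?_
      refine (ih (length_drop_le_two_pow hl) (hα.drop hP₅ _) (htree'.mono hV₅).2.2.2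
        (fun k hk => ((k₃ k hk).mono hV₄).mono hV₅) (fun k hk => (k₄ k hk).mono hV₅)
        (fun ω hω k hk => hankel_nodePoly_take (h₁ ω (hP₅ hω)) k hk)
        (fun ω hω k hk => hankel_nodePoly_take (h₂ ω (hP₅ hω)) k hk)).mono le_rfl
        fun P₆ V₆ hP₆ hV₆ k₆ i hi => ?_
      rw [← List.take_append_drop (2 ^ n) l, List.mem_append] at hi
      rcases hi with hi | hi
      · obtain ⟨v, hv, hvω⟩ := k₅ i hi
        refine ⟨v, hV₆ hv, fun ω hω => ?_⟩
        rw [hvω ω (hP₆ hω), mul_div_mul_right]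
        exact eval_nodePoly_ne_zero fun j hj => hα.ne _ (hP₅ (hP₆ hω)) hi hj
      · obtain ⟨v, hv, hvω⟩ := k₆ i hi
        refine ⟨v, hv, fun ω hω => ?_⟩
        rw [hvω ω hω, mul_div_mul_right]
        exact eval_nodePoly_ne_zero fun j hj => (hα.ne _ (hP₅ (hP₆ hω)) hj hi).symm
    · have := add_mul_mulCost_le 4 n
      omega

end Quotients

/-! ### Bases of interpolation modules -/

section Module

variable {ι F : Type*} [Field F]

/-- The degree of `p`, shifted by `s`, is at most `t`. -/
def DegLe (s : ℕ) (t : WithBot ℕ) (p : F[X]) : Prop := p.degree + s ≤ t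

theorem DegLe.add {s : ℕ} {t : WithBot ℕ} {p q : F[X]} (hp : DegLe s t p) (hq : DegLe s t q) :
    DegLe s t (p + q) := by
  refine (add_le_add_left (degree_add_le p q) _).trans ?_
  rcases max_choice p.degree q.degree with h | h <;> rw [h]
  exacts [hp, hq]

theorem DegLe.neg {s : ℕ} {t : WithBot ℕ} {p : F[X]} (hp : DegLe s t p) : DegLe s t (-p) := by
  unfold DegLe; rwa [degree_neg]

theorem DegLe.mul_C {s s' : ℕ} {t : WithBot ℕ} {p : F[X]} {c : F} (hp : DegLe s t p)
    (h : c = 0 ∨ s' ≤ s) : DegLe s' t (p * C c) := by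
  rcases h with rfl | h
  · simp [DegLe]
  · refine le_trans (add_le_add (degree_mul_le _ _) (Nat.cast_le.2 h)) (le_trans ?_ hp)
    refine add_le_add_left ?_ _
    calc p.degree + (C c).degree ≤ p.degree + 0 := add_le_add_right degree_C_le _
      _ = p.degree := add_zero _

theorem degLe_mul_X_sub_C {s : ℕ} {t : WithBot ℕ} {p : F[X]} (a : F) :
    DegLe s t (p * (X - C a)) ↔ DegLe (s + 1) t p := by
  unfold DegLe
  rw [degree_mul, degree_X_sub_C, add_assoc]
  push_cast
  rw [add_comm (1 : WithBot ℕ)]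

/-- The rows of `B` are a basis of the module of the pairs `u` of polynomials with
`∑_j u_j(α_i) ρ_j(i) = 0` for all `i` in `l`. The basis is reduced: if the degrees of the components
of a pair are counted with the shifts `s`, then the degree of a combination of the rows is the
maximum over the rows of the degree of the coefficient plus the degree `s'` of the row. -/
structure IntBasis (α : ι → F) (ρ : Fin 2 → ι → F) (l : List ι) (s s' : Fin 2 → ℕ)
    (B : Matrix (Fin 2) (Fin 2) F[X]) : Prop where
  degree_iff : ∀ u t, (∀ j, DegLe (s j) t ((u ᵥ* B) j)) ↔ ∀ j, DegLe (s' j) t (u j)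
  vanish : ∀ r, ∀ i ∈ l, ∑ j, (B r j).eval (α i) * ρ j i = 0
  generate : ∀ u : Fin 2 → F[X], (∀ i ∈ l, ∑ j, (u j).eval (α i) * ρ j i = 0) → ∃ v, u = v ᵥ* B

theorem sum_eval_vecMul (u : Fin 2 → F[X]) (B : Matrix (Fin 2) (Fin 2) F[X]) (x : F)
    (ρ : Fin 2 → F) :
    ∑ j, ((u ᵥ* B) j).eval x * ρ j = ∑ r, (u r).eval x * ∑ j, (B r j).eval x * ρ j := by
  simp [Matrix.vecMul, dotProduct, Fin.sum_univ_two]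
  ring

/-- The divide-and-conquer step: a basis for the points of `l₁`, and a basis for the points of
`l₂` with the weights that result from the first one. -/
theorem IntBasis.mul {α : ι → F} {ρ : Fin 2 → ι → F} {l₁ l₂ : List ι} {s s' s'' : Fin 2 → ℕ}
    {B₁ B₂ : Matrix (Fin 2) (Fin 2) F[X]} {c : ι → F} (hc : ∀ i ∈ l₁, c i ≠ 0)
    (h₁ : IntBasis α (fun j i => ρ j i * c i) l₁ s s' B₁)
    (h₂ : IntBasis α (fun r i => ∑ j, (B₁ r j).eval (α i) * ρ j i) l₂ s' s'' B₂) :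
    IntBasis α ρ (l₁ ++ l₂) s s'' (B₂ * B₁) := by
  have hcancel : ∀ (u : Fin 2 → F[X]) i, i ∈ l₁ →
      (∑ j, (u j).eval (α i) * (ρ j i * c i) = 0 ↔ ∑ j, (u j).eval (α i) * ρ j i = 0) := by
    intro u i hi
    have : ∑ j, (u j).eval (α i) * (ρ j i * c i) = (∑ j, (u j).eval (α i) * ρ j i) * c i := by
      rw [Finset.sum_mul]; exact Finset.sum_congr rfl fun j _ => by ring
    rw [this, mul_eq_zero, or_iff_left (hc i hi)]
  refine ⟨fun u t => ?_, fun r i hi => ?_, fun u hu => ?_⟩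
  · rw [← Matrix.vecMul_vecMul, h₁.degree_iff, h₂.degree_iff]
  · have h := sum_eval_vecMul (B₂ r) B₁ (α i) fun j => ρ j i
    have h' : B₂ r ᵥ* B₁ = (B₂ * B₁) r := by
      ext1 j; rfl
    rw [h'] at h
    rw [h]
    rcases List.mem_append.1 hi with hi | hi
    · exact Finset.sum_eq_zero fun r' _ => by
        rw [(hcancel (B₁ r') i hi).1 (h₁.vanish r' i hi), mul_zero]
    · exact h₂.vanish r i hi
  · obtain ⟨v, rfl⟩ := h₁.generate u fun i hi =>
      (hcancel u i hi).2 (hu i (List.mem_append_left _ hi))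
    obtain ⟨w, rfl⟩ := h₂.generate v fun i hi => by
      rw [← sum_eval_vecMul v B₁ (α i) fun j => ρ j i]
      exact hu i (List.mem_append_right _ hi)
    exact ⟨w, by rw [Matrix.vecMul_vecMul]⟩

theorem IntBasis.one {α : ι → F} {ρ : Fin 2 → ι → F} {l : List ι} (s : Fin 2 → ℕ)
    (hρ : ∀ i ∈ l, ∀ j, ρ j i = 0) : IntBasis α ρ l s s 1 := by
  refine ⟨fun u t => by rw [Matrix.vecMul_one], fun r i hi => ?_, fun u _ =>
    ⟨u, by rw [Matrix.vecMul_one]⟩⟩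
  exact Finset.sum_eq_zero fun j _ => by rw [hρ i hi j, mul_zero]

/-- The basis for a single point `a` with nonzero weight in the first component. -/
theorem IntBasis.first {α : ι → F} {ρ : Fin 2 → ι → F} {i : ι} (s : Fin 2 → ℕ) (hρ : ρ 0 i ≠ 0)
    (h : ρ 1 i = 0 ∨ s 0 ≤ s 1) :
    IntBasis α ρ [i] s ![s 0 + 1, s 1] !![X - C (α i), 0; C (0 - ρ 1 i / ρ 0 i), 1] := by
  have hc : 0 - ρ 1 i / ρ 0 i = 0 ∨ s 0 ≤ s 1 := h.imp_left fun h => by rw [h]; simp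
  have hvec : ∀ u : Fin 2 → F[X], u ᵥ* !![X - C (α i), 0; C (0 - ρ 1 i / ρ 0 i), 1]
      = ![u 0 * (X - C (α i)) + u 1 * C (0 - ρ 1 i / ρ 0 i), u 1] := by
    intro u
    ext1 j
    fin_cases j <;> simp [Matrix.vecMul, dotProduct, Fin.sum_univ_two]
  refine ⟨fun u t => ?_, fun r j hj => ?_, fun u hu => ?_⟩
  · rw [hvec, Fin.forall_fin_two, Fin.forall_fin_two]
    simp only [Matrix.cons_val_zero, Matrix.cons_val_one]
    refine and_congr_left fun h1 => ?_
    rw [← degLe_mul_X_sub_C (α i)]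
    refine ⟨fun h0 => ?_, fun h0 => h0.add (h1.mul_C hc)⟩
    have := h0.add (h1.mul_C hc).neg
    rwa [add_neg_cancel_right] at this
  · obtain rfl : j = i := by simpa using hj
    fin_cases r
    · simp [Fin.sum_univ_two]
    · simp [Fin.sum_univ_two]
      field_simp
      ring
  · have h0 := hu i (by simp)
    rw [Fin.sum_univ_two] at h0
    obtain ⟨q, hq⟩ : X - C (α i) ∣ u 0 - u 1 * C (0 - ρ 1 i / ρ 0 i) := by
      rw [dvd_iff_isRoot, IsRoot, eval_sub, eval_mul, eval_C]
      field_simp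
      linear_combination h0
    refine ⟨![q, u 1], ?_⟩
    rw [hvec]
    ext1 j
    fin_cases j
    · change u 0 = q * (X - C (α i)) + u 1 * C (0 - ρ 1 i / ρ 0 i)
      linear_combination hq
    · rfl

theorem IntBasis.second {α : ι → F} {ρ : Fin 2 → ι → F} {i : ι} (s : Fin 2 → ℕ) (hρ : ρ 1 i ≠ 0)
    (h : ρ 0 i = 0 ∨ s 1 ≤ s 0) :
    IntBasis α ρ [i] s ![s 0, s 1 + 1] !![1, C (0 - ρ 0 i / ρ 1 i); 0, X - C (α i)] := by
  have hc : 0 - ρ 0 i / ρ 1 i = 0 ∨ s 1 ≤ s 0 := h.imp_left fun h => by rw [h]; simp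
  have hvec : ∀ u : Fin 2 → F[X], u ᵥ* !![1, C (0 - ρ 0 i / ρ 1 i); 0, X - C (α i)]
      = ![u 0, u 1 * (X - C (α i)) + u 0 * C (0 - ρ 0 i / ρ 1 i)] := by
    intro u
    ext1 j
    fin_cases j
    · simp [Matrix.vecMul, dotProduct, Fin.sum_univ_two]
    · simp [Matrix.vecMul, dotProduct, Fin.sum_univ_two]
      ring
  refine ⟨fun u t => ?_, fun r j hj => ?_, fun u hu => ?_⟩
  · rw [hvec, Fin.forall_fin_two, Fin.forall_fin_two]
    simp only [Matrix.cons_val_zero, Matrix.cons_val_one]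
    refine and_congr_right fun h1 => ?_
    rw [← degLe_mul_X_sub_C (α i)]
    refine ⟨fun h0 => ?_, fun h0 => h0.add (h1.mul_C hc)⟩
    have := h0.add (h1.mul_C hc).neg
    rwa [add_neg_cancel_right] at this
  · obtain rfl : j = i := by simpa using hj
    fin_cases r
    · simp [Fin.sum_univ_two]
      field_simp
      ring
    · simp [Fin.sum_univ_two]
  · have h0 := hu i (by simp)
    rw [Fin.sum_univ_two] at h0
    obtain ⟨q, hq⟩ : X - C (α i) ∣ u 1 - u 0 * C (0 - ρ 0 i / ρ 1 i) := by
      rw [dvd_iff_isRoot, IsRoot, eval_sub, eval_mul, eval_C]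
      field_simp
      linear_combination h0
    refine ⟨![u 0, q], ?_⟩
    rw [hvec]
    ext1 j
    fin_cases j
    · rfl
    · change u 1 = q * (X - C (α i)) + u 0 * C (0 - ρ 0 i / ρ 1 i)
      linear_combination hq

/-- The decoding equation: let `y_i = f(α_i)` for all but at most `A` of the points, where
`deg f ≤ D`, and let there be more than `D + 2 A` points. A reduced basis of the module of the pairs
`(E, N)` with `E(α_i) y_i = N(α_i)`, where the degrees of `E` are shifted by `D`, has a row of
degree at most `D + A`, and this row satisfies `N = f E` and `E ∣ ∏ (X - α_i)`, where the
product is over the errors. -/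
theorem IntBasis.decode [DecidableEq F] {α : ι → F} {ρ : Fin 2 → ι → F} {l : List ι}
    (hl : l.Pairwise fun i j => α i ≠ α j) {s' : Fin 2 → ℕ} {B : Matrix (Fin 2) (Fin 2) F[X]}
    {D A : ℕ} {f : F[X]} (hf : f.degree ≤ D) (hB : IntBasis α ρ l ![D, 0] s' B)
    (hρ : ∀ i ∈ l, ρ 1 i = -1) (hlen : D + 2 * A < l.length)
    (herr : (l.filter fun i => ρ 0 i ≠ f.eval (α i)).length ≤ A) :
    (∃ r, s' r ≤ D + A) ∧ ∀ r, s' r ≤ D + A →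
      B r 1 = f * B r 0 ∧ B r 0 ∣ nodePoly α (l.filter fun i => ρ 0 i ≠ f.eval (α i)) := by
  set t : WithBot ℕ := ((D + A : ℕ) : WithBot ℕ) with ht
  -- a solution of small degree is a multiple of `(1, f)`
  have hsmall : ∀ u : Fin 2 → F[X], (∀ j, DegLe ((![D, 0] : Fin 2 → ℕ) j) t (u j)) →
      (∀ i ∈ l, ∑ j, (u j).eval (α i) * ρ j i = 0) → u 1 = f * u 0 := by
    intro u hu hv
    set g := l.filter fun i => ρ 0 i = f.eval (α i) with hg
    have hglen : D + A < g.length := by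
      have h1 := List.length_eq_length_filter_add (l := l) fun i => decide (ρ 0 i = f.eval (α i))
      have h2 : (l.filter fun i => !decide (ρ 0 i = f.eval (α i))).length
          = (l.filter fun i => decide (ρ 0 i ≠ f.eval (α i))).length := by
        congr 2; ext i; simp
      rw [h2] at h1
      have h3 : (l.filter fun i => decide (ρ 0 i = f.eval (α i))).length = g.length := rfl
      omega
    have hnd : (g.map α).Nodup := by
      rw [List.Nodup, List.pairwise_map]
      exact hl.sublist List.filter_sublist
    have hdeg : (u 1 - f * u 0).degree ≤ t := by
      refine (degree_sub_le _ _).trans (max_le ?_ ?_)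
      · have := hu 1
        simpa [DegLe] using this
      · refine (degree_mul_le _ _).trans (le_trans (add_le_add_left hf _) ?_)
        have := hu 0
        rw [add_comm]
        simpa [DegLe] using this
    rw [← sub_eq_zero]
    by_contra hne
    have h1 : (g.map α).toFinset.card ≤ (u 1 - f * u 0).natDegree := by
      refine card_le_degree_of_subset_roots fun x hx => ?_
      rw [Finset.mem_val, List.mem_toFinset, List.mem_map] at hx
      obtain ⟨i, hi, rfl⟩ := hx
      rw [hg, List.mem_filter] at hi
      rw [mem_roots hne, IsRoot, eval_sub, eval_mul]
      have h2 := hv i hi.1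
      rw [Fin.sum_univ_two, hρ i hi.1, of_decide_eq_true hi.2] at h2
      linear_combination -h2
    rw [List.toFinset_card_of_nodup hnd, List.length_map] at h1
    have h2 := natDegree_le_of_degree_le hdeg
    omega
  have hrow : ∀ r, (Pi.single r 1 : Fin 2 → F[X]) ᵥ* B = B r := fun r => by
    rw [Matrix.single_one_vecMul]; rfl
  have hrowdeg : ∀ r, s' r ≤ D + A → B r 1 = f * B r 0 := by
    intro r hr
    refine hsmall (B r) ?_ (hB.vanish r)
    have h := (hB.degree_iff (Pi.single r 1) t).2 fun j => ?_
    · rwa [hrow] at h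
    · by_cases hj : j = r
      · subst hj
        rw [Pi.single_eq_same, DegLe, degree_one, zero_add]
        exact Nat.cast_le.2 hr
      · rw [Pi.single_eq_of_ne hj]
        simp [DegLe]
  have hinj : ∀ u, u ᵥ* B = 0 → u = 0 := by
    intro u hu
    have h := (hB.degree_iff u ⊥).1 fun j => by rw [hu]; simp [DegLe]
    ext1 j
    have h1 := h j
    rw [DegLe, le_bot_iff, WithBot.add_eq_bot, degree_eq_bot] at h1
    exact h1.resolve_right (WithBot.natCast_ne_bot _)
  have hnotboth : ¬ (s' 0 ≤ D + A ∧ s' 1 ≤ D + A) := by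
    rintro ⟨h0, h1⟩
    have e0 := hrowdeg 0 h0
    have e1 := hrowdeg 1 h1
    have h2 := hinj ![B 1 0, -B 0 0] (by
      ext1 j
      fin_cases j
      · simp [Matrix.vecMul, dotProduct, Fin.sum_univ_two]; ring
      · simp [Matrix.vecMul, dotProduct, Fin.sum_univ_two, e0, e1]; ring)
    have h3 : B 0 0 = 0 := by
      have := congrFun h2 1
      simpa using this
    have h4 := hinj (Pi.single 0 1) (by
      rw [hrow]
      ext1 j
      fin_cases j
      · exact h3
      · exact e0.trans (by rw [h3, mul_zero]; rfl))
    have h5 := congrFun h4 0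
    simp at h5
  -- the error locator is a solution of small degree
  set Λ := nodePoly α (l.filter fun i => ρ 0 i ≠ f.eval (α i)) with hΛ
  have hΛ0 : Λ ≠ 0 := by
    rw [hΛ, nodePoly]
    refine List.prod_ne_zero fun h => ?_
    obtain ⟨i, -, hi⟩ := List.mem_map.1 h
    exact X_sub_C_ne_zero _ hi
  have hΛdeg : Λ.degree ≤ (A : ℕ) := by
    refine Order.le_of_lt_succ (lt_of_lt_of_le ((degree_lt_iff_coeff_zero _ (A + 1)).2
      fun i hi => coeff_nodePoly _ _ i (by omega)) ?_)
    exact le_of_eq rfl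
  obtain ⟨v, hv⟩ := hB.generate ![Λ, f * Λ] fun i hi => by
    rw [Fin.sum_univ_two]
    simp only [Matrix.cons_val_zero, Matrix.cons_val_one, eval_mul]
    rw [hρ i hi]
    by_cases h : ρ 0 i = f.eval (α i)
    · rw [h]; ring
    · rw [hΛ, eval_nodePoly_of_mem α (List.mem_filter.2 ⟨hi, decide_eq_true h⟩)]; ring
  have hvdeg := (hB.degree_iff v t).1 fun j => by
    rw [← hv]
    fin_cases j
    · simp only [DegLe, Fin.zero_eta, Matrix.cons_val_zero]
      rw [ht, add_comm D A, Nat.cast_add]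
      exact add_le_add_left hΛdeg _
    · change (f * Λ).degree + ((0 : ℕ) : WithBot ℕ) ≤ t
      rw [ht, Nat.cast_add, Nat.cast_zero, add_zero]
      exact (degree_mul_le _ _).trans (add_le_add hf hΛdeg)
  have hvzero : ∀ j, D + A < s' j → v j = 0 := by
    intro j hj
    by_contra h
    have h1 : (s' j : WithBot ℕ) ≤ t := by
      refine le_trans ?_ (hvdeg j)
      exact le_add_of_nonneg_left (zero_le_degree_iff.2 h)
    rw [ht, Nat.cast_le] at h1
    omega
  have hv0 : Λ = v 0 * B 0 0 + v 1 * B 1 0 := by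
    have := congrFun hv 0
    simpa [Matrix.vecMul, dotProduct, Fin.sum_univ_two] using this
  refine ⟨?_, fun r hr => ⟨hrowdeg r hr, ?_⟩⟩
  · by_contra! h
    refine hΛ0 ?_
    rw [hv0, hvzero 0 (h 0), hvzero 1 (h 1), zero_mul, zero_mul, add_zero]
  · rw [hv0]
    fin_cases r
    · rw [hvzero 1 (not_le.1 fun h => hnotboth ⟨hr, h⟩), zero_mul, add_zero]
      exact Dvd.intro_left _ rfl
    · rw [hvzero 0 (not_le.1 fun h => hnotboth ⟨h, hr⟩), zero_mul, zero_add]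
      exact Dvd.intro_left _ rfl

end Module

/-! ### Computation of reduced bases -/

section Programs

variable {ι Ω F : Type*} [Field F]

theorem Reach.div {Q : Set Ω → Set (Ω → F) → Prop} {P : Set Ω} {V : Set (Ω → F)} {τ : ℕ}
    {x y : Ω → F} (hx : Known F V x) (hy : Known F V y)
    (k : ∀ V', V ⊆ V' → Known F V' (x / y) → Reach Q P V' τ) : Reach Q P V (τ + 1) :=
  .op (x / y) hx hy (.inr rfl) (k _ (Set.subset_insert _ _) (.of_mem (Set.mem_insert _ _)))

theorem polyAt_C (ω : Ω) (x : Ω → F) : polyAt ω (C x) = C (x ω) := by simp [polyAt]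

theorem polyAt_X (ω : Ω) : polyAt ω (X : (Ω → F)[X]) = X := by simp [polyAt]

theorem polyAt_zero (ω : Ω) : polyAt ω (0 : (Ω → F)[X]) = 0 := by simp [polyAt]

theorem polyAt_one (ω : Ω) : polyAt ω (1 : (Ω → F)[X]) = 1 := by simp [polyAt]

theorem polyAt_sub (ω : Ω) (p q : (Ω → F)[X]) : polyAt ω (p - q) = polyAt ω p - polyAt ω q := by
  simp [polyAt]

theorem polyAt_neg (ω : Ω) (p : (Ω → F)[X]) : polyAt ω (-p) = -polyAt ω p := by simp [polyAt]

theorem polyAt_mul (ω : Ω) (p q : (Ω → F)[X]) : polyAt ω (p * q) = polyAt ω p * polyAt ω q := by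
  simp [polyAt]

theorem polyAt_add (ω : Ω) (p q : (Ω → F)[X]) : polyAt ω (p + q) = polyAt ω p + polyAt ω q := by
  simp [polyAt]

/-- A basis in the sense of `IntBasis`, with entries of length at most `n + 1`, has been computed.
The degrees `s'` of its rows are the same for all inputs of `P`, so that later decisions can depend
on them without further tests. -/
def BasisKnown (α : ι → Ω → F) (ρ : Ω → Fin 2 → ι → F) (l : List ι) (n : ℕ) (s : Fin 2 → ℕ)
    (P : Set Ω) (V : Set (Ω → F)) : Prop :=
  ∃ (s' : Fin 2 → ℕ) (B : Matrix (Fin 2) (Fin 2) (Ω → F)[X]),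
    (∀ r j, CoeffsIn (Known F V) (n + 1) (B r j)) ∧
    ∀ ω ∈ P, IntBasis (fun i => α i ω) (ρ ω) l s s' (B.map (polyAt ω))

theorem basisKnown_one {α : ι → Ω → F} {ρ : Ω → Fin 2 → ι → F} {l : List ι} {n : ℕ}
    {s : Fin 2 → ℕ} {P : Set Ω} {V : Set (Ω → F)} (h : ∀ ω ∈ P, ∀ i ∈ l, ∀ j, ρ ω j i = 0) :
    BasisKnown α ρ l n s P V := by
  refine ⟨s, 1, fun r j => ?_, fun ω hω => ?_⟩
  · rw [Matrix.one_apply]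
    split_ifs
    · exact CoeffsIn.one V (by omega)
    · exact ⟨fun _ _ => coeff_zero _, fun _ => by rw [coeff_zero]; exact Known.zero V⟩
  · rw [Matrix.map_one _ (polyAt_zero ω) (polyAt_one ω)]
    exact IntBasis.one s (h ω hω)

theorem CoeffsIn.zero (V : Set (Ω → F)) (n : ℕ) : CoeffsIn (Known F V) n (0 : (Ω → F)[X]) :=
  ⟨fun _ _ => coeff_zero _, fun _ => by rw [coeff_zero]; exact Known.zero V⟩

theorem Reach.basisFirst {α : ι → Ω → F} {ρ : Ω → Fin 2 → ι → F} {i : ι} {s : Fin 2 → ℕ}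
    {P : Set Ω} {V : Set (Ω → F)} {x : Fin 2 → Ω → F} (hα : Known F V (α i))
    (hx : ∀ j, Known F V (x j)) (hx' : ∀ ω ∈ P, ∀ j, x j ω = ρ ω j i)
    (h0 : ∀ ω ∈ P, ρ ω 0 i ≠ 0) (h1 : ∀ ω ∈ P, ρ ω 1 i = 0 ∨ s 0 ≤ s 1) :
    Reach (BasisKnown α ρ [i] 1 s) P V 4 := by
  refine Reach.div (τ := 3) (hx 1) (hx 0) fun V₁ hV₁ k₁ =>
    (Can.sub (Known.zero V₁) k₁).reach (σ := 2) fun V₂ hV₂ k₂ =>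
      (Can.X_sub_C ((hα.mono hV₁).mono hV₂)).reach (σ := 0) fun V₃ hV₃ k₃ => .done ?_
  refine ⟨![s 0 + 1, s 1], !![X - C (α i), 0; C (0 - x 1 / x 0), 1], ?_,
    fun ω hω => ?_⟩
  · rw [Fin.forall_fin_two, Fin.forall_fin_two, Fin.forall_fin_two]
    exact ⟨⟨k₃, CoeffsIn.zero _ _⟩,
      CoeffsIn.C_of_known (by norm_num) (k₂.mono hV₃), CoeffsIn.one _ (by norm_num)⟩
  · have := IntBasis.first (α := fun i => α i ω) s (h0 ω hω) (h1 ω hω)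
    convert this using 1
    ext1 r j
    fin_cases r <;> fin_cases j <;>
      simp [polyAt_sub, polyAt_neg, hx' ω hω, polyAt_C, polyAt_X, polyAt_zero, polyAt_one]

theorem Reach.basisSecond {α : ι → Ω → F} {ρ : Ω → Fin 2 → ι → F} {i : ι} {s : Fin 2 → ℕ}
    {P : Set Ω} {V : Set (Ω → F)} {x : Fin 2 → Ω → F} (hα : Known F V (α i))
    (hx : ∀ j, Known F V (x j)) (hx' : ∀ ω ∈ P, ∀ j, x j ω = ρ ω j i)
    (h0 : ∀ ω ∈ P, ρ ω 1 i ≠ 0) (h1 : ∀ ω ∈ P, ρ ω 0 i = 0 ∨ s 1 ≤ s 0) :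
    Reach (BasisKnown α ρ [i] 1 s) P V 4 := by
  refine Reach.div (τ := 3) (hx 0) (hx 1) fun V₁ hV₁ k₁ =>
    (Can.sub (Known.zero V₁) k₁).reach (σ := 2) fun V₂ hV₂ k₂ =>
      (Can.X_sub_C ((hα.mono hV₁).mono hV₂)).reach (σ := 0) fun V₃ hV₃ k₃ => .done ?_
  refine ⟨![s 0, s 1 + 1], !![1, C (0 - x 0 / x 1); 0, X - C (α i)], ?_,
    fun ω hω => ?_⟩
  · rw [Fin.forall_fin_two, Fin.forall_fin_two, Fin.forall_fin_two]
    exact ⟨⟨CoeffsIn.one _ (by norm_num), CoeffsIn.C_of_known (by norm_num) (k₂.mono hV₃)⟩,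
      CoeffsIn.zero _ _, k₃⟩
  · have := IntBasis.second (α := fun i => α i ω) s (h0 ω hω) (h1 ω hω)
    convert this using 1
    ext1 r j
    fin_cases r <;> fin_cases j <;>
      simp [polyAt_sub, polyAt_neg, hx' ω hω, polyAt_C, polyAt_X, polyAt_zero, polyAt_one]

theorem Can.forall_fin_two {R : Type*} [CommRing R] [Algebra F R] {Q : Fin 2 → Set R → Prop}
    (hQ : ∀ i V V', V ⊆ V' → Q i V → Q i V') {V : Set R} {τ : ℕ}
    (h : ∀ i, ∀ V', V ⊆ V' → Can F (Q i) V' τ) : Can F (fun V' => ∀ i, Q i V') V (2 * τ) := by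
  rw [two_mul]
  refine (h 0 V subset_rfl).bind fun V₁ hV₁ h₀ => (h 1 V₁ hV₁).mono le_rfl fun V₂ hV₂ h₁ => ?_
  rw [Fin.forall_fin_two]
  exact ⟨hQ _ _ _ hV₂ h₀, h₁⟩

theorem Can.matrixMul {R : Type*} [CommRing R] [Algebra F R] {n : ℕ} {V : Set R}
    {B A : Matrix (Fin 2) (Fin 2) R[X]}
    (hB : ∀ r j, CoeffsIn (Known F V) (2 ^ n + 1) (B r j))
    (hA : ∀ r j, CoeffsIn (Known F V) (2 ^ n + 1) (A r j)) :
    Can F (fun V' => ∀ r j, CoeffsIn (Known F V') (2 ^ (n + 1) + 1) ((B * A) r j)) V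
      (2 * (2 * (mulCost (n + 1) + (mulCost (n + 1) + (2 ^ (n + 1) + 1))))) := by
  have hle := two_pow_add_one_le n
  refine Can.forall_fin_two (fun r V V' hV h j => (h j).mono hV) fun r V₁ hV₁ =>
    Can.forall_fin_two (fun j V V' hV h => h.mono hV) fun j V₂ hV₂ => ?_
  have key : ∀ t, ∀ V₃, V₂ ⊆ V₃ →
      Can F (fun V' => CoeffsIn (Known F V') (2 ^ (n + 1) + 1) (B r t * A t j)) V₃
        (mulCost (n + 1)) := fun t V₃ hV₃ =>
    (Can.polyMul ((((hB r t).mono_length hle).mono hV₁).mono (hV₂.trans hV₃))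
      ((((hA t j).mono_length hle).mono hV₁).mono (hV₂.trans hV₃))).mono le_rfl fun V₄ _ h₄ =>
        ⟨fun i hi => coeff_mul_eq_zero_of_length (hB r t).1 (hA t j).1 i
          (by rw [pow_succ] at hi; omega), h₄.2⟩
  refine (key 0 V₂ subset_rfl).bind fun V₃ hV₃ h₃ => (key 1 V₃ hV₃).bind fun V₄ hV₄ h₄ => ?_
  rw [Matrix.mul_apply, Fin.sum_univ_two]
  exact Can.polyAdd (h₃.mono hV₄) h₄

theorem map_polyAt_mul (ω : Ω) (B A : Matrix (Fin 2) (Fin 2) (Ω → F)[X]) :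
    (B * A).map (polyAt ω) = B.map (polyAt ω) * A.map (polyAt ω) := by
  ext1 r j
  simp only [Matrix.map_apply, Matrix.mul_apply, Fin.sum_univ_two, polyAt_add, polyAt_mul]

/-- The basis for a single point with weights `x_0, x_1`: the tests of the weights for zero
determine which of the rows is multiplied by `X - α_i`. -/
theorem Reach.basisSingle {α : ι → Ω → F} {ρ : Ω → Fin 2 → ι → F} {i : ι} {s : Fin 2 → ℕ}
    {P : Set Ω} {V : Set (Ω → F)} {x : Fin 2 → Ω → F} (hα : Known F V (α i))
    (hx : ∀ j, Known F V (x j)) (hx' : ∀ ω ∈ P, ∀ j, x j ω = ρ ω j i) :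
    Reach (BasisKnown α ρ [i] 1 s) P V 6 := by
  -- if both weights are nonzero, the row of smaller degree is kept, so that the basis is reduced
  refine .test (hx 0) (.test (hx 1) (.done ?_) ?_) (.test (hx 1) ?_ ?_)
  · refine basisKnown_one fun ω hω i' hi' j => ?_
    obtain rfl : i' = i := by simpa using hi'
    rw [← hx' ω hω.1.1]
    fin_cases j
    exacts [hω.1.2, hω.2]
  · refine Reach.basisSecond hα hx (fun ω hω => hx' ω hω.1.1) (fun ω hω => ?_)
      (fun ω hω => .inl ?_)
    · rw [← hx' ω hω.1.1]; exact hω.2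
    · rw [← hx' ω hω.1.1]; exact hω.1.2
  · refine Reach.basisFirst hα hx (fun ω hω => hx' ω hω.1.1) (fun ω hω => ?_)
      (fun ω hω => .inl ?_)
    · rw [← hx' ω hω.1.1]; exact hω.1.2
    · rw [← hx' ω hω.1.1]; exact hω.2
  · rcases le_total (s 0) (s 1) with hs | hs
    · refine Reach.basisFirst hα hx (fun ω hω => hx' ω hω.1.1) (fun ω hω => ?_)
        (fun ω hω => .inr hs)
      rw [← hx' ω hω.1.1]; exact hω.1.2
    · refine Reach.basisSecond hα hx (fun ω hω => hx' ω hω.1.1) (fun ω hω => ?_)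
        (fun ω hω => .inr hs)
      rw [← hx' ω hω.1.1]; exact hω.2

/-- The moments of the weights that result from the rows of `B`. -/
theorem Can.hankelAdd {R : Type*} [CommRing R] [Algebra F R] {V : Set R} {n : ℕ}
    {B : Matrix (Fin 2) (Fin 2) R[X]} (hB : ∀ r j, CoeffsIn (Known F V) (2 ^ n + 1) (B r j))
    {μ : Fin 2 → ℕ → R} (hμ : ∀ j, ∀ k < 2 ^ (n + 1), Known F V (μ j k)) :
    Can F (fun V' => ∀ r, ∀ k < 2 ^ n, Known F V'
      (PolyComputing.hankel (2 ^ n + 1) (B r 0) (μ 0) k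
        + PolyComputing.hankel (2 ^ n + 1) (B r 1) (μ 1) k)) V
      (2 * (mulCost (n + 1) + (mulCost (n + 1) + 2 ^ n * 1))) := by
  refine Can.forall_fin_two (fun r V V' hV h k hk => (h k hk).mono hV) fun r V₁ hV₁ => ?_
  refine (Can.hankel ((hB r 0).mono hV₁) fun k hk => (hμ 0 k hk).mono hV₁).bind
    fun V₂ hV₂ h₂ => ?_
  refine (Can.hankel ((hB r 1).mono (hV₁.trans hV₂)) fun k hk =>
    (hμ 1 k hk).mono (hV₁.trans hV₂)).bind fun V₃ hV₃ h₃ => ?_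
  exact Can.forall_range (fun k V V' hV h => h.mono hV) _ fun k hk V₄ hV₄ =>
    Can.add (((h₂ k hk).mono hV₃).mono hV₄) ((h₃ k hk).mono hV₄)

/-- A reduced basis of the interpolation module, by divide and conquer. The recursion passes the
weights on in the form of their moments: on the first half of the points they are multiplied by the
polynomial that vanishes on the second half, and on the second half they are combined by the basis
for the first half. -/
theorem Reach.intBasis {α : ι → Ω → F} (n : ℕ) {l : List ι} (hl : l.length ≤ 2 ^ n) {P : Set Ω}
    {V : Set (Ω → F)} (hα : DistinctOn α l P) (htree : TreeKnown F α n l V)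
    (hknown : ∀ i ∈ l, Known F V (α i)) {μ : Fin 2 → ℕ → Ω → F}
    (hμ : ∀ j, ∀ k < 2 ^ n, Known F V (μ j k)) {ρ : Ω → Fin 2 → ι → F}
    (hρ : ∀ ω ∈ P, ∀ j, ∀ k < 2 ^ n, μ j k ω = moment (fun i => α i ω) (ρ ω j) l k)
    (s : Fin 2 → ℕ) :
    Reach (BasisKnown α ρ l (2 ^ n) s) P V ((n + 1) * (15 * mulCost n)) := by
  induction n generalizing l P V μ ρ s with
  | zero =>
    rcases l with _ | ⟨i, l⟩
    · exact .done (basisKnown_one fun ω _ i hi => absurd hi List.not_mem_nil)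
    · obtain rfl : l = [] := by
        rw [List.length_cons, pow_zero] at hl
        exact List.eq_nil_of_length_eq_zero (by omega)
      refine (Reach.basisSingle (x := fun j => μ j 0) (hknown i (by simp))
        (fun j => hμ j 0 (by norm_num)) fun ω hω j => ?_).le ?_
      · rw [hρ ω hω j 0 (by norm_num)]
        simp [moment]
      · have := two_pow_le_mulCost 0
        omega
  | succ n ih =>
    have hl₁ := length_take_le_two_pow (l := l) (n := n)
    have hl₂ := length_drop_le_two_pow hl
    have hcost := add_mul_mulCost_le 15 n
    have hpow := two_pow_le_mulCost (n + 1)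
    have hpow' : 2 ^ (n + 1) = 2 * 2 ^ n := by rw [pow_succ, mul_comm]
    have hpos : 0 < 2 ^ n := pow_pos (by norm_num) n
    refine Reach.le (τ := 2 * mulCost (n + 1) + ((n + 1) * (15 * mulCost n) +
      (2 * (mulCost (n + 1) + (mulCost (n + 1) + 2 ^ n * 1)) + ((n + 1) * (15 * mulCost n) +
      2 * (2 * (mulCost (n + 1) + (mulCost (n + 1) + (2 ^ (n + 1) + 1)))))))) ?_ (by omega)
    refine (Can.forall_fin_two
      (Q := fun j V' => ∀ k < 2 ^ n,
        Known F V' (hankel (2 ^ n + 1) (nodePoly α (l.drop (2 ^ n))) (μ j) k))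
      (fun j V V' hV h k hk => (h k hk).mono hV) fun j V₁ hV₁ =>
        Can.hankel ((coeffsIn_nodePoly_drop hl htree).mono hV₁)
          fun k hk => (hμ j k hk).mono hV₁).reach fun V₁ hV₁ h₁ => ?_
    refine (ih hl₁ (hα.take subset_rfl _) (htree.2.2.1.mono hV₁)
      (fun i hi => (hknown i (List.mem_of_mem_take hi)).mono hV₁) h₁
      (ρ := fun ω j i => ρ ω j i * (nodePoly (fun i => α i ω) (l.drop (2 ^ n))).eval (α i ω))
      (fun ω hω j k hk => hankel_nodePoly_drop hl (hρ ω hω j) k hk) s).bind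
        fun P₂ V₂ hP₂ hV₂ ⟨s', B₁, hB₁, hbasis₁⟩ => ?_
    have hc : ∀ ω ∈ P₂, ∀ i ∈ l.take (2 ^ n),
        (nodePoly (fun i => α i ω) (l.drop (2 ^ n))).eval (α i ω) ≠ 0 := fun ω hω i hi =>
      eval_nodePoly_ne_zero fun i' hi' => hα.ne (2 ^ n) (hP₂ hω) hi hi'
    refine (Can.hankelAdd hB₁ fun j k hk => ((hμ j k hk).mono hV₁).mono hV₂).reach
      fun V₃ hV₃ h₃ => ?_
    refine (ih hl₂ (hα.drop hP₂ _) (((htree.2.2.2.mono hV₁).mono hV₂).mono hV₃)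
      (fun i hi => (((hknown i (List.mem_of_mem_drop hi)).mono hV₁).mono hV₂).mono hV₃) h₃
      (ρ := fun ω r i => ∑ j, (polyAt ω (B₁ r j)).eval (α i ω) * ρ ω j i)
      (fun ω hω r k hk => ?_) s').bind fun P₄ V₄ hP₄ hV₄ ⟨s'', B₂, hB₂, hbasis₂⟩ => ?_
    · have e : moment (fun i => α i ω) (fun i => ∑ j, (polyAt ω (B₁ r j)).eval (α i ω) * ρ ω j i)
            l k = moment (fun i => α i ω) (fun i => ∑ j, (polyAt ω (B₁ r j)).eval (α i ω) * ρ ω j i)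
            (l.drop (2 ^ n)) k := by
        conv_lhs => rw [← List.take_append_drop (2 ^ n) l]
        rw [moment_append, moment_eq_zero (l := l.take (2 ^ n)), zero_add]
        intro i hi
        have hv := (hbasis₁ ω hω).vanish r i hi
        have hf : ∑ j, ((B₁.map (polyAt ω)) r j).eval (α i ω) *
              (ρ ω j i * (nodePoly (fun i => α i ω) (l.drop (2 ^ n))).eval (α i ω))
            = (∑ j, (polyAt ω (B₁ r j)).eval (α i ω) * ρ ω j i) *
              (nodePoly (fun i => α i ω) (l.drop (2 ^ n))).eval (α i ω) := by
          rw [Finset.sum_mul]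
          exact Finset.sum_congr rfl fun j _ => by rw [Matrix.map_apply]; ring
        rw [hf] at hv
        exact (mul_eq_zero.1 hv).resolve_right (hc ω hω i hi)
      rw [← e, Pi.add_apply, hankel_apply_moment (hB₁ r 0).1 (hρ ω (hP₂ hω) 0) k hk,
        hankel_apply_moment (hB₁ r 1).1 (hρ ω (hP₂ hω) 1) k hk]
      simp only [Fin.sum_univ_two]
      unfold moment
      rw [← List.sum_map_add]
      congr 1
      exact List.map_congr_left fun i _ => by ring
    · refine ((Can.matrixMul hB₂ fun r j => ((hB₁ r j).mono hV₃).mono hV₄).reach (σ := 0)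
        fun V₅ hV₅ h₅ => .done ⟨s'', B₂ * B₁, h₅, fun ω hω => ?_⟩)
      rw [map_polyAt_mul, ← List.take_append_drop (2 ^ n) l]
      exact IntBasis.mul (hc ω (hP₄ hω)) (hbasis₁ ω (hP₄ hω)) (hbasis₂ ω hω)

end Programs

/-! ### Decoding one polynomial -/

section Decoding

variable {ι κ Ω F : Type*} [Field F]

theorem moment_apply (ω : Ω) (α y : ι → Ω → F) (l : List ι) (k : ℕ) :
    moment α y l k ω = moment (fun i => α i ω) (fun i => y i ω) l k := by
  unfold moment
  refine (map_list_sum (Pi.evalRingHom (fun _ => F) ω) _).trans ?_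
  rw [List.map_map]
  rfl

/-- Decoding of a polynomial `f` of degree at most `D`, given by values at more than `D + 2 A`
points `α_i` of which at most `A` are wrong, at the points `β_j`: a row `(E, N)` of the reduced
basis satisfies `N = f E`, so that `f(β_j) = N(β_j) / E(β_j)`. -/
theorem Reach.decode [DecidableEq F] {n D A : ℕ} {l : List ι} {lβ : List κ} {P : Set Ω}
    {V : Set (Ω → F)} {α y : ι → Ω → F} {β : κ → Ω → F} {f : Ω → F[X]}
    (hl : l.length ≤ 2 ^ n) (hlβ : lβ.length ≤ 2 ^ n) (hα : DistinctOn α l P)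
    (hβ : DistinctOn β lβ P) (hβα : ∀ ω ∈ P, ∀ j ∈ lβ, ∀ i ∈ l, β j ω ≠ α i ω)
    (kα : ∀ i ∈ l, Known F V (α i)) (ky : ∀ i ∈ l, Known F V (y i))
    (kβ : ∀ j ∈ lβ, Known F V (β j)) (hf : ∀ ω ∈ P, (f ω).degree ≤ D)
    (hlen : D + 2 * A < l.length)
    (herr : ∀ ω ∈ P, (l.filter fun i => y i ω ≠ (f ω).eval (α i ω)).length ≤ A) :
    Reach (fun P' V' => ∀ j ∈ lβ, ∃ v ∈ V', ∀ ω ∈ P', v ω = (f ω).eval (β j ω)) P V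
      ((n + 2) * (44 * mulCost (n + 1))) := by
  have hle : (n + 1) * mulCost n ≤ (n + 2) * mulCost (n + 1) :=
    Nat.mul_le_mul (by omega) (mulCost_mono (Nat.le_succ n))
  have hle' : mulCost (n + 1) ≤ (n + 2) * mulCost (n + 1) := Nat.le_mul_of_pos_left _ (by omega)
  refine Reach.le (τ := (n + 1) * (1 * mulCost n) + ((n + 1) * (1 * mulCost n) +
    (2 * ((n + 1) * (7 * mulCost n)) + ((n + 1) * (15 * mulCost n) +
    ((n + 1 + 1) * (7 * mulCost (n + 1)) + (mulCost (n + 1) + (mulCost (n + 1) +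
    (n + 1) * (4 * mulCost n)))))))) ?_ (by nlinarith)
  refine (Can.treeKnown hl kα).reach fun V₁ hV₁ ⟨_, treeα⟩ => ?_
  refine (Can.treeKnown hlβ fun j hj => (kβ j hj).mono hV₁).reach fun V₂ hV₂ ⟨_, treeβ⟩ => ?_
  have h02 := hV₁.trans hV₂
  -- the weights `y_i` and `-1` of the decoding equation `E(α_i) y_i = N(α_i)`
  set yy : Fin 2 → ι → Ω → F := ![y, fun _ => -1] with hyy
  refine (Can.forall_fin_two (Q := fun j V' => ∀ k < 2 ^ n, Known F V' (moment α (yy j) l k))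
    (fun j V V' hV h k hk => (h k hk).mono hV) fun j V₃ hV₃ =>
      Can.moments hl le_rfl (fun i hi => (kα i hi).mono (h02.trans hV₃)) fun i hi => ?_).reach
        fun V₃ hV₃ h₃ => ?_
  · fin_cases j
    · exact (ky i hi).mono (h02.trans hV₃)
    · have := Known.const (R := Ω → F) V₃ (-1 : F)
      rwa [map_neg, map_one] at this
  have h03 := h02.trans hV₃
  refine (Reach.intBasis n hl hα ((treeα.mono hV₂).mono hV₃) (fun i hi => (kα i hi).mono h03) h₃
    (ρ := fun ω j i => yy j i ω) (fun ω _ j k _ => moment_apply ω α (yy j) l k) ![D, 0]).bind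
      fun P₄ V₄ hP₄ hV₄ ⟨s', B, hB, hbasis⟩ => ?_
  have hdec := fun ω (hω : ω ∈ P₄) => (hbasis ω hω).decode (hα ω (hP₄ hω)) (hf ω (hP₄ hω))
    (fun i _ => rfl) hlen (herr ω (hP₄ hω))
  obtain ⟨r, hr⟩ : ∃ r, ∀ ω ∈ P₄, s' r ≤ D + A := by
    rcases P₄.eq_empty_or_nonempty with rfl | ⟨ω, hω⟩
    · exact ⟨0, fun ω hω => absurd hω (Set.notMem_empty ω)⟩
    · obtain ⟨r, hr⟩ := (hdec ω hω).1
      exact ⟨r, fun _ _ => hr⟩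
  have h04 := h03.trans hV₄
  refine (Can.moments (y := fun _ => 1) hlβ (Nat.le_succ n) (fun j hj => (kβ j hj).mono h04)
    fun j _ => Known.one _).reach fun V₅ hV₅ h₅ => ?_
  refine (Can.hankel ((hB r 0).mono hV₅) h₅).reach fun V₆ hV₆ h₆ => ?_
  refine (Can.hankel ((hB r 1).mono (hV₅.trans hV₆)) fun k hk => (h₅ k hk).mono hV₆).reach
    fun V₇ hV₇ h₇ => ?_
  have hm : ∀ j, ∀ ω ∈ P₄, ∀ k < 2 ^ n, hankel (2 ^ n + 1) (B r j) (moment β (fun _ => 1) lβ) k ω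
      = moment (fun i => β i ω) (fun i => (polyAt ω (B r j)).eval (β i ω)) lβ k := by
    intro j ω _ k hk
    rw [hankel_apply_moment (ρ := fun _ => 1) (hB r j).1
      (fun k _ => moment_apply ω β (fun _ => 1) lβ k) k hk]
    simp only [one_mul]
  refine (Reach.quotients n hlβ (fun ω hω => hβ ω (hP₄ hω))
    (treeβ.mono (hV₃.trans (hV₄.trans (hV₅.trans (hV₆.trans hV₇)))))
    (fun k hk => (h₆ k hk).mono hV₇) h₇ (hm 0) (hm 1)).mono le_rfl
      fun P₈ V₈ hP₈ _ hq j hj => ?_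
  obtain ⟨v, hv, hvω⟩ := hq j hj
  refine ⟨v, hv, fun ω hω => ?_⟩
  have hω₄ := hP₈ hω
  obtain ⟨hN, hE⟩ := (hdec ω hω₄).2 r (hr ω hω₄)
  rw [Matrix.map_apply, Matrix.map_apply] at hN
  rw [Matrix.map_apply] at hE
  have hE0 : (polyAt ω (B r 0)).eval (β j ω) ≠ 0 := by
    intro h0
    obtain ⟨q, hq⟩ := hE
    have h1 := congrArg (eval (β j ω)) hq
    rw [eval_mul, h0, zero_mul] at h1
    exact eval_nodePoly_ne_zero
      (fun i hi => hβα ω (hP₄ hω₄) j hj i (List.mem_filter.1 hi).1) h1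
  rw [hvω ω hω, hN, eval_mul, mul_div_cancel_right₀ _ hE0]

end Decoding

/-! ### The response polynomials -/

section Response

variable {F : Type u} [Field F] {p : Params}

/-- An entry of the joint encoding polynomial `∑_i f^(i)` of the sources. -/
def sourcePoly (s : Points F p) (w : SourceData F p) (P : Fin p.S → Fin p.X → Block F p)
    (e : Fin p.a × Fin p.c) : F[X] :=
  ∑ i : Fin p.S,
    ((∑ t : Fin p.X, C (P i t e.1 e.2) * Lagrange.basis Finset.univ s.β (Fin.natAdd p.K t)) +
      ∑ j : Fin p.K with j.val / (p.K / p.S) = i.val,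
        C (dataBlock w j e.1 e.2) * Lagrange.basis Finset.univ s.β (Fin.castAdd p.X j))

/-- An entry of the encoding polynomial `g` of the user. -/
def userPoly (s : Points F p) (v : UserData F p) (Q : Fin p.X → Block F p)
    (e : Fin p.a × Fin p.c) : F[X] :=
  (∑ j : Fin p.K, C (v j e.1 e.2) * Lagrange.basis Finset.univ s.β (Fin.castAdd p.X j)) +
    ∑ t : Fin p.X, C (Q t e.1 e.2) * Lagrange.basis Finset.univ s.β (Fin.natAdd p.K t)

/-- An entry of the polynomial `h(∑_i f^(i), g)`, whose values are the correct responses. -/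
def responsePoly (s : Points F p) (h : PolyMap F p) (w : SourceData F p) (v : UserData F p)
    (m : Masks F p) (e : Fin p.a × Fin p.c) : F[X] :=
  MvPolynomial.aeval (Sum.elim (sourcePoly s w m.1) (userPoly s v m.2)) (h e.1 e.2)

theorem eval_sourcePoly (s : Points F p) (w : SourceData F p) (P : Fin p.S → Fin p.X → Block F p)
    (e : Fin p.a × Fin p.c) (z : F) :
    (sourcePoly s w P e).eval z = (∑ i, sourceEncode s w P i z) e.1 e.2 := by
  simp only [sourcePoly, eval_finsetSum, eval_add, eval_mul, eval_C, sourceEncode, Matrix.sum_apply,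
    Matrix.add_apply, Matrix.smul_apply, smul_eq_mul, lagrange, mul_comm]

theorem eval_userPoly (s : Points F p) (v : UserData F p) (Q : Fin p.X → Block F p)
    (e : Fin p.a × Fin p.c) (z : F) :
    (userPoly s v Q e).eval z = userEncode s v Q z e.1 e.2 := by
  simp only [userPoly, eval_finsetSum, eval_add, eval_mul, eval_C, userEncode, Matrix.sum_apply,
    Matrix.add_apply, Matrix.smul_apply, smul_eq_mul, lagrange, mul_comm]

theorem eval_responsePoly (s : Points F p) (h : PolyMap F p) (w : SourceData F p)
    (v : UserData F p) (m : Masks F p) (e : Fin p.a × Fin p.c) (z : F) :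
    (responsePoly s h w v m e).eval z
      = h.apply (∑ i, sourceEncode s w m.1 i z) (userEncode s v m.2 z) e.1 e.2 := by
  rw [responsePoly, ← coe_evalRingHom, MvPolynomial.aeval_def, MvPolynomial.hom_eval₂,
    PolyMap.apply, Matrix.of_apply, MvPolynomial.eval]
  congr 1
  · ext x; simp
  · ext i
    rcases i with i | i
    · exact eval_sourcePoly s w m.1 i z
    · exact eval_userPoly s v m.2 i z

theorem natDegree_C_mul_basis_le (s : Points F p) (x : F) (j : Fin (p.K + p.X)) :
    (C x * Lagrange.basis Finset.univ s.β j).natDegree ≤ p.K + p.X - 1 := by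
  refine (natDegree_C_mul_le _ _).trans (le_of_eq ?_)
  rw [Lagrange.natDegree_basis s.β_injective.injOn (Finset.mem_univ _), Finset.card_fin]

theorem natDegree_responsePoly_le (s : Points F p) (h : PolyMap F p) (w : SourceData F p)
    (v : UserData F p) (m : Masks F p) (e : Fin p.a × Fin p.c) :
    (responsePoly s h w v m e).natDegree ≤ (p.K + p.X - 1) * h.deg := by
  rw [mul_comm]
  refine MvPolynomial.aeval_natDegree_le _ ?_ _ fun i => ?_
  · exact Finset.le_sup (f := fun e : Fin p.a × Fin p.c => (h e.1 e.2).totalDegree)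
      (Finset.mem_univ e)
  · rcases i with i | i
    · rw [Sum.elim_inl, sourcePoly]
      refine natDegree_sum_le_of_forall_le _ _ fun i _ =>
        Polynomial.natDegree_add_le_of_degree_le (R := F) ?_ ?_ <;>
        exact natDegree_sum_le_of_forall_le _ _ fun j _ => natDegree_C_mul_basis_le _ _ _
    · rw [Sum.elim_inr, userPoly]
      refine Polynomial.natDegree_add_le_of_degree_le (R := F) ?_ ?_ <;>
        exact natDegree_sum_le_of_forall_le _ _ fun j _ => natDegree_C_mul_basis_le _ _ _

theorem lagrange_self (s : Points F p) (j : Fin (p.K + p.X)) : lagrange s j (s.β j) = 1 :=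
  Lagrange.eval_basis_self s.β_injective.injOn (Finset.mem_univ j)

theorem lagrange_of_ne (s : Points F p) {i j : Fin (p.K + p.X)} (h : i ≠ j) :
    lagrange s i (s.β j) = 0 :=
  Lagrange.eval_basis_of_ne h (Finset.mem_univ j)

theorem castAdd_ne_natAdd {n m : ℕ} (i : Fin n) (j : Fin m) : Fin.natAdd n j ≠ Fin.castAdd m i := by
  intro h
  have := congrArg Fin.val h
  simp only [Fin.val_natAdd, Fin.val_castAdd] at this
  omega

theorem userEncode_β (s : Points F p) (v : UserData F p) (Q : Fin p.X → Block F p) (j : Fin p.K) :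
    userEncode s v Q (s.β (Fin.castAdd p.X j)) = v j := by
  rw [userEncode, Finset.sum_eq_single j, lagrange_self, one_smul, Finset.sum_eq_zero, add_zero]
  · exact fun t _ => by rw [lagrange_of_ne s (castAdd_ne_natAdd j t), zero_smul]
  · exact fun i _ hi => by
      rw [lagrange_of_ne s fun h => hi (Fin.castAdd_injective _ _ h), zero_smul]
  · exact fun h => absurd (Finset.mem_univ j) h

theorem sum_sourceEncode_β (s : Points F p) (w : SourceData F p)
    (P : Fin p.S → Fin p.X → Block F p) (j : Fin p.K) :
    ∑ i, sourceEncode s w P i (s.β (Fin.castAdd p.X j)) = dataBlock w j := by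
  have hdiv : j.val / (p.K / p.S) < p.S := by
    rw [Nat.div_lt_iff_lt_mul (Nat.div_pos (Nat.le_of_dvd p.K_pos p.S_dvd_K) p.S_pos),
      Nat.mul_div_cancel' p.S_dvd_K]
    exact j.2
  have h : ∀ i, sourceEncode s w P i (s.β (Fin.castAdd p.X j))
      = if j.val / (p.K / p.S) = i.val then dataBlock w j else 0 := by
    intro i
    rw [sourceEncode, Finset.sum_eq_zero, zero_add, Finset.sum_filter, Finset.sum_eq_single j,
      lagrange_self, one_smul]
    · intro j' _ hj'
      rw [lagrange_of_ne s fun h => hj' (Fin.castAdd_injective _ _ h), zero_smul, ite_self]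
    · exact fun h => absurd (Finset.mem_univ j) h
    · exact fun t _ => by rw [lagrange_of_ne s (castAdd_ne_natAdd j t), zero_smul]
  simp only [h]
  rw [Finset.sum_eq_single ⟨_, hdiv⟩]
  · exact if_pos rfl
  · intro i _ hi
    rw [if_neg fun h => hi (Fin.ext h.symm)]
  · exact fun h => absurd (Finset.mem_univ _) h

/-- The function `h` of the data is found at the points `β_j`. -/
theorem eval_responsePoly_β (s : Points F p) (h : PolyMap F p) (w : SourceData F p)
    (v : UserData F p) (m : Masks F p) (e : Fin p.a × Fin p.c) (j : Fin p.K) :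
    (responsePoly s h w v m e).eval (s.β (Fin.castAdd p.X j))
      = h.apply (dataBlock w j) (v j) e.1 e.2 := by
  rw [eval_responsePoly, sum_sourceEncode_β, userEncode_β]

theorem eval_responsePoly_α (s : Points F p) (h : PolyMap F p) (w : SourceData F p)
    (v : UserData F p) (m : Masks F p) (e : Fin p.a × Fin p.c) (k : Fin p.N) :
    (responsePoly s h w v m e).eval (s.α k) = response s h w v m k e.1 e.2 :=
  eval_responsePoly s h w v m e _

end Response

/-! ### The decoder -/

section Decoder

variable {F : Type u} [Field F] {p : Params} {d : ℕ}

/-- What the decoder may meet: points, a polynomial map, data and masks, responding workers, and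
the blocks received from them. -/
structure Scenario (F : Type u) [Field F] (p : Params) (d : ℕ) where
  s : Points F p
  h : PolyMap F p
  w : SourceData F p
  v : UserData F p
  m : Masks F p
  κ : Fin (threshold p d) ↪ Fin p.N
  Z : Fin (threshold p d) → Block F p

/-- The degree of `h` is `d`, and at most `A` of the received blocks are wrong. -/
def Scenario.Admissible (ω : Scenario F p d) : Prop :=
  ω.h.deg = d ∧ {t | ω.Z t ≠ response ω.s ω.h ω.w ω.v ω.m (ω.κ t)}.ncard ≤ p.A

/-- What the decoder is given. -/
def Scenario.input (ω : Scenario F p d) : DecoderInput p d → F := decoderInput ω.s ω.κ ω.Z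

/-- What the decoder is to find. -/
def Scenario.target (ω : Scenario F p d) : DecoderOutput p → F := fun o =>
  ω.h.apply (dataBlock ω.w o.1) (ω.v o.1) o.2.1 o.2.2

theorem length_filter_finRange {n : ℕ} (q : Fin n → Prop) [DecidablePred q] :
    ((List.finRange n).filter fun i => q i).length = {i | q i}.ncard := by
  rw [← List.toFinset_card_of_nodup ((List.nodup_finRange n).filter _), ← Set.ncard_coe_finset]
  congr 1
  ext i
  simp

/-- The decoder treats each entry of the blocks separately. -/
theorem Reach.decodeEntry {n : ℕ} (hn : threshold p d ≤ 2 ^ n) (e : Fin p.a × Fin p.c)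
    {V : Set (Scenario F p d → F)} (hV : Set.range (fun i ω => Scenario.input ω i) ⊆ V)
    {P : Set (Scenario F p d)} (hP : ∀ ω ∈ P, ω.Admissible) :
    Reach (fun P' V' => ∀ j, ∃ v ∈ V', ∀ ω ∈ P', v ω = ω.target (j, e)) P V
      ((n + 2) * (44 * mulCost (n + 1))) := by
  classical
  have hin : ∀ i, Known F V fun ω : Scenario F p d => ω.input i := fun i =>
    .of_mem (hV ⟨i, rfl⟩)
  have hdeg : ∀ ω ∈ P, (responsePoly ω.s ω.h ω.w ω.v ω.m e).natDegree ≤ (p.K + p.X - 1) * d := by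
    intro ω hω
    have := natDegree_responsePoly_le ω.s ω.h ω.w ω.v ω.m e
    rwa [(hP ω hω).1] at this
  -- for `d = 0` a constant polynomial is evaluated at a single point: there may be fewer than `K`
  -- workers, and the list of points must not be longer than `2^n`
  obtain ⟨lβ, hlen, hnodup, hlβ⟩ : ∃ lβ : List (Fin p.K), lβ.length ≤ 2 ^ n ∧ lβ.Nodup ∧
      ∀ j, ∃ j' ∈ lβ, ∀ ω ∈ P, (responsePoly ω.s ω.h ω.w ω.v ω.m e).eval
        (ω.s.β (Fin.castAdd p.X j')) = ω.target (j, e) := by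
    rcases Nat.eq_zero_or_pos d with rfl | hd
    · refine ⟨[⟨0, p.K_pos⟩], by simpa using Nat.one_le_two_pow, List.nodup_singleton _, fun j =>
        ⟨_, List.mem_singleton_self _, fun ω hω => ?_⟩⟩
      have h0 := hdeg ω hω
      rw [mul_zero, Nat.le_zero] at h0
      rw [Scenario.target, ← eval_responsePoly_β ω.s ω.h ω.w ω.v ω.m e j,
        eq_C_of_natDegree_eq_zero h0, eval_C, eval_C]
    · refine ⟨List.finRange p.K, ?_, List.nodup_finRange _, fun j =>
        ⟨j, List.mem_finRange j, fun ω _ => eval_responsePoly_β ω.s ω.h ω.w ω.v ω.m e j⟩⟩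
      rw [List.length_finRange]
      refine le_trans ?_ hn
      have h1 : p.K + p.X - 1 ≤ (p.K + p.X - 1) * d := Nat.le_mul_of_pos_right _ hd
      unfold threshold mHat
      omega
  refine (Reach.decode (n := n) (D := (p.K + p.X - 1) * d) (A := p.A)
    (l := List.finRange (threshold p d)) (lβ := lβ)
    (α := fun t ω => ω.input (.inl t)) (y := fun t ω => ω.input (.inr (.inr (t, e))))
    (β := fun j ω => ω.input (.inr (.inl j)))
    (f := fun ω => responsePoly ω.s ω.h ω.w ω.v ω.m e)
    (by rwa [List.length_finRange]) hlen ?_ ?_ ?_ (fun _ _ => hin _) (fun _ _ => hin _)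
    (fun _ _ => hin _) ?_ ?_ ?_).mono le_rfl fun P' V' hP' _ h j => ?_
  · intro ω _
    exact (List.nodup_finRange _).imp fun hne h => hne (ω.κ.injective (ω.s.α_injective h))
  · intro ω _
    exact hnodup.imp fun hne h => hne (Fin.castAdd_injective _ _ (ω.s.β_injective h))
  · intro ω _ j _ t _ h
    exact ω.s.disjoint (ω.κ t) j h.symm
  · intro ω hω
    exact degree_le_of_natDegree_le (hdeg ω hω)
  · rw [List.length_finRange]
    exact Nat.lt_succ_self _
  · intro ω hω
    rw [length_filter_finRange]
    refine (Set.ncard_le_ncard ?_ (Set.toFinite _)).trans (hP ω hω).2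
    intro t (ht : ω.Z t e.1 e.2 ≠ _) hZ
    refine ht ?_
    change ω.Z t e.1 e.2 = eval (ω.s.α (ω.κ t)) _
    rw [eval_responsePoly_α, hZ]
  · obtain ⟨j', hj', htarget⟩ := hlβ j
    obtain ⟨v, hv, hvω⟩ := h j' hj'
    exact ⟨v, hv, fun ω hω => (hvω ω hω).trans (htarget ω (hP' hω))⟩

theorem exists_decodesWithin (F : Type u) [Field F] (p : Params) (d : ℕ) {n : ℕ}
    (hn : threshold p d ≤ 2 ^ n) :
    ∃ T : CompTree F (DecoderInput p d) (DecoderOutput p),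
      DecodesWithin T ((3 * (p.a * p.c * ((n + 2) * (44 * mulCost (n + 1)))) : ℕ) : ℝ) := by
  obtain ⟨T, hT⟩ := Reach.exists_compTree (P := {ω : Scenario F p d | ω.Admissible})
    (x := Scenario.input) (target := Scenario.target)
    ((Reach.forall_fintype (Q := fun e P' V' => ∀ j, ∃ v ∈ V', ∀ ω ∈ P', v ω = ω.target (j, e))
      (fun e P P' V V' hP hV h j => (h j).imp fun v hv =>
        ⟨hV hv.1, fun ω hω => hv.2 ω (hP hω)⟩)
      fun e P' V' hP hV => Reach.decodeEntry hn e hV hP).mono le_rfl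
        fun P' V' _ _ h o => h o.2 o.1)
  refine ⟨T, fun s h hd w v m κ Z hZ => ?_⟩
  obtain ⟨h1, h2⟩ := hT ⟨s, h, w, v, m, κ, Z⟩ ⟨hd, hZ⟩
  refine ⟨fun j r t => congrFun h1 (j, r, t), Nat.cast_le.2 ?_⟩
  rw [Fintype.card_prod, Fintype.card_fin, Fintype.card_fin] at h2
  exact h2

end Decoder

/-! ### The number of operations -/

section Complexity

open Real

/-- With `m = M̂`, the lengths `2^n` of the polynomials are of the order of `m`, and their binary
logarithms of the order of `log m`. As `log log 3 > 0`, the lower order terms in the bound for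
`log n` are absorbed by `log (log m)`. -/
theorem decoding_cost_le {m n : ℕ} (hm : 3 ≤ m) (hn : 2 ^ n ≤ 2 * m) :
    (((n + 2) * (44 * mulCost (n + 1)) : ℕ) : ℝ)
      ≤ 10 ^ 11 * (m * log m ^ 2 * log (log m)) := by
  have hm' : (3 : ℝ) ≤ m := by exact_mod_cast hm
  have hlog3 : (1.09 : ℝ) ≤ log 3 := by linarith [log_three_gt_d9]
  have hL : (1.09 : ℝ) ≤ log m := hlog3.trans (log_le_log (by norm_num) hm')
  have hLL : (1 / 13 : ℝ) ≤ log (log m) := by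
    have h1 := one_sub_inv_le_log_of_pos (show 0 < log (m : ℝ) by linarith)
    have h2 : (log (m : ℝ))⁻¹ ≤ (1.09 : ℝ)⁻¹ := inv_anti₀ (by norm_num) hL
    norm_num at h2 ⊢
    linarith
  have hlog2 := log_two_gt_d9
  have hN : ((n + 2 : ℕ) : ℝ) ≤ 5 * log m := by
    have h1 : (n : ℝ) * log 2 ≤ log 2 + log m := by
      rw [← log_pow, ← log_mul (by norm_num) (by positivity)]
      exact log_le_log (by positivity) (by exact_mod_cast hn)
    push_cast
    nlinarith
  have hlg : ((Nat.log 2 (n + 2) + 1 : ℕ) : ℝ) ≤ 60 * log (log m) := by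
    have h1 : ((Nat.log 2 (n + 2) : ℕ) : ℝ) * log 2 ≤ log 5 + log (log m) := by
      rw [← log_pow, ← log_mul (by norm_num) (by linarith)]
      refine log_le_log (by positivity) (le_trans ?_ hN)
      exact_mod_cast Nat.pow_log_le_self 2 (by omega)
    have h2 : log 5 ≤ 2 := by
      rw [log_le_iff_le_exp (by norm_num)]
      have h3 := add_one_le_exp (1 : ℝ)
      have h4 := exp_one_gt_d9
      have h5 : exp 2 = exp 1 * exp 1 := by rw [← exp_add]; norm_num
      rw [h5]
      nlinarith
    push_cast
    nlinarith
  have hpow : ((2 ^ (n + 1) : ℕ) : ℝ) ≤ 4 * m := by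
    have : 2 ^ (n + 1) ≤ 4 * m := by rw [pow_succ]; omega
    exact_mod_cast this
  have hfac : ((lgFactor (n + 1) : ℕ) : ℝ) ≤ 5 * log m * (60 * log (log m)) := by
    rw [lgFactor, Nat.cast_mul]
    exact mul_le_mul hN hlg (Nat.cast_nonneg _) (by linarith)
  rw [mulCost]
  calc (((n + 2) * (44 * (288000 * (2 ^ (n + 1) * lgFactor (n + 1)))) : ℕ) : ℝ)
      = 44 * 288000 * (((n + 2 : ℕ) : ℝ) * (((2 ^ (n + 1) : ℕ) : ℝ) *
          ((lgFactor (n + 1) : ℕ) : ℝ))) := by push_cast; ring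
    _ ≤ 44 * 288000 * (5 * log m * (4 * m * (5 * log m * (60 * log (log m))))) := by
        gcongr
    _ = (44 * 288000 * 6000) * (m * log m ^ 2 * log (log m)) := by ring
    _ ≤ _ := by
        gcongr
        norm_num

/-- The `b S / K` of the cost formulas is the width `c` of a block. -/
theorem mul_width (p : Params) : (p.a : ℝ) * p.b * ((p.S : ℝ) / p.K) = p.a * p.c := by
  have hK : (p.K : ℝ) ≠ 0 := Nat.cast_ne_zero.2 (by have := p.K_pos; omega)
  have h : (p.K : ℝ) * p.c = p.S * p.b := by exact_mod_cast p.block_width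
  field_simp
  linear_combination -(p.a : ℝ) * h

theorem exists_decoder (F : Type u) [Field F] (p : Params) (d : ℕ) (hm : 3 ≤ mHat p d) :
    ∃ T : CompTree F (DecoderInput p d) (DecoderOutput p),
      DecodesWithin T (3 * 10 ^ 11 * (p.a * p.b * ((p.S : ℝ) / p.K) * mHat p d
        * log (mHat p d) ^ 2 * log (log (mHat p d)))) := by
  set m := mHat p d with hmdef
  obtain ⟨T, hT⟩ := exists_decodesWithin F p d (n := Nat.log 2 m + 1)
    (Nat.lt_pow_succ_log_self (by norm_num) _)
  refine ⟨T, fun s h hd w v mk κ Z hZ => ?_⟩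
  obtain ⟨h1, h2⟩ := hT s h hd w v mk κ Z hZ
  refine ⟨h1, h2.trans ?_⟩
  have hpow : 2 ^ (Nat.log 2 m + 1) ≤ 2 * m := by
    rw [pow_succ, mul_comm]
    exact Nat.mul_le_mul le_rfl (Nat.pow_log_le_self 2 (by omega))
  have hc := decoding_cost_le hm hpow
  rw [mul_width]
  calc ((3 * (p.a * p.c * ((Nat.log 2 m + 1 + 2) * (44 * mulCost (Nat.log 2 m + 1 + 1)))) : ℕ) : ℝ)
      = 3 * (p.a * p.c) *
        (((Nat.log 2 m + 1 + 2) * (44 * mulCost (Nat.log 2 m + 1 + 1)) : ℕ) : ℝ) := by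
        push_cast; ring
    _ ≤ 3 * (p.a * p.c) * (10 ^ 11 * (m * log m ^ 2 * log (log m))) := by gcongr
    _ = _ := by ring

end Complexity

/-! ### Entropy -/

section Entropy

variable {T : Type u} [Fintype T]

theorem sum_toReal_pmf (law : PMF T) : ∑ x, (law x).toReal = 1 := by
  rw [← ENNReal.toReal_sum fun x _ => law.apply_ne_top x,
    ← tsum_fintype (L := .unconditional T), law.tsum_coe, ENNReal.toReal_one]

theorem pmf_eq_uniform_iff [Nonempty T] (law : PMF T) :
    law = PMF.uniformOfFintype T ↔ ∀ x, (law x).toReal = (Fintype.card T : ℝ)⁻¹ := by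
  constructor
  · rintro rfl x
    simp
  · intro h
    ext x
    rw [PMF.uniformOfFintype_apply,
      ← ENNReal.toReal_eq_toReal_iff' (law.apply_ne_top x) (by simp), h]
    simp

/-- Jensen's inequality for the strictly concave function `x ↦ - x log x`. -/
theorem sum_negMulLog_le [Nonempty T] (law : PMF T) :
    ∑ x, Real.negMulLog (law x).toReal ≤ Real.log (Fintype.card T) ∧
      (∑ x, Real.negMulLog (law x).toReal = Real.log (Fintype.card T) ↔
        law = PMF.uniformOfFintype T) := by
  set n : ℝ := (Fintype.card T : ℝ) with hn
  have hpos : 0 < n := Nat.cast_pos.2 Fintype.card_pos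
  have hw : ∑ _x : T, n⁻¹ = 1 := by
    rw [Finset.sum_const, Finset.card_univ, nsmul_eq_mul, mul_inv_cancel₀ hpos.ne']
  have hmean : ∑ x, n⁻¹ • (law x).toReal = n⁻¹ := by
    simp only [smul_eq_mul]
    rw [← Finset.mul_sum, sum_toReal_pmf, mul_one]
  have hsum : ∑ x, n⁻¹ • Real.negMulLog (law x).toReal
      = n⁻¹ * ∑ x, Real.negMulLog (law x).toReal := by
    simp only [smul_eq_mul]
    rw [← Finset.mul_sum]
  have hval : Real.negMulLog n⁻¹ = n⁻¹ * Real.log n := by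
    rw [Real.negMulLog, Real.log_inv]; ring
  have hle := Real.strictConcaveOn_negMulLog.concaveOn.le_map_sum (t := Finset.univ)
    (w := fun _ => n⁻¹) (p := fun x => (law x).toReal) (fun _ _ => (inv_pos.2 hpos).le) hw
    fun x _ => ENNReal.toReal_nonneg
  have heq := Real.strictConcaveOn_negMulLog.map_sum_eq_iff (t := Finset.univ)
    (w := fun _ => n⁻¹) (p := fun x => (law x).toReal) (fun _ _ => inv_pos.2 hpos) hw
    fun x _ => ENNReal.toReal_nonneg
  rw [hmean, hsum, hval] at hle heq
  refine ⟨le_of_mul_le_mul_left hle (inv_pos.2 hpos), ?_⟩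
  rw [pmf_eq_uniform_iff]
  have h1 : ∑ x, Real.negMulLog (law x).toReal = Real.log n ↔
      n⁻¹ * Real.log n = n⁻¹ * ∑ x, Real.negMulLog (law x).toReal := by
    rw [mul_right_inj' (inv_ne_zero hpos.ne')]
    exact eq_comm
  rw [h1, heq]
  simp [hn]

variable (F : Type u) [Field F] [Fintype F]

theorem log_card_pos : 0 < Real.log (Fintype.card F) :=
  Real.log_pos (Nat.one_lt_cast.2 Fintype.one_lt_card)

theorem entropy_le_messageSize [Nonempty T] (law : PMF T) :
    entropy F law ≤ messageSize F T ∧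
      (entropy F law = messageSize F T ↔ law = PMF.uniformOfFintype T) := by
  have h := sum_negMulLog_le law
  have hq := log_card_pos F
  rw [entropy, messageSize, Real.logb]
  exact ⟨div_le_div_of_nonneg_right h.1 hq.le, by rw [div_left_inj' hq.ne']; exact h.2⟩

theorem messageSize_block (p : Params) : messageSize F (Block F p) = p.a * p.c := by
  have h : Fintype.card (Block F p) = Fintype.card F ^ (p.a * p.c) := by
    rw [Fintype.card_congr (Matrix.of (m := Fin p.a) (n := Fin p.c) (α := F)).symm,
      Fintype.card_fun, Fintype.card_fun, Fintype.card_fin, Fintype.card_fin, ← pow_mul, mul_comm]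
  have hq := log_card_pos F
  rw [messageSize, h, Real.logb, Nat.cast_pow, Real.log_pow, mul_div_assoc, div_self hq.ne',
    mul_one, Nat.cast_mul]

end Entropy

/-! ### Uniformly distributed shares and responses -/

section Uniform

/-- A function on a finite set is uniformly distributed if its values are shifted arbitrarily by
permutations of the set. -/
theorem map_uniform_of_shift {Ω T : Type*} [Fintype Ω] [Nonempty Ω] [Fintype T] [AddGroup T]
    (φ : Ω → T) (σ : T → Equiv.Perm Ω) (h : ∀ B m, φ (σ B m) = φ m + B) :
    (PMF.uniformOfFintype Ω).map φ = PMF.uniformOfFintype T := by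
  classical
  set law := (PMF.uniformOfFintype Ω).map φ with hlaw
  have hσ : ∀ B, (PMF.uniformOfFintype Ω).map (σ B) = PMF.uniformOfFintype Ω := by
    intro B
    ext x
    rw [PMF.map_apply, tsum_eq_single ((σ B).symm x)]
    · simp
    · intro y hy
      rw [if_neg]
      rintro rfl
      simp at hy
  have hshift : ∀ B, law B = law 0 := by
    intro B
    have h1 : law.map (fun t => t + B) = law := by
      conv_rhs => rw [hlaw, ← hσ B, PMF.map_comp]
      rw [hlaw, PMF.map_comp]
      congr 1
      ext1 m
      exact (h B m).symm
    conv_lhs => rw [← h1, PMF.map_apply]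
    rw [tsum_eq_single 0]
    · rw [if_pos (zero_add B).symm]
    · intro t ht
      rw [if_neg fun h2 => ht (right_eq_add.1 h2)]
  ext B
  have hsum := law.tsum_coe
  rw [tsum_fintype, Finset.sum_congr rfl fun t _ => hshift t, Finset.sum_const, Finset.card_univ,
    nsmul_eq_mul, mul_comm] at hsum
  rw [hshift, PMF.uniformOfFintype_apply]
  exact ENNReal.eq_inv_of_mul_eq_one_left hsum

variable {F : Type u} [Field F] {p : Params}

/-- Some mask contributes to the share of worker `k`: as `α_k` is not among `β_1, …, β_K`, the
polynomials `ℓ_{K+t}` vanish at `α_k` except for one of them if `α_k = β_{K+t}`, and none of them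
vanishes at `α_k` otherwise. -/
theorem exists_lagrange_ne_zero (s : Points F p) (hX : 1 ≤ p.X) (k : Fin p.N) :
    ∃ t : Fin p.X, lagrange s (Fin.natAdd p.K t) (s.α k) ≠ 0 := by
  obtain ⟨t, ht⟩ : ∃ t : Fin p.X, ∀ l, l ≠ Fin.natAdd p.K t → s.α k ≠ s.β l := by
    by_cases h : ∃ t : Fin p.X, s.α k = s.β (Fin.natAdd p.K t)
    · obtain ⟨t, ht⟩ := h
      exact ⟨t, fun l hl hk => hl (s.β_injective (hk.symm.trans ht))⟩
    · push Not at h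
      refine ⟨⟨0, hX⟩, fun l _ => ?_⟩
      refine Fin.addCases (fun j => ?_) (fun t => ?_) l
      exacts [s.disjoint k j, h t]
  refine ⟨t, ?_⟩
  rw [lagrange, Lagrange.basis, eval_prod, Finset.prod_ne_zero_iff]
  intro l hl
  have hl' := Finset.ne_of_mem_erase hl
  rw [Lagrange.basisDivisor, eval_mul, eval_C, eval_sub, eval_X, eval_C]
  exact mul_ne_zero (inv_ne_zero (sub_ne_zero.2 fun h => hl' (s.β_injective h).symm))
    (sub_ne_zero.2 (ht l hl'))

theorem sum_smul_shift {X : ℕ} (ℓ : Fin X → F) {t : Fin X} (ht : ℓ t ≠ 0)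
    (Q : Fin X → Block F p) (B : Block F p) :
    ∑ t', ℓ t' • (Q + (Pi.single t ((ℓ t)⁻¹ • B) : Fin X → Block F p)) t'
      = (∑ t', ℓ t' • Q t') + B := by
  simp only [Pi.add_apply, smul_add, Finset.sum_add_distrib]
  congr 1
  rw [Finset.sum_eq_single t, Pi.single_eq_same, smul_smul, mul_inv_cancel₀ ht, one_smul]
  · intro t' _ h
    rw [Pi.single_eq_of_ne h, smul_zero]
  · exact fun h => absurd (Finset.mem_univ t) h

/-- The masks of source `i` with index `t` are shifted such that the share of worker `k` is shifted
by `B`. -/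
def shiftSource (s : Points F p) (k : Fin p.N) (i : Fin p.S) (t : Fin p.X) (B : Block F p) :
    Equiv.Perm (Masks F p) :=
  Equiv.addRight (Pi.single i (Pi.single t ((lagrange s (Fin.natAdd p.K t) (s.α k))⁻¹ • B)), 0)

theorem sourceEncode_shiftSource (s : Points F p) {k : Fin p.N} (i : Fin p.S) {t : Fin p.X}
    (ht : lagrange s (Fin.natAdd p.K t) (s.α k) ≠ 0) (w : SourceData F p) (B : Block F p)
    (m : Masks F p) (i' : Fin p.S) :
    sourceEncode s w (shiftSource s k i t B m).1 i' (s.α k)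
      = sourceEncode s w m.1 i' (s.α k) + if i' = i then B else 0 := by
  rw [sourceEncode, sourceEncode, shiftSource, Equiv.coe_addRight, Prod.fst_add, Pi.add_apply]
  dsimp only
  split_ifs with h
  · subst h
    rw [Pi.single_eq_same,
      sum_smul_shift (fun t => lagrange s (Fin.natAdd p.K t) (s.α k)) ht, add_right_comm]
  · rw [Pi.single_eq_of_ne h, add_zero, add_zero]

variable [Fintype F]

theorem jointLaw_map_uniform {T : Type u} [Fintype T] [Nonempty T]
    (data : PMF (SourceData F p × UserData F p))
    (φ : (SourceData F p × UserData F p) × Masks F p → T)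
    (h : ∀ d, (PMF.uniformOfFintype (Masks F p)).map (fun m => φ (d, m))
      = PMF.uniformOfFintype T) :
    (jointLaw data).map φ = PMF.uniformOfFintype T := by
  rw [jointLaw, PMF.map_bind]
  simp only [PMF.map_comp]
  exact (congrArg data.bind (funext h)).trans (PMF.bind_const _ _)

theorem sourceShareLaw_eq_uniform (s : Points F p) (data : PMF (SourceData F p × UserData F p))
    (hX : 1 ≤ p.X) (i : Fin p.S) (k : Fin p.N) :
    sourceShareLaw s data i k = PMF.uniformOfFintype (Block F p) := by
  obtain ⟨t, ht⟩ := exists_lagrange_ne_zero s hX k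
  refine jointLaw_map_uniform data _ fun d =>
    map_uniform_of_shift _ (shiftSource s k i t) fun B m => ?_
  rw [sourceEncode_shiftSource s i ht, if_pos rfl]

theorem userShareLaw_eq_uniform (s : Points F p) (data : PMF (SourceData F p × UserData F p))
    (hX : 1 ≤ p.X) (k : Fin p.N) :
    userShareLaw s data k = PMF.uniformOfFintype (Block F p) := by
  obtain ⟨t, ht⟩ := exists_lagrange_ne_zero s hX k
  refine jointLaw_map_uniform data _ fun d => map_uniform_of_shift _
    (fun B => Equiv.addRight
      (0, Pi.single t ((lagrange s (Fin.natAdd p.K t) (s.α k))⁻¹ • B))) fun B m => ?_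
  rw [userEncode, userEncode, Equiv.coe_addRight, Prod.snd_add,
    sum_smul_shift (fun t => lagrange s (Fin.natAdd p.K t) (s.α k)) ht, add_assoc]

/-- The polynomial map `h(x, y) = x + y^d`, with the power taken entrywise. It is of degree `d`, and
a shift of `x` shifts its value, so that a uniform mask in `x` makes the value uniform. -/
def addPow (F : Type u) [Field F] (p : Params) (d : ℕ) : PolyMap F p := fun r t =>
  MvPolynomial.X (Sum.inl (r, t)) + MvPolynomial.X (Sum.inr (r, t)) ^ d

theorem width_pos (p : Params) : 0 < p.c := by
  refine Nat.pos_of_ne_zero fun h => ?_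
  have h1 := p.block_width
  have h2 : 0 < p.S * p.b := Nat.mul_pos p.S_pos p.b_pos
  rw [h, mul_zero] at h1
  omega

theorem deg_addPow (F : Type u) [Field F] (p : Params) {d : ℕ} (hd : 1 ≤ d) :
    (addPow F p d).deg = d := by
  have hentry : ∀ e : Fin p.a × Fin p.c, (addPow F p d e.1 e.2).totalDegree = d := by
    intro e
    refine le_antisymm ?_ ?_
    · refine (MvPolynomial.totalDegree_add _ _).trans (max_le ?_ ?_)
      · rw [MvPolynomial.totalDegree_X]; exact hd
      · rw [MvPolynomial.totalDegree_X_pow]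
    · have hmem : Finsupp.single (Sum.inr e) d ∈ (addPow F p d e.1 e.2).support := by
        rw [MvPolynomial.mem_support_iff, addPow, MvPolynomial.coeff_add,
          MvPolynomial.coeff_X_pow, if_pos rfl, MvPolynomial.coeff_X, if_neg, zero_add]
        · exact one_ne_zero
        · intro h
          have := DFunLike.congr_fun h (Sum.inl e)
          simp at this
      have := MvPolynomial.le_totalDegree hmem
      rwa [Finsupp.sum_single_index rfl] at this
  rw [PolyMap.deg, Finset.sup_congr rfl fun e _ => hentry e]
  exact Finset.sup_const ⟨(⟨0, p.a_pos⟩, ⟨0, width_pos p⟩), Finset.mem_univ _⟩ d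

theorem responseLaw_addPow (s : Points F p) (data : PMF (SourceData F p × UserData F p))
    (hX : 1 ≤ p.X) (d : ℕ) (k : Fin p.N) :
    responseLaw s (addPow F p d) data k = PMF.uniformOfFintype (Block F p) := by
  obtain ⟨t, ht⟩ := exists_lagrange_ne_zero s hX k
  refine jointLaw_map_uniform data _ fun d =>
    map_uniform_of_shift _ (shiftSource s k ⟨0, p.S_pos⟩ t) fun B m => ?_
  have hm : (shiftSource s k ⟨0, p.S_pos⟩ t B m).2 = m.2 := add_zero _
  ext r j
  simp only [response, PolyMap.apply, addPow, hm, sourceEncode_shiftSource s _ ht,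
    Finset.sum_add_distrib, Finset.sum_ite_eq', Finset.mem_univ, if_true, Matrix.of_apply,
    Matrix.add_apply, map_add, map_pow, MvPolynomial.eval_X, Sum.elim_inl, Sum.elim_inr]
  ring

end Uniform

/-! ### Communication costs -/

section Costs

variable {F : Type u} [Field F] [Fintype F] {p : Params}

theorem entropy_uniform_block :
    entropy F (PMF.uniformOfFintype (Block F p)) = p.a * p.c := by
  rw [← messageSize_block F p]
  exact (entropy_le_messageSize F _).2.2 rfl

theorem threshold_cast (p : Params) (d : ℕ) :
    (threshold p d : ℝ) = ((p.K : ℝ) + p.X - 1) * d + 2 * p.A + 1 := by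
  have := p.K_pos
  rw [threshold, mHat, Nat.cast_add, Nat.cast_add, Nat.cast_mul, Nat.cast_sub (by omega)]
  push_cast
  ring

theorem nonempty_card_eq {N M : ℕ} (h : M ≤ N) :
    Nonempty {𝒦 : Finset (Fin N) // 𝒦.card = M} := by
  obtain ⟨𝒦, -, h𝒦⟩ := Finset.exists_subset_card_eq (s := (Finset.univ : Finset (Fin N)))
    (n := M) (by rwa [Finset.card_fin])
  exact ⟨⟨𝒦, h𝒦⟩⟩

theorem downloadSize_eq (d : ℕ) (hN : threshold p d ≤ p.N) :
    downloadSize F p d = threshold p d * (p.a * p.c) := by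
  have := nonempty_card_eq hN
  rw [downloadSize]
  refine (congrArg iSup (funext fun 𝒦 => ?_)).trans ciSup_const
  rw [Finset.sum_const, 𝒦.2, nsmul_eq_mul, messageSize_block]

theorem downloadCost_le (s : Points F p) (h : PolyMap F p)
    (data : PMF (SourceData F p × UserData F p)) (hN : threshold p h.deg ≤ p.N) :
    downloadCost s h data ≤ threshold p h.deg * (p.a * p.c) ∧
      (downloadCost s h data = threshold p h.deg * (p.a * p.c) ↔
        ∃ 𝒦 : Finset (Fin p.N), 𝒦.card = threshold p h.deg ∧
          ∀ k ∈ 𝒦, responseLaw s h data k = PMF.uniformOfFintype (Block F p)) := by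
  have := nonempty_card_eq hN
  have hk : ∀ k, entropy F (responseLaw s h data k) ≤ p.a * p.c := fun k => by
    rw [← messageSize_block F p]; exact (entropy_le_messageSize F _).1
  have hconst : ∀ 𝒦 : {𝒦 : Finset (Fin p.N) // 𝒦.card = threshold p h.deg},
      ∑ _k ∈ 𝒦.1, ((p.a : ℝ) * p.c) = threshold p h.deg * (p.a * p.c) := fun 𝒦 => by
    rw [Finset.sum_const, 𝒦.2, nsmul_eq_mul]
  have hle : downloadCost s h data ≤ threshold p h.deg * (p.a * p.c) :=
    ciSup_le fun 𝒦 => (Finset.sum_le_sum fun k _ => hk k).trans_eq (hconst 𝒦)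
  refine ⟨hle, fun heq => ?_, fun ⟨𝒦, hcard, hunif⟩ => le_antisymm hle ?_⟩
  · obtain ⟨𝒦, h𝒦⟩ := exists_eq_ciSup_of_finite
      (f := fun 𝒦 : {𝒦 : Finset (Fin p.N) // 𝒦.card = threshold p h.deg} =>
        ∑ k ∈ 𝒦.1, entropy F (responseLaw s h data k))
    have h1 : ∑ k ∈ 𝒦.1, entropy F (responseLaw s h data k) = ∑ _k ∈ 𝒦.1, ((p.a : ℝ) * p.c) :=
      h𝒦.trans (heq.trans (hconst 𝒦).symm)
    refine ⟨𝒦.1, 𝒦.2, fun k hk𝒦 => (entropy_le_messageSize F _).2.1 ?_⟩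
    rw [messageSize_block]
    exact (Finset.sum_eq_sum_iff_of_le fun k _ => hk k).1 h1 k hk𝒦
  · refine le_trans (le_of_eq ?_) (le_ciSup (f := fun 𝒦 : {𝒦 : Finset (Fin p.N) //
      𝒦.card = threshold p h.deg} => ∑ k ∈ 𝒦.1, entropy F (responseLaw s h data k))
      (Set.finite_range _).bddAbove ⟨𝒦, hcard⟩)
    rw [← hconst ⟨𝒦, hcard⟩]
    exact Finset.sum_congr rfl fun k hk𝒦 => by rw [hunif k hk𝒦, entropy_uniform_block]

end Costs

end PolyComputing

end

theorem theorem3p2 :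
    -- upload costs
    (∀ (F : Type u) [Field F] [Fintype F] (p : PolyComputing.Params)
        (s : PolyComputing.Points F p)
        (data : PMF (PolyComputing.SourceData F p × PolyComputing.UserData F p)),
        1 ≤ p.X →
          (∀ i : Fin p.S, PolyComputing.sourceUploadCost s data i
            = (p.N : ℝ) * p.a * p.b * ((p.S : ℝ) / p.K)) ∧
          PolyComputing.userUploadCost s data
            = (p.N : ℝ) * p.a * p.b * ((p.S : ℝ) / p.K)) ∧
    -- download cost, as the size of the downloaded messages
    (∀ (F : Type u) [Field F] [Fintype F] (p : PolyComputing.Params) (d : ℕ),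
        PolyComputing.threshold p d ≤ p.N →
          PolyComputing.downloadSize F p d
            = (((p.K : ℝ) + p.X - 1) * d + 2 * p.A + 1) * p.a * p.b * ((p.S : ℝ) / p.K)) ∧
    -- download cost, as entropy: the same value is an upper bound, and when it is attained
    (∀ (F : Type u) [Field F] [Fintype F] (p : PolyComputing.Params)
        (s : PolyComputing.Points F p) (h : PolyComputing.PolyMap F p)
        (data : PMF (PolyComputing.SourceData F p × PolyComputing.UserData F p)),
        PolyComputing.threshold p h.deg ≤ p.N →
          PolyComputing.downloadCost s h data
            ≤ (((p.K : ℝ) + p.X - 1) * h.deg + 2 * p.A + 1) * p.a * p.b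
                * ((p.S : ℝ) / p.K) ∧
          (PolyComputing.downloadCost s h data
            = (((p.K : ℝ) + p.X - 1) * h.deg + 2 * p.A + 1) * p.a * p.b
                * ((p.S : ℝ) / p.K) ↔
            ∃ 𝒦 : Finset (Fin p.N), 𝒦.card = PolyComputing.threshold p h.deg ∧
              ∀ k ∈ 𝒦, PolyComputing.responseLaw s h data k
                = PMF.uniformOfFintype (PolyComputing.Block F p))) ∧
    -- in every positive degree the bound is attained by some polynomial map
    (∀ (F : Type u) [Field F] [Fintype F] (p : PolyComputing.Params) (d : ℕ),
        1 ≤ p.X → 1 ≤ d → PolyComputing.threshold p d ≤ p.N →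
          ∃ h : PolyComputing.PolyMap F p, h.deg = d ∧
            ∀ (s : PolyComputing.Points F p)
              (data : PMF (PolyComputing.SourceData F p × PolyComputing.UserData F p)),
              PolyComputing.downloadCost s h data
                = (((p.K : ℝ) + p.X - 1) * d + 2 * p.A + 1) * p.a * p.b
                    * ((p.S : ℝ) / p.K)) ∧
    -- decoding complexity, with an absolute constant
    (∃ C : ℝ, 0 < C ∧
      ∀ (F : Type u) [Field F] [Fintype F] (p : PolyComputing.Params) (d : ℕ),
        3 ≤ PolyComputing.mHat p d →
          ∃ T : PolyComputing.CompTree F (PolyComputing.DecoderInput p d)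
              (PolyComputing.DecoderOutput p),
            PolyComputing.DecodesWithin T
              (C * (p.a * p.b * ((p.S : ℝ) / p.K) * PolyComputing.mHat p d
                * Real.log (PolyComputing.mHat p d) ^ 2
                * Real.log (Real.log (PolyComputing.mHat p d))))) := by
  -- an operation count of `10 ^ 11 ⋯` as in `decoding_cost_le`, times three: besides performing the
  -- operation, a tree may have to load its operands
  refine ⟨fun F _ _ p s data hX => ?_, fun F _ _ p d hN => ?_, fun F _ _ p s h data hN => ?_,
    fun F _ _ p d hX hd hN => ?_, 3 * 10 ^ 11, by norm_num,
    fun F _ _ p d hm => PolyComputing.exists_decoder F p d hm⟩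
  · rw [mul_assoc (p.N : ℝ), mul_assoc (p.N : ℝ), PolyComputing.mul_width]
    refine ⟨fun i => ?_, ?_⟩
    · simp only [PolyComputing.sourceUploadCost,
        PolyComputing.sourceShareLaw_eq_uniform s data hX, PolyComputing.entropy_uniform_block,
        Finset.sum_const, Finset.card_fin, nsmul_eq_mul]
    · simp only [PolyComputing.userUploadCost, PolyComputing.userShareLaw_eq_uniform s data hX,
        PolyComputing.entropy_uniform_block, Finset.sum_const, Finset.card_fin, nsmul_eq_mul]
  · rw [mul_assoc, mul_assoc, ← mul_assoc (p.a : ℝ), PolyComputing.mul_width,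
      ← PolyComputing.threshold_cast]
    exact PolyComputing.downloadSize_eq d hN
  · rw [mul_assoc, mul_assoc, ← mul_assoc (p.a : ℝ), PolyComputing.mul_width,
      ← PolyComputing.threshold_cast]
    exact PolyComputing.downloadCost_le s h data hN
  · have hdeg := PolyComputing.deg_addPow F p hd
    refine ⟨PolyComputing.addPow F p d, hdeg, fun s data => ?_⟩
    rw [mul_assoc, mul_assoc, ← mul_assoc (p.a : ℝ), PolyComputing.mul_width,
      ← PolyComputing.threshold_cast]
    have hN' : PolyComputing.threshold p (PolyComputing.addPow F p d).deg ≤ p.N := by rwa [hdeg]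
    have hcost := (PolyComputing.downloadCost_le s (PolyComputing.addPow F p d) data hN').2
    rw [hdeg] at hcost
    obtain ⟨𝒦, h𝒦⟩ := PolyComputing.nonempty_card_eq hN
    exact hcost.2 ⟨𝒦, h𝒦, fun k _ => PolyComputing.responseLaw_addPow s data hX d k⟩
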